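/- Let $M$ be a von Neumann algebra with a faithful normal tracial state $\tau$, and let $A\subset M$ be a diffuse (i.e. without minimal projections) abelian von Neumann subalgebra with the same unit. Let $L^2(M)$ be the Hilbert space of the GNS construction of $\tau$, with left and right actions $\pi(a)x=ax$ and $\rho(a)x=xa$ of $M$, and let $L^2(A)$ be the closure of $A$ in $L^2(M)$. Suppose that there are a nonzero complex Hilbert space $\mathcal K$ and an isomorphism of $A$-bimodules (a unitary that intertwines the left and right actions of $A$) $$L^2(M)\;\simeq\; L^2(A)\,\oplus\,\bigl(L^2(A)\otimes\mathcal K\otimes L^2(A)\bigr),\qquad a\cdot(x\otimes k\otimes y)\cdot b=ax\otimes k\otimes yb .$$ Then: 1. $M$ is a II$_1$ factor (a finite factor without minimal projections). 2. $A$ is a maximal abelian von Neumann subalgebra of $M$. 3. $A$ is singular: the von Neumann algebra generated by the unitaries $u\in M$ with $uAu^*=A$ is $A$. 4. The Pukánszky invariant of $A\subset M$ is $\{\dim\mathcal K\}$. Here the Pukánszky invariant is the set of all $n\in\mathbb N\cup\{\infty\}$ such that the commutant of $\{\pi(A),\rho(A)\}''$ acting on $L^2(M)\ominus L^2(A)$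 has a nonzero direct summand of type I$_n$; all infinite cardinals are written $\infty$. 5. If $L^2(M)$ is separable, then $A$ is Takesaki simple in $M$. That is: let $B\subset M$ be any norm-separable, ultraweakly dense $C^*$-subalgebra; let $(Y,\nu)$ be any standard Borel probability space with a $*$-isomorphism $A\simeq L^\infty(Y,\nu)$, $a\mapsto f_a$; let $L^2(M)=\int_Y^\oplus\mathcal H_t\,d\nu(t)$ be any disintegration over a measurable field of Hilbert spaces for which each $\rho(a)$, $a\in A$, is the diagonal operator of multiplication by $f_a$; and let $(\pi_t)_{t\in Y}$ be any measurable field of representations of $B$ on $(\mathcal H_t)_{t\in Y}$ with $\pi|_B=\int_Y^\oplus\pi_t\,d\nu(t)$. Then there is a Borel set $N\subset Y$ with $\nu(N)=0$ such that for all $s,t\in Y\setminus N$ the representations $\pi_s$ and $\pi_t$ are unitarily equivalent if and only if $s=t$. -/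

import Mathlib

open MeasureTheory
open scoped ComplexOrder InnerProductSpace TensorProduct ENNReal

universe u v

noncomputable section

namespace CoarseMasa

/-! ### Hilbert space tensor products -/

section Tensor

variable (E : Type u) [NormedAddCommGroup E] [InnerProductSpace ℂ E]
  (K : Type v) [NormedAddCommGroup K] [InnerProductSpace ℂ K]

/-- The Hilbert space tensor product `E ⊗ K ⊗ E`. -/
def TripleTensor : Type (max u v) := UniformSpace.Completion (E ⊗[ℂ] (K ⊗[ℂ] E))

instance : NormedAddCommGroup (TripleTensor E K) :=
  inferInstanceAs (NormedAddCommGroup (UniformSpace.Completion (E ⊗[ℂ] (K ⊗[ℂ] E))))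
instance : InnerProductSpace ℂ (TripleTensor E K) :=
  inferInstanceAs (InnerProductSpace ℂ (UniformSpace.Completion (E ⊗[ℂ] (K ⊗[ℂ] E))))
instance : CompleteSpace (TripleTensor E K) :=
  inferInstanceAs (CompleteSpace (UniformSpace.Completion (E ⊗[ℂ] (K ⊗[ℂ] E))))

variable {E K}

/-- The elementary tensor `x ⊗ k ⊗ y`. -/
def tmul (x : E) (k : K) (y : E) : TripleTensor E K :=
  ((x ⊗ₜ[ℂ] (k ⊗ₜ[ℂ] y) : E ⊗[ℂ] (K ⊗[ℂ] E)) : UniformSpace.Completion (E ⊗[ℂ] (K ⊗[ℂ] E)))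

theorem inner_tmul (x x' : E) (k k' : K) (y y' : E) :
    ⟪tmul x k y, tmul x' k' y'⟫_ℂ = ⟪x, x'⟫_ℂ * (⟪k, k'⟫_ℂ * ⟪y, y'⟫_ℂ) :=
  (UniformSpace.Completion.inner_coe _ _).trans (by simp)

end Tensor

section Operators

variable {H : Type u} [NormedAddCommGroup H] [InnerProductSpace ℂ H] [CompleteSpace H]

/-! ### A von Neumann algebra as an ordered C⋆-algebra -/

instance : SMulMemClass (VonNeumannAlgebra H) ℂ (H →L[ℂ] H) where
  smul_mem {S} c _ hx := S.toStarSubalgebra.smul_mem hx c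

instance isClosed_coe (M : VonNeumannAlgebra H) : IsClosed (M : Set (H →L[ℂ] H)) := by
  rw [← M.centralizer_centralizer]
  exact Set.isClosed_centralizer _

/-- For the Loewner order inherited from the bounded operators, the positive elements of `M` are
the elements `s⋆ s` with `s ∈ M`. -/
instance (M : VonNeumannAlgebra H) : StarOrderedRing M := by
  refine StarOrderedRing.of_nonneg_iff' ?_ ?_
  · intro x y h z
    exact add_le_add (α := H →L[ℂ] H) (le_refl (z : H →L[ℂ] H)) h
  · intro x
    constructor
    · intro hx
      have hx' : (0 : H →L[ℂ] H) ≤ (x : H →L[ℂ] H) := hx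
      have hmem : CFC.sqrt (x : H →L[ℂ] H) ∈ M := by
        rw [CFC.sqrt_eq_real_sqrt _ hx']
        exact cfcₙ_mem _ x.2
      refine ⟨⟨CFC.sqrt (x : H →L[ℂ] H), hmem⟩, Subtype.ext ?_⟩
      have hs : IsSelfAdjoint (CFC.sqrt (x : H →L[ℂ] H)) :=
        IsSelfAdjoint.of_nonneg (CFC.sqrt_nonneg _)
      change (x : H →L[ℂ] H) = star (CFC.sqrt (x : H →L[ℂ] H)) * CFC.sqrt (x : H →L[ℂ] H)
      rw [hs.star_eq, CFC.sqrt_mul_sqrt_self _ hx']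
    · rintro ⟨s, rfl⟩
      exact star_mul_self_nonneg (s : H →L[ℂ] H)

/-! ### Traces and the standard bimodule -/

/-- A faithful normal tracial state on `M`. Normality is ultraweak continuity:
`τ x = ∑ₙ ⟪ξₙ, x ηₙ⟫` for two square-summable sequences of vectors. -/
structure Trace (M : VonNeumannAlgebra H) where
  toFunctional : M →ₚ[ℂ] ℂ
  map_one : toFunctional 1 = 1
  map_mul_comm : ∀ x y : M, toFunctional (x * y) = toFunctional (y * x)
  faithful : ∀ x : M, toFunctional (star x * x) = 0 → x = 0
  normal : ∃ ξ η : lp (fun _ : ℕ => H) 2,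
    ∀ x : M, toFunctional x = ∑' n, ⟪ξ n, (x : H →L[ℂ] H) (η n)⟫_ℂ

variable {M : VonNeumannAlgebra H} (τ : Trace M)

/-- `L²(M)`, the Hilbert space of the GNS construction of the trace, with
`⟪x, y⟫ = τ (x⋆ y)` on `M`. -/
def Trace.L2 : Type u := τ.toFunctional.GNS

instance : NormedAddCommGroup τ.L2 := inferInstanceAs (NormedAddCommGroup τ.toFunctional.GNS)
instance : InnerProductSpace ℂ τ.L2 := inferInstanceAs (InnerProductSpace ℂ τ.toFunctional.GNS)
instance : CompleteSpace τ.L2 := inferInstanceAs (CompleteSpace τ.toFunctional.GNS)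

/-- The canonical image of `x ∈ M` in `L²(M)`. -/
def Trace.vec (x : M) : τ.L2 :=
  ((τ.toFunctional.toPreGNS x : τ.toFunctional.PreGNS) : τ.toFunctional.GNS)

/-- The left action `π` of `M` on `L²(M)`: `π(a) x = a x`. -/
def Trace.left : M →⋆ₐ[ℂ] (τ.L2 →L[ℂ] τ.L2) := τ.toFunctional.gnsStarAlgHom

/-- Right multiplication by `a` on `M` with the norm of the trace. -/
def Trace.rightPre (a : M) : τ.toFunctional.PreGNS →L[ℂ] τ.toFunctional.PreGNS :=
  (τ.toFunctional.toPreGNS.toLinearMap ∘ₗ LinearMap.mulRight ℂ a ∘ₗ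
    τ.toFunctional.ofPreGNS.toLinearMap).mkContinuous ‖a‖ fun x => by
      have key : ∀ z : M, ‖τ.toFunctional.toPreGNS z‖ = ‖τ.toFunctional.toPreGNS (star z)‖ :=
        fun z => by
          rw [PositiveLinearMap.preGNS_norm_def, PositiveLinearMap.preGNS_norm_def]
          simp only [PositiveLinearMap.ofPreGNS_toPreGNS, star_star]
          rw [τ.map_mul_comm]
      have h1 := key (τ.toFunctional.ofPreGNS x * a)
      have h2 := key (τ.toFunctional.ofPreGNS x)
      have h3 := (τ.toFunctional.leftMulMapPreGNS (star a)).le_of_opNorm_le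
        (LinearMap.mkContinuous_norm_le _ (norm_nonneg _) _)
        (τ.toFunctional.toPreGNS (star (τ.toFunctional.ofPreGNS x)))
      rw [norm_star, ← h2] at h3
      rw [star_mul] at h1
      exact h1.le.trans h3

/-- The right action `ρ` of `M` on `L²(M)`: `ρ(a) x = x a`. -/
def Trace.right (a : M) : τ.L2 →L[ℂ] τ.L2 := (τ.rightPre a).completion

theorem Trace.left_vec (a x : M) : τ.left a (τ.vec x) = τ.vec (a * x) :=
  ContinuousLinearMap.completion_apply_coe _ _

theorem Trace.right_vec (a x : M) : τ.right a (τ.vec x) = τ.vec (x * a) :=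
  ContinuousLinearMap.completion_apply_coe _ _

theorem Trace.inner_vec (x y : M) : ⟪τ.vec x, τ.vec y⟫_ℂ = τ.toFunctional (star x * y) :=
  UniformSpace.Completion.inner_coe _ _

variable (A : VonNeumannAlgebra H)

/-- `L²(A)`, realised as the closure of `A` in `L²(M)`. -/
def Trace.L2sub : Submodule ℂ τ.L2 :=
  (Submodule.span ℂ {ξ | ∃ a : M, (a : H →L[ℂ] H) ∈ A ∧ τ.vec a = ξ}).topologicalClosure

theorem Trace.mem_L2sub_of_map {T : τ.L2 →L[ℂ] τ.L2}
    (hT : ∀ a : M, (a : H →L[ℂ] H) ∈ A → ∃ b : M, (b : H →L[ℂ] H) ∈ A ∧ T (τ.vec a) = τ.vec b)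
    {ξ : τ.L2} (hξ : ξ ∈ τ.L2sub A) : T ξ ∈ τ.L2sub A := by
  refine map_mem_closure T.continuous hξ fun x hx => ?_
  induction hx using Submodule.span_induction with
  | mem x hx =>
    obtain ⟨a, ha, rfl⟩ := hx
    obtain ⟨b, hb, h⟩ := hT a ha
    rw [h]
    exact Submodule.subset_span ⟨b, hb, rfl⟩
  | zero => rw [map_zero]; exact Submodule.zero_mem _
  | add x y _ _ hx hy => rw [map_add]; exact Submodule.add_mem _ hx hy
  | smul c x _ hx => rw [map_smul]; exact Submodule.smul_mem _ c hx

theorem Trace.left_mem {a : M} (ha : (a : H →L[ℂ] H) ∈ A) {ξ : τ.L2} (hξ : ξ ∈ τ.L2sub A) :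
    τ.left a ξ ∈ τ.L2sub A :=
  τ.mem_L2sub_of_map A (fun b hb => ⟨a * b, mul_mem ha hb, τ.left_vec a b⟩) hξ

theorem Trace.right_mem {a : M} (ha : (a : H →L[ℂ] H) ∈ A) {ξ : τ.L2} (hξ : ξ ∈ τ.L2sub A) :
    τ.right a ξ ∈ τ.L2sub A :=
  τ.mem_L2sub_of_map A (fun b hb => ⟨b * a, mul_mem hb ha, τ.right_vec a b⟩) hξ

/-- `L²(A)` as a Hilbert space. -/
def Trace.L2A : Type u := τ.L2sub A

instance : NormedAddCommGroup (τ.L2A A) := inferInstanceAs (NormedAddCommGroup (τ.L2sub A))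
instance : InnerProductSpace ℂ (τ.L2A A) := inferInstanceAs (InnerProductSpace ℂ (τ.L2sub A))
instance : CompleteSpace (τ.L2A A) :=
  (Submodule.isClosed_topologicalClosure _).completeSpace_coe

/-- The inclusion of `L²(A)` in `L²(M)`. -/
def Trace.incl : τ.L2A A →ₗᵢ[ℂ] τ.L2 := (τ.L2sub A).subtypeₗᵢ

variable {A}

/-- The left action of `a ∈ A` on `L²(A)`. -/
def Trace.leftA {a : M} (ha : (a : H →L[ℂ] H) ∈ A) (x : τ.L2A A) : τ.L2A A :=
  ⟨τ.left a (τ.incl A x), τ.left_mem A ha x.2⟩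

/-- The right action of `a ∈ A` on `L²(A)`. -/
def Trace.rightA {a : M} (ha : (a : H →L[ℂ] H) ∈ A) (x : τ.L2A A) : τ.L2A A :=
  ⟨τ.right a (τ.incl A x), τ.right_mem A ha x.2⟩

variable (A)

/-- An isomorphism of `A`-bimodules from `L²(A) ⊕ (L²(A) ⊗ K ⊗ L²(A))` onto `L²(M)`: a unitary
that intertwines the actions `a · x · b = a x b` on `L²(A)` and
`a · (x ⊗ k ⊗ y) · b = a x ⊗ k ⊗ y b` on `L²(A) ⊗ K ⊗ L²(A)` with those on `L²(M)`. (The actions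
are bounded and linear, so it suffices to say so on elementary tensors.) -/
structure CoarseDecomposition (K : Type v) [NormedAddCommGroup K] [InnerProductSpace ℂ K] where
  toEquiv : WithLp 2 (τ.L2A A × TripleTensor (τ.L2A A) K) ≃ₗᵢ[ℂ] τ.L2
  left_trivial : ∀ (a : M) (ha : (a : H →L[ℂ] H) ∈ A) (x : τ.L2A A),
    τ.left a (toEquiv (WithLp.toLp 2 (x, 0))) = toEquiv (WithLp.toLp 2 (τ.leftA ha x, 0))
  right_trivial : ∀ (a : M) (ha : (a : H →L[ℂ] H) ∈ A) (x : τ.L2A A),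
    τ.right a (toEquiv (WithLp.toLp 2 (x, 0))) = toEquiv (WithLp.toLp 2 (τ.rightA ha x, 0))
  left_coarse : ∀ (a : M) (ha : (a : H →L[ℂ] H) ∈ A) (x : τ.L2A A) (k : K) (y : τ.L2A A),
    τ.left a (toEquiv (WithLp.toLp 2 (0, tmul x k y))) =
      toEquiv (WithLp.toLp 2 (0, tmul (τ.leftA ha x) k y))
  right_coarse : ∀ (a : M) (ha : (a : H →L[ℂ] H) ∈ A) (x : τ.L2A A) (k : K) (y : τ.L2A A),
    τ.right a (toEquiv (WithLp.toLp 2 (0, tmul x k y))) =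
      toEquiv (WithLp.toLp 2 (0, tmul x k (τ.rightA ha y)))

/-! ### Factors and maximal abelian subalgebras -/

/-- No nonzero projection of `N` is minimal. For abelian `N` this says that `N` is diffuse. -/
def HasNoMinimalProjection (N : VonNeumannAlgebra H) : Prop :=
  ∀ p ∈ N, IsStarProjection p → p ≠ 0 →
    ∃ q ∈ N, IsStarProjection q ∧ q ≠ 0 ∧ q ≠ p ∧ p * q = q

def IsAbelian (N : VonNeumannAlgebra H) : Prop := ∀ x ∈ N, ∀ y ∈ N, x * y = y * x

def IsFactor (N : VonNeumannAlgebra H) : Prop :=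
  (1 : H →L[ℂ] H) ≠ 0 ∧ ∀ x ∈ N, (∀ y ∈ N, x * y = y * x) → ∃ c : ℂ, x = c • (1 : H →L[ℂ] H)

/-- `N` is a finite von Neumann algebra: its isometries are unitaries. -/
def IsFinite (N : VonNeumannAlgebra H) : Prop := ∀ w ∈ N, star w * w = 1 → w * star w = 1

/-- A II₁ factor: a finite factor without minimal projections. -/
def IsII1Factor (N : VonNeumannAlgebra H) : Prop :=
  IsFactor N ∧ IsFinite N ∧ HasNoMinimalProjection N

/-- `A` is a maximal abelian subalgebra of `N`. -/
def IsMasa (A N : VonNeumannAlgebra H) : Prop :=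
  A ≤ N ∧ IsAbelian A ∧ ∀ B : VonNeumannAlgebra H, IsAbelian B → A ≤ B → B ≤ N → B = A

/-- The group normalizer of `A` in `N`: the unitaries `w ∈ N` such that `w A w⋆ = A`. -/
def normalizer (A N : VonNeumannAlgebra H) : Set (H →L[ℂ] H) :=
  {w | w ∈ N ∧ w ∈ unitary (H →L[ℂ] H) ∧
    (fun a => w * a * star w) '' (A : Set (H →L[ℂ] H)) = A}

/-- `A` is singular in `N`: the von Neumann algebra generated by the group normalizer is `A`. -/
def IsSingular (A N : VonNeumannAlgebra H) : Prop :=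
  Set.centralizer (Set.centralizer (normalizer A N)) = (A : Set (H →L[ℂ] H))

/-! ### Types of direct summands and the Pukánszky invariant -/

/-- `e` is an abelian projection of the algebra `P`: `e P e` is commutative. -/
def IsAbelianProjection (P : Set (H →L[ℂ] H)) (e : H →L[ℂ] H) : Prop :=
  e ∈ P ∧ IsStarProjection e ∧ ∀ x ∈ P, ∀ y ∈ P, (e * x * e) * (e * y * e) = (e * y * e) * (e * x * e)

/-- Murray-von Neumann equivalence in `P`. -/
def MvNEquiv (P : Set (H →L[ℂ] H)) (e f : H →L[ℂ] H) : Prop :=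
  ∃ w ∈ P, star w * w = e ∧ w * star w = f

/-- The central projection `z` of `P` cuts out a nonzero direct summand `z P` of type `I_n`:
`z` is the sum (in the strong topology) of `n` orthogonal equivalent abelian projections. All
infinite cardinals are recorded as `n = ∞`. -/
def IsTypeISummand (P : Set (H →L[ℂ] H)) (n : ℕ∞) (z : H →L[ℂ] H) : Prop :=
  z ∈ P ∧ IsStarProjection z ∧ (∀ x ∈ P, z * x = x * z) ∧ z ≠ 0 ∧
    ∃ E : Set (H →L[ℂ] H), E.encard = n ∧ (∀ e ∈ E, IsAbelianProjection P e) ∧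
      (∀ e ∈ E, ∀ f ∈ E, MvNEquiv P e f) ∧ (∀ e ∈ E, ∀ f ∈ E, e ≠ f → e * f = 0) ∧
      ∀ ξ : H, HasSum (fun e : E => (e : H →L[ℂ] H) ξ) (z ξ)

end Operators

section Invariants

variable {H : Type u} [NormedAddCommGroup H] [InnerProductSpace ℂ H] [CompleteSpace H]
  {M : VonNeumannAlgebra H} (τ : Trace M) (A : VonNeumannAlgebra H)

/-- The abelian von Neumann algebra `{π(A), ρ(A)}''` on `L²(M)`. -/
def leftRightAlgebra : Set (τ.L2 →L[ℂ] τ.L2) :=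
  Set.centralizer (Set.centralizer
    {T | ∃ a : M, (a : H →L[ℂ] H) ∈ A ∧ (T = τ.left a ∨ T = τ.right a)})

/-- The commutant of `{π(A), ρ(A)}''` acting on `L²(M) ⊖ L²(A)`. An operator on that subspace is
identified with its extension by `0` to `L²(M)`. -/
def pukanszkyAlgebra : Set (τ.L2 →L[ℂ] τ.L2) :=
  {T | T ∈ Set.centralizer (leftRightAlgebra τ A) ∧
    (∀ ξ ∈ τ.L2sub A, T ξ = 0) ∧ ∀ ξ, T ξ ∈ (τ.L2sub A)ᗮ}

/-- The Pukánszky invariant: the set of all `n ∈ ℕ ∪ {∞}` such that the above commutant has a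
nonzero direct summand of type `I_n`. -/
def pukanszkyInvariant : Set ℕ∞ :=
  {n | ∃ z, IsTypeISummand (pukanszkyAlgebra τ A) n z}

end Invariants

/-! ### Direct integrals -/

section DirectIntegral

/-- A measurable field of Hilbert spaces `F t`, `t ∈ Y`, given by its measurable sections. -/
structure MeasurableField (Y : Type) [MeasurableSpace Y] (F : Y → Type)
    [∀ t, NormedAddCommGroup (F t)] [∀ t, InnerProductSpace ℂ (F t)] where
  sections : Submodule ℂ (∀ t, F t)
  measurable_norm : ∀ ξ ∈ sections, Measurable fun t => ‖ξ t‖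
  mem_of_measurable_inner : ∀ η : ∀ t, F t,
    (∀ ξ ∈ sections, Measurable fun t => ⟪ξ t, η t⟫_ℂ) → η ∈ sections
  exists_fundamental : ∃ ξ : ℕ → ∀ t, F t, (∀ n, ξ n ∈ sections) ∧
    ∀ t, (Submodule.span ℂ (Set.range fun n => ξ n t)).topologicalClosure = ⊤

variable {Y : Type} [MeasurableSpace Y] {F : Y → Type}
  [∀ t, NormedAddCommGroup (F t)] [∀ t, InnerProductSpace ℂ (F t)]

/-- The square-integrable measurable sections. -/
def MeasurableField.squareIntegrable (S : MeasurableField Y F) (ν : Measure Y) :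
    Submodule ℂ (∀ t, F t) where
  carrier := {ξ | ξ ∈ S.sections ∧ Integrable (fun t => ‖ξ t‖ ^ 2) ν}
  zero_mem' := ⟨S.sections.zero_mem, by simp⟩
  add_mem' := by
    rintro ξ η ⟨hξ, hξ'⟩ ⟨hη, hη'⟩
    refine ⟨S.sections.add_mem hξ hη, ?_⟩
    refine ((hξ'.const_mul 2).add (hη'.const_mul 2)).mono
      ((S.measurable_norm _ (S.sections.add_mem hξ hη)).pow_const 2).aestronglyMeasurable
      (Filter.Eventually.of_forall fun t => ?_)
    have h := norm_add_le (ξ t) (η t)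
    rw [Real.norm_of_nonneg (by positivity), Pi.add_apply, Pi.add_apply,
      Real.norm_of_nonneg (by positivity)]
    nlinarith [sq_nonneg (‖ξ t‖ - ‖η t‖), norm_nonneg (ξ t + η t)]
  smul_mem' := by
    rintro c ξ ⟨hξ, hξ'⟩
    refine ⟨S.sections.smul_mem c hξ, ?_⟩
    simpa [norm_smul, mul_pow] using hξ'.const_mul (‖c‖ ^ 2)

/-- A unitary from the direct integral `∫⊕ F t dν(t)` onto the Hilbert space `L`. It is given by
the map it induces on square-integrable sections (of which the direct integral is the quotient by
the sections that vanish almost everywhere). -/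
structure DirectIntegralIso (S : MeasurableField Y F) (ν : Measure Y)
    (L : Type u) [NormedAddCommGroup L] [InnerProductSpace ℂ L] where
  toMap : S.squareIntegrable ν →ₗ[ℂ] L
  inner_map : ∀ ξ η, ⟪toMap ξ, toMap η⟫_ℂ = ∫ t, ⟪(ξ : ∀ t, F t) t, (η : ∀ t, F t) t⟫_ℂ ∂ν
  surjective : Function.Surjective toMap

/-- A ⋆-isomorphism of the abelian von Neumann algebra `A` onto `L^∞(Y, ν)`. -/
structure LInftyIso {H : Type u} [NormedAddCommGroup H] [InnerProductSpace ℂ H] [CompleteSpace H]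
    (A : VonNeumannAlgebra H) (ν : Measure Y) where
  toEquiv : A ≃ₗ[ℂ] Lp ℂ ∞ ν
  map_mul : ∀ a b : A, ∀ᵐ t ∂ν, toEquiv (a * b) t = toEquiv a t * toEquiv b t
  map_star : ∀ a : A, ∀ᵐ t ∂ν, toEquiv (star a) t = star (toEquiv a t)

end DirectIntegral

/-! ### The Takesaki invariant -/

section Takesaki

variable {H : Type u} [NormedAddCommGroup H] [InnerProductSpace ℂ H] [CompleteSpace H]

/-- The ultraweak topology: the initial topology for the functionals `x ↦ ∑ₙ ⟪ξₙ, x ηₙ⟫` with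
`(ξₙ)` and `(ηₙ)` square-summable. -/
abbrev ultraweakTopology (H : Type u) [NormedAddCommGroup H] [InnerProductSpace ℂ H] :
    TopologicalSpace (H →L[ℂ] H) :=
  ⨅ p : lp (fun _ : ℕ => H) 2 × lp (fun _ : ℕ => H) 2,
    TopologicalSpace.induced (fun x : H →L[ℂ] H => ∑' n, ⟪p.1 n, x (p.2 n)⟫_ℂ) inferInstance

/-- `B` is a separable C⋆-subalgebra of `M` that is dense for the ultraweak topology. -/
structure IsDenseSeparable (M : VonNeumannAlgebra H) (B : NonUnitalStarSubalgebra ℂ (H →L[ℂ] H)) :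
    Prop where
  le : ∀ b ∈ B, b ∈ M
  isClosed : IsClosed (B : Set (H →L[ℂ] H))
  isSeparable : TopologicalSpace.IsSeparable (B : Set (H →L[ℂ] H))
  dense : (M : Set (H →L[ℂ] H)) ⊆ @closure _ (ultraweakTopology H) (B : Set (H →L[ℂ] H))

/-- The data from which the Takesaki invariant is computed: an isomorphism `A ≅ L^∞(Y, ν)`, a
disintegration `L²(M) = ∫⊕ F t dν(t)` for which `ρ(A)` becomes the algebra of diagonalizable
operators (`ρ(a)` being multiplication by the function of `a`), and a measurable field of
representations `π_t` of `B` with `π|_B = ∫⊕ π_t dν(t)`. -/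
structure TakesakiData {M : VonNeumannAlgebra H} (τ : Trace M) (A : VonNeumannAlgebra H)
    (hAM : A ≤ M) (B : NonUnitalStarSubalgebra ℂ (H →L[ℂ] H)) (hB : IsDenseSeparable M B)
    (Y : Type) [MeasurableSpace Y] (ν : Measure Y) (F : Y → Type)
    [∀ t, NormedAddCommGroup (F t)] [∀ t, InnerProductSpace ℂ (F t)]
    [∀ t, CompleteSpace (F t)] where
  iso : LInftyIso A ν
  field : MeasurableField Y F
  unitary : DirectIntegralIso field ν τ.L2
  diagonal : ∀ (a : A) (ξ η : field.squareIntegrable ν),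
    (∀ᵐ t ∂ν, (η : ∀ t, F t) t = iso.toEquiv a t • (ξ : ∀ t, F t) t) →
      unitary.toMap η = τ.right ⟨a, hAM a.2⟩ (unitary.toMap ξ)
  rep : ∀ t, B →⋆ₙₐ[ℂ] (F t →L[ℂ] F t)
  rep_measurable : ∀ (b : B), ∀ ξ ∈ field.sections, (fun t => rep t b (ξ t)) ∈ field.sections
  rep_decomposes : ∀ (b : B) (ξ η : field.squareIntegrable ν),
    (∀ᵐ t ∂ν, (η : ∀ t, F t) t = rep t b ((ξ : ∀ t, F t) t)) →
      unitary.toMap η = τ.left ⟨b, hB.le b b.2⟩ (unitary.toMap ξ)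

/-- The Takesaki equivalence relation on `Y`: `π_s` and `π_t` are unitarily equivalent. -/
def TakesakiData.Rel {M : VonNeumannAlgebra H} {τ : Trace M} {A : VonNeumannAlgebra H}
    {hAM : A ≤ M} {B : NonUnitalStarSubalgebra ℂ (H →L[ℂ] H)} {hB : IsDenseSeparable M B}
    {Y : Type} [MeasurableSpace Y] {ν : Measure Y} {F : Y → Type}
    [∀ t, NormedAddCommGroup (F t)] [∀ t, InnerProductSpace ℂ (F t)]
    [∀ t, CompleteSpace (F t)] (D : TakesakiData τ A hAM B hB Y ν F) (s t : Y) : Prop :=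
  ∃ U : F s ≃ₗᵢ[ℂ] F t, ∀ (b : B) (x : F s), U (D.rep s b x) = D.rep t b (U x)

/-- `A` is Takesaki simple in `M`: for all choices of the data, the Takesaki equivalence relation
agrees with equality off a Borel null set. -/
def IsTakesakiSimple {M : VonNeumannAlgebra H} (τ : Trace M) (A : VonNeumannAlgebra H)
    (hAM : A ≤ M) : Prop :=
  ∀ (B : NonUnitalStarSubalgebra ℂ (H →L[ℂ] H)) (hB : IsDenseSeparable M B)
    (Y : Type) [MeasurableSpace Y] [StandardBorelSpace Y] (ν : Measure Y) [IsProbabilityMeasure ν]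
    (F : Y → Type) [∀ t, NormedAddCommGroup (F t)] [∀ t, InnerProductSpace ℂ (F t)]
    [∀ t, CompleteSpace (F t)] (D : TakesakiData τ A hAM B hB Y ν F),
    ∃ N : Set Y, MeasurableSet N ∧ ν N = 0 ∧ ∀ s ∉ N, ∀ t ∉ N, D.Rel s t ↔ s = t

end Takesaki

end CoarseMasa

end

/-! The engine is an estimate on elementary tensors `η = a ⊗ k ⊗ b` with `a, b ∈ A`. The left and
right actions of `A` move different legs, so `‖p η q‖ ≤ c ‖p‖₂ ‖q‖₂` for projections `p, q ∈ A`,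
whereas on `L²(A)` the two actions coincide. As `A` is diffuse, `1` is a finite sum of projections
`e_i ∈ A` of trace at most `ε²` (`Trace.exists_partition`). If `w ∈ M` is an isometry with `w A w⋆ ⊆
A` and `(w e w⋆) ξ = ξ e` for all projections `e ∈ A`, then `⟨ξ, η⟩ = ∑ ⟨ξ e_i, (w e_i w⋆) η e_i⟩`
is `O(ε)`, so `ξ` has no coarse component (`exists_triv_of_left_eq_right`).

With `w = 1` this shows that the trivial summand consists exactly of the `A`-central vectors. It is
cyclic for `A`, so operators commuting with `A` that preserve it commute there. Applied to `e_A` and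
to a self-adjoint `x ∈ A' ∩ M`, this puts `x` in `L²(A)`, and hence in `A`. So `A` is maximal
abelian. Averaging over the unitaries of `A` then identifies the trivial summand with `L²(A)`, and
therefore the coarse summand with its complement. A normalizing unitary `w` satisfies the displayed
relation with `ξ = w`, so it is `A`-central and lies in `A`: this is singularity. A central `x` of
`M` lies in `A` and satisfies `x ⊗ k ⊗ 1 = 1 ⊗ k ⊗ x`, so it is a scalar. The trace makes `M`
finite, and a minimal projection of `M` would be annihilated by every projection of smaller trace,
hence by all pieces of a fine partition.

For the Pukánszky invariant, the operators `1 ⊗ |l⟩⟨k| ⊗ 1` for an orthonormal basis of `K` are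
matrix units of the commutant, with abelian diagonal entries because `1 ⊗ k ⊗ 1` is cyclic for the
abelian action. So the commutant is homogeneous of type `I_n` with `n = dim K`. A determinant
argument over a commutative corner shows that no other type occurs (`IsHomogeneous.encard_le`).

For Takesaki simplicity, write `Ω_t` for the fibre of `1`. Left and right multiplication agree on
`1`, so a projection `e ∈ A` acts on `Ω_s` by its value `f_e(s)`. On elementary tensors the left
action of `e` is fibrewise small: `‖(e η)_t‖² ≤ c τ(e) ‖η_t‖²`. Given a unitary equivalence `U` from
fibre `s` to fibre `t`, put `ζ = U Ω_s`. Pieces `e` of fine partitions with `f_e(s) = 1` give `⟨ζ,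
η_t⟩ = ⟨ζ, (e η)_t⟩ → 0`, so `⟨ζ, Ω_t⟩ ≠ 0`, and then `f_e(s) = f_e(t)` for a countable family of
projections separating points (`eq_of_fibre_equiv`). Only `B` acts on the fibres, so elements of `A`
are reached by strong approximation from `B` (`Trace.exists_approx`). -/

noncomputable section

namespace CoarseMasa

/-! ### The left and right actions on `L²(M)`. -/

section TraceBasics

variable {H : Type u} [NormedAddCommGroup H] [InnerProductSpace ℂ H] [CompleteSpace H]
variable {M : VonNeumannAlgebra H} (τ : Trace M)

theorem Trace.denseRange_vec : DenseRange τ.vec :=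
  UniformSpace.Completion.denseRange_coe (α := τ.toFunctional.PreGNS)

/-- The canonical map `M → L²(M)` as a linear map. -/
def Trace.vecₗ : M →ₗ[ℂ] τ.L2 :=
  (UniformSpace.Completion.toComplL (𝕜 := ℂ) (E := τ.toFunctional.PreGNS)).toLinearMap ∘ₗ
    τ.toFunctional.toPreGNS.toLinearMap

theorem Trace.vec_add (x y : M) : τ.vec (x + y) = τ.vec x + τ.vec y := map_add τ.vecₗ x y

theorem Trace.vec_sub (x y : M) : τ.vec (x - y) = τ.vec x - τ.vec y := map_sub τ.vecₗ x y

theorem Trace.vec_smul (c : ℂ) (x : M) : τ.vec (c • x) = c • τ.vec x := map_smul τ.vecₗ c x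

theorem Trace.vec_zero : τ.vec 0 = 0 := map_zero τ.vecₗ

theorem Trace.vec_sum {ι : Type*} (s : Finset ι) (f : ι → M) :
    τ.vec (∑ i ∈ s, f i) = ∑ i ∈ s, τ.vec (f i) := map_sum τ.vecₗ f s

theorem Trace.norm_vec_sq (x : M) : ‖τ.vec x‖ ^ 2 = (τ.toFunctional (star x * x)).re := by
  rw [← τ.inner_vec, ← inner_self_eq_norm_sq (𝕜 := ℂ)]; rfl

theorem Trace.vec_eq_zero {x : M} (h : τ.vec x = 0) : x = 0 := by
  refine τ.faithful x ?_
  rw [← τ.inner_vec, h, inner_zero_left]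

theorem Trace.vec_injective : Function.Injective τ.vec := fun x y h => by
  rw [← sub_eq_zero]; refine τ.vec_eq_zero ?_; rw [τ.vec_sub, h, sub_self]

theorem Trace.norm_vec_star (x : M) : ‖τ.vec (star x)‖ = ‖τ.vec x‖ := by
  rw [← sq_eq_sq₀ (norm_nonneg _) (norm_nonneg _), τ.norm_vec_sq, τ.norm_vec_sq, star_star,
    τ.map_mul_comm]

theorem Trace.clm_ext {E : Type*} [NormedAddCommGroup E] [NormedSpace ℂ E] {S T : τ.L2 →L[ℂ] E}
    (h : ∀ x, S (τ.vec x) = T (τ.vec x)) : S = T :=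
  ContinuousLinearMap.coeFn_injective <|
    τ.denseRange_vec.equalizer S.continuous T.continuous (funext h)

theorem Trace.eq_zero_of_inner_vec {ξ : τ.L2} (h : ∀ x, ⟪τ.vec x, ξ⟫_ℂ = 0) : ξ = 0 := by
  have := DenseRange.equalizer τ.denseRange_vec (g := fun η => ⟪η, ξ⟫_ℂ) (h := fun _ => 0)
    (by fun_prop) (by fun_prop) (funext h)
  exact inner_self_eq_zero.1 (congrFun this ξ)

theorem Trace.right_mul (a b : M) : τ.right (a * b) = τ.right b * τ.right a :=
  τ.clm_ext fun x => by
    simp [τ.right_vec, mul_assoc]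

theorem Trace.right_one : τ.right (1 : M) = 1 :=
  τ.clm_ext fun x => by simp [τ.right_vec]

theorem Trace.right_sum {ι : Type*} (s : Finset ι) (f : ι → M) :
    τ.right (∑ i ∈ s, f i) = ∑ i ∈ s, τ.right (f i) :=
  τ.clm_ext fun x => by
    rw [τ.right_vec, Finset.mul_sum, τ.vec_sum, sum_apply]
    simp only [τ.right_vec]

theorem Trace.right_star (a : M) : star (τ.right a) = τ.right (star a) := by
  refine ((ContinuousLinearMap.eq_adjoint_iff _ _).2 fun ξ η => ?_).symm
  have h : ∀ x y : M, ⟪τ.right (star a) (τ.vec x), τ.vec y⟫_ℂ = ⟪τ.vec x, τ.right a (τ.vec y)⟫_ℂ :=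
    fun x y => by
      rw [τ.right_vec, τ.right_vec, τ.inner_vec, τ.inner_vec, star_mul, star_star, mul_assoc,
        τ.map_mul_comm, mul_assoc]
  refine τ.denseRange_vec.induction_on (p := fun ξ => ⟪τ.right (star a) ξ, η⟫_ℂ = ⟪ξ, τ.right a η⟫_ℂ)
    ξ (isClosed_eq (by fun_prop) (by fun_prop)) fun x => ?_
  refine τ.denseRange_vec.induction_on
    (p := fun η => ⟪τ.right (star a) (τ.vec x), η⟫_ℂ = ⟪τ.vec x, τ.right a η⟫_ℂ)
    η (isClosed_eq (by fun_prop) (by fun_prop)) fun y => h x y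

theorem Trace.left_star (a : M) : star (τ.left a) = τ.left (star a) := (map_star τ.left a).symm

theorem Trace.left_right_comm (a b : M) : τ.left a * τ.right b = τ.right b * τ.left a :=
  τ.clm_ext fun x => by
    simp [τ.right_vec, τ.left_vec, mul_assoc]

theorem Trace.left_right_apply (a b : M) (ξ : τ.L2) :
    τ.left a (τ.right b ξ) = τ.right b (τ.left a ξ) :=
  DFunLike.congr_fun (τ.left_right_comm a b) ξ

theorem Trace.left_mul_apply (a b : M) (ξ : τ.L2) : τ.left (a * b) ξ = τ.left a (τ.left b ξ) := by
  rw [map_mul]; rfl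

theorem Trace.right_mul_apply (a b : M) (ξ : τ.L2) :
    τ.right (a * b) ξ = τ.right b (τ.right a ξ) := by
  rw [τ.right_mul]; rfl

theorem Trace.inner_left (a : M) (ξ η : τ.L2) :
    ⟪ξ, τ.left a η⟫_ℂ = ⟪τ.left (star a) ξ, η⟫_ℂ := by
  rw [← τ.left_star]; exact (ContinuousLinearMap.adjoint_inner_left _ _ _).symm

theorem Trace.inner_right (a : M) (ξ η : τ.L2) :
    ⟪ξ, τ.right a η⟫_ℂ = ⟪τ.right (star a) ξ, η⟫_ℂ := by
  rw [← τ.right_star]; exact (ContinuousLinearMap.adjoint_inner_left _ _ _).symm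

theorem Trace.norm_left_le (a : M) : ‖τ.left a‖ ≤ ‖a‖ := NonUnitalStarAlgHom.norm_apply_le τ.left a

theorem Trace.norm_left_vec_le (a x : M) : ‖τ.vec (a * x)‖ ≤ ‖a‖ * ‖τ.vec x‖ := by
  rw [← τ.left_vec]
  exact (τ.left a).le_of_opNorm_le (τ.norm_left_le a) _

theorem Trace.norm_right_vec_le (a x : M) : ‖τ.vec (x * a)‖ ≤ ‖a‖ * ‖τ.vec x‖ := by
  rw [← τ.norm_vec_star, star_mul, ← τ.norm_vec_star x, ← norm_star a]
  exact τ.norm_left_vec_le _ _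

theorem Trace.vec_eq_left (a : M) : τ.vec a = τ.left a (τ.vec 1) := by rw [τ.left_vec, mul_one]

theorem Trace.vec_eq_right (a : M) : τ.vec a = τ.right a (τ.vec 1) := by
  rw [τ.right_vec, one_mul]

theorem Trace.norm_vec_sq_of_isStarProjection {p : M} (hp : IsStarProjection p) :
    ‖τ.vec p‖ ^ 2 = (τ.toFunctional p).re := by
  rw [τ.norm_vec_sq, hp.isSelfAdjoint.star_eq, hp.isIdempotentElem.eq]

theorem Trace.vec_mem_L2sub {A : VonNeumannAlgebra H} {a : M} (ha : (a : H →L[ℂ] H) ∈ A) :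
    τ.vec a ∈ τ.L2sub A :=
  Submodule.le_topologicalClosure _ (Submodule.subset_span ⟨a, ha, rfl⟩)

/-- The image of `A ∩ M` in `L²(M)` is dense in `L²(A)`. -/
theorem Trace.mem_L2sub_iff {A : VonNeumannAlgebra H} {ξ : τ.L2} :
    ξ ∈ τ.L2sub A ↔ ξ ∈ closure {ξ | ∃ a : M, (a : H →L[ℂ] H) ∈ A ∧ τ.vec a = ξ} := by
  have : (Submodule.span ℂ {ξ | ∃ a : M, (a : H →L[ℂ] H) ∈ A ∧ τ.vec a = ξ} : Set τ.L2) =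
      {ξ | ∃ a : M, (a : H →L[ℂ] H) ∈ A ∧ τ.vec a = ξ} := by
    refine Set.Subset.antisymm (fun x hx => ?_) Submodule.subset_span
    induction hx using Submodule.span_induction with
    | mem x hx => exact hx
    | zero => exact ⟨0, zero_mem A, τ.vec_zero⟩
    | add x y _ _ hx hy =>
      obtain ⟨a, ha, rfl⟩ := hx
      obtain ⟨b, hb, rfl⟩ := hy
      exact ⟨a + b, add_mem ha hb, τ.vec_add a b⟩
    | smul c x _ hx =>
      obtain ⟨a, ha, rfl⟩ := hx
      exact ⟨c • a, SMulMemClass.smul_mem c ha, τ.vec_smul c a⟩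
  rw [← this]
  exact Iff.rfl

end TraceBasics

open Filter Topology

/-! ### Weak limits, and membership in `A` from membership in `L²(A)`. -/

section WeakLimits

variable {H : Type u} [NormedAddCommGroup H] [InnerProductSpace ℂ H] [CompleteSpace H]

/-- Bounded sequences of operators converge weakly along ultrafilters. -/
theorem exists_weak_limit (𝒰 : Ultrafilter ℕ) {b : ℕ → H →L[ℂ] H} {R : ℝ} (hb : ∀ n, ‖b n‖ ≤ R) :
    ∃ T : H →L[ℂ] H, ∀ x y, Tendsto (fun n => ⟪x, b n y⟫_ℂ) 𝒰 (𝓝 ⟪x, T y⟫_ℂ) := by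
  have hR : 0 ≤ R := (norm_nonneg _).trans (hb 0)
  have bound : ∀ x y n, ‖⟪b n x, y⟫_ℂ‖ ≤ R * ‖x‖ * ‖y‖ := fun x y n =>
    (norm_inner_le_norm _ _).trans
      (mul_le_mul_of_nonneg_right ((b n).le_of_opNorm_le (hb n) x) (norm_nonneg y))
  have key : ∀ x y, ∃ c : ℂ, ‖c‖ ≤ R * ‖x‖ * ‖y‖ ∧
      Tendsto (fun n => ⟪b n x, y⟫_ℂ) 𝒰 (𝓝 c) := by
    intro x y
    -- An ultrafilter on a compact disc converges, so every matrix coefficient has a limit without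
    -- extracting subsequences. The limits form a bounded sesquilinear form, hence an operator.
    obtain ⟨c, hc, h⟩ := (isCompact_closedBall (0 : ℂ) (R * ‖x‖ * ‖y‖)).ultrafilter_le_nhds
      (𝒰.map fun n => ⟪b n x, y⟫_ℂ) (by
        rw [le_principal_iff]
        exact Filter.mem_map.2 <| Filter.univ_mem' fun n =>
          mem_closedBall_zero_iff.2 (bound x y n))
    exact ⟨c, by simpa using hc, h⟩
  choose f hf hlim using key
  let F : H →ₗ⋆[ℂ] H →ₗ[ℂ] ℂ := LinearMap.mk₂'ₛₗ (starRingEnd ℂ) (RingHom.id ℂ) f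
    (fun x x' y => tendsto_nhds_unique (hlim _ _)
      (((hlim x y).add (hlim x' y)).congr fun n => by rw [map_add, inner_add_left]))
    (fun c x y => tendsto_nhds_unique (hlim _ _)
      (((hlim x y).const_mul (starRingEnd ℂ c)).congr fun n => by rw [map_smul, inner_smul_left]))
    (fun x y y' => tendsto_nhds_unique (hlim _ _)
      (((hlim x y).add (hlim x y')).congr fun n => by rw [inner_add_right]))
    (fun c x y => tendsto_nhds_unique (hlim _ _)
      (((hlim x y).const_mul c).congr fun n => by rw [inner_smul_right]))
  refine ⟨InnerProductSpace.continuousLinearMapOfBilin (𝕜 := ℂ) (F.mkContinuous₂ R hf),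
    fun x y => ?_⟩
  have h := (hlim y x).star
  have e : ⟪InnerProductSpace.continuousLinearMapOfBilin (𝕜 := ℂ) (F.mkContinuous₂ R hf) y, x⟫_ℂ
      = f y x := InnerProductSpace.continuousLinearMapOfBilin_apply _ _ _
  rw [← inner_conj_symm x, e]
  exact h.congr fun n => inner_conj_symm _ _

omit [InnerProductSpace ℂ H] [CompleteSpace H] in
theorem summable_norm_sq (x : lp (fun _ : ℕ => H) 2) : Summable fun n => ‖x n‖ ^ 2 := by
  simpa using (lp.memℓp x).summable (by norm_num)

omit [InnerProductSpace ℂ H] [CompleteSpace H] in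
theorem summable_norm_mul_norm (x y : lp (fun _ : ℕ => H) 2) :
    Summable fun n => ‖x n‖ * ‖y n‖ :=
  Summable.of_nonneg_of_le (fun n => by positivity)
    (fun n => by nlinarith [sq_nonneg (‖x n‖ - ‖y n‖), sq_nonneg ‖x n‖, sq_nonneg ‖y n‖])
    ((summable_norm_sq x).add (summable_norm_sq y))

variable {M : VonNeumannAlgebra H} (τ : Trace M)

/-- Commuting with a fixed element of the commutant is a condition on matrix coefficients, so it
survives weak limits; `N` is its own bicommutant. -/
theorem mem_of_weak_limit {N : VonNeumannAlgebra H} {𝒰 : Ultrafilter ℕ} {b : ℕ → H →L[ℂ] H}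
    (hb : ∀ n, b n ∈ N) {T : H →L[ℂ] H}
    (h : ∀ x y, Tendsto (fun n => ⟪x, b n y⟫_ℂ) 𝒰 (𝓝 ⟪x, T y⟫_ℂ)) : T ∈ N := by
  rw [← N.commutant_commutant, VonNeumannAlgebra.mem_commutant_iff]
  intro g hg
  ext y
  refine ext_inner_left ℂ fun x => ?_
  have h1 := h (ContinuousLinearMap.adjoint g x) y
  have h2 := h x (g y)
  have h3 : ⟪ContinuousLinearMap.adjoint g x, T y⟫_ℂ = ⟪x, T (g y)⟫_ℂ := by
    refine (tendsto_nhds_unique h2 (h1.congr fun n => ?_)).symm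
    have := DFunLike.congr_fun ((VonNeumannAlgebra.mem_commutant_iff.1 hg) _ (hb n)) y
    rw [ContinuousLinearMap.adjoint_inner_left]
    exact congrArg _ this.symm
  rw [ContinuousLinearMap.adjoint_inner_left] at h3
  exact h3

theorem inner_star_mul (x z : M) (v w : H) :
    ⟪v, ((star x * z : M) : H →L[ℂ] H) w⟫_ℂ = ⟪(x : H →L[ℂ] H) v, (z : H →L[ℂ] H) w⟫_ℂ :=
  ContinuousLinearMap.adjoint_inner_right (x : H →L[ℂ] H) v ((z : H →L[ℂ] H) w)

/-- Operator-norm bounded subsets of a von Neumann subalgebra are closed in `L²`. -/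
theorem Trace.exists_vec_eq_of_tendsto {N : VonNeumannAlgebra H} {b : ℕ → M} {R : ℝ}
    (hbN : ∀ n, (b n : H →L[ℂ] H) ∈ N) (hb : ∀ n, ‖b n‖ ≤ R) {ξ : τ.L2}
    (hξ : Tendsto (fun n => τ.vec (b n)) atTop (𝓝 ξ)) :
    ∃ c : M, (c : H →L[ℂ] H) ∈ N ∧ τ.vec c = ξ := by
  let 𝒰 : Ultrafilter ℕ := hyperfilter ℕ
  obtain ⟨T, hT⟩ := exists_weak_limit 𝒰 (b := fun n => (b n : H →L[ℂ] H)) hb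
  have hTM : T ∈ M := mem_of_weak_limit (fun n => (b n).2) hT
  refine ⟨⟨T, hTM⟩, mem_of_weak_limit hbN hT, ?_⟩
  obtain ⟨x₀, y₀, hn⟩ := τ.normal
  have hU : Tendsto (fun n => τ.vec (b n)) 𝒰 (𝓝 ξ) := hξ.mono_left (Nat.hyperfilter_le_atTop)
  rw [← sub_eq_zero]
  refine τ.eq_zero_of_inner_vec fun x => ?_
  rw [inner_sub_right, sub_eq_zero]
  refine tendsto_nhds_unique ?_ (tendsto_const_nhds.inner hU)
  -- Normality enters here: the pairing with `x` is an absolutely convergent series of matrix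
  -- coefficients of `z`, so dominated convergence turns weak operator limits into weak limits in
  -- `L²(M)`.
  have e : ∀ z : M, ⟪τ.vec x, τ.vec z⟫_ℂ =
      ∑' n, ⟪(x : H →L[ℂ] H) (x₀ n), (z : H →L[ℂ] H) (y₀ n)⟫_ℂ := fun z => by
    rw [τ.inner_vec, hn]
    exact tsum_congr fun n => inner_star_mul x z _ _
  simp only [e]
  have hs := summable_norm_mul_norm x₀ y₀
  refine tendsto_tsum_of_dominated_convergence (bound := fun n => ‖x‖ * R * (‖x₀ n‖ * ‖y₀ n‖))
    (hs.mul_left _) (fun k => hT _ _) (Eventually.of_forall fun n k => ?_)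
  calc _ ≤ _ := norm_inner_le_norm _ _
    _ ≤ (‖x‖ * ‖x₀ k‖) * (R * ‖y₀ k‖) := by
      gcongr
      · exact (x : H →L[ℂ] H).le_opNorm _
      · exact (b n : H →L[ℂ] H).le_of_opNorm_le (hb n) _
    _ = _ := by ring

/-! ### Resolvents -/

theorem coe_inv_mem {A : VonNeumannAlgebra H} (w : Mˣ) (h : ((w : M) : H →L[ℂ] H) ∈ A) :
    (((w⁻¹ : Mˣ) : M) : H →L[ℂ] H) ∈ A := by
  rw [← A.commutant_commutant, VonNeumannAlgebra.mem_commutant_iff]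
  intro g hg
  have h1 := (VonNeumannAlgebra.mem_commutant_iff.1 hg) _ h
  have e1 : ((w : M) : H →L[ℂ] H) * (((w⁻¹ : Mˣ) : M) : H →L[ℂ] H) = 1 :=
    congrArg Subtype.val w.mul_inv
  have e2 : (((w⁻¹ : Mˣ) : M) : H →L[ℂ] H) * ((w : M) : H →L[ℂ] H) = 1 :=
    congrArg Subtype.val w.inv_mul
  calc g * (((w⁻¹ : Mˣ) : M) : H →L[ℂ] H)
      = (((w⁻¹ : Mˣ) : M) : H →L[ℂ] H) * (((w : M) : H →L[ℂ] H) * g)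
          * (((w⁻¹ : Mˣ) : M) : H →L[ℂ] H) := by rw [← mul_assoc, e2, one_mul]
    _ = _ := by rw [h1, mul_assoc, mul_assoc, e1, mul_one]

/-- Approximants in `L²` norm need not be bounded in operator norm. Their resolvents at `-i` are
contractions, to which `exists_vec_eq_of_tendsto` applies. The bound comes from `v⋆v + (xv)⋆(xv) =
1` for `v = (x + i)⁻¹`. -/
theorem exists_unit_add_I {B : Type*} [CStarAlgebra B] [PartialOrder B] [StarOrderedRing B] {x : B}
    (hx : IsSelfAdjoint x) :
    ∃ w : Bˣ, (w : B) = x + algebraMap ℂ B Complex.I ∧ ‖((w⁻¹ : Bˣ) : B)‖ ≤ 1 := by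
  have h1 : IsUnit (x + algebraMap ℂ B Complex.I) := by
    have : (-Complex.I) ∉ spectrum ℂ x := fun h => by
      have := hx.mem_spectrum_eq_re h
      simpa using congrArg Complex.im this
    rw [spectrum.notMem_iff] at this
    have h2 := this.neg
    rwa [map_neg, neg_sub, sub_neg_eq_add] at h2
  obtain ⟨w, hw⟩ := h1
  refine ⟨w, hw, ?_⟩
  set v : B := ((w⁻¹ : Bˣ) : B)
  have e : (w : B) * v = 1 := w.mul_inv
  rcases subsingleton_or_nontrivial B with hB | hB
  · rw [Subsingleton.elim v 0, norm_zero]; exact zero_le_one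
  have e2 : star v * v + star (x * v) * (x * v) = 1 := by
    have h3 : star ((w : B) * v) * ((w : B) * v) = 1 := by rw [e]; simp
    rw [← h3, hw]
    simp only [star_add, star_mul, hx.star_eq, Algebra.algebraMap_eq_smul_one, star_smul,
      Complex.star_def, Complex.conj_I, add_mul, mul_add, smul_mul_assoc, mul_smul_comm,
      one_mul, neg_smul, neg_mul, mul_assoc, smul_smul, Complex.I_mul_I, smul_add, smul_neg]
    module
  have e3 : star v * v ≤ 1 := by
    rw [← e2]; exact le_add_of_nonneg_right (star_mul_self_nonneg _)
  have e4 := CStarAlgebra.norm_le_norm_of_nonneg_of_le (star_mul_self_nonneg v) e3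
  rw [CStarRing.norm_star_mul_self, CStarRing.norm_one] at e4
  nlinarith [norm_nonneg v]

/-- A self-adjoint element of `M` that lies in `L²(A)` belongs to `A`. -/
theorem Trace.mem_of_vec_mem_L2sub {A : VonNeumannAlgebra H} {x : M} (hx : IsSelfAdjoint x)
    (h : τ.vec x ∈ τ.L2sub A) : (x : H →L[ℂ] H) ∈ A := by
  rw [τ.mem_L2sub_iff, mem_closure_iff_seq_limit] at h
  obtain ⟨s, hs, hlim⟩ := h
  choose a haA ha using hs
  -- The real parts of the approximants still converge to `x`, because the adjoint is isometric for
  -- the trace norm.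
  let c : ℕ → M := fun n => (2⁻¹ : ℂ) • (a n + star (a n))
  have hc : ∀ n, IsSelfAdjoint (c n) := fun n => by
    rw [isSelfAdjoint_iff, star_smul, star_add, star_star, add_comm]
    simp [c]
  have hcA : ∀ n, (c n : H →L[ℂ] H) ∈ A := fun n =>
    SMulMemClass.smul_mem _ (add_mem (haA n) (star_mem (haA n)))
  have hcx : ∀ n, ‖τ.vec (x - c n)‖ ≤ ‖s n - τ.vec x‖ := fun n => by
    have e : x - c n = (2⁻¹ : ℂ) • ((x - a n) + star (x - a n)) := by
      rw [star_sub, hx.star_eq]; simp only [c]; module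
    rw [e, τ.vec_smul, norm_smul, τ.vec_add, norm_sub_rev, ← ha n, ← τ.vec_sub]
    have := norm_add_le (τ.vec (x - a n)) (τ.vec (star (x - a n)))
    rw [τ.norm_vec_star] at this
    rw [norm_inv, Complex.norm_ofNat]; linarith
  choose w hw hw1 using fun n => exists_unit_add_I (hc n)
  obtain ⟨y, hy, hy1⟩ := exists_unit_add_I hx
  have hwA : ∀ n, (((w n)⁻¹ : Mˣ) : M).1 ∈ A := fun n => by
    refine coe_inv_mem _ ?_
    rw [hw, Algebra.algebraMap_eq_smul_one]
    exact add_mem (hcA n) (SMulMemClass.smul_mem _ (one_mem A))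
  have hl : Tendsto (fun n => τ.vec (((w n)⁻¹ : Mˣ) : M)) atTop (𝓝 (τ.vec ((y⁻¹ : Mˣ) : M))) := by
    rw [tendsto_iff_norm_sub_tendsto_zero]
    refine squeeze_zero (fun n => norm_nonneg _) (fun n => ?_)
      (tendsto_iff_norm_sub_tendsto_zero.1 hlim)
    -- The resolvent identity: with contractive outer factors, the `L²` distance of the resolvents
    -- is at most that of `c n` and `x`.
    have e : (((w n)⁻¹ : Mˣ) : M) - ((y⁻¹ : Mˣ) : M)
        = (((w n)⁻¹ : Mˣ) : M) * ((x - c n) * ((y⁻¹ : Mˣ) : M)) := by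
      have : x - c n = (y : M) - (w n : M) := by rw [hw, hy]; abel
      rw [this, sub_mul, y.mul_inv, mul_sub, mul_one, ← mul_assoc, (w n).inv_mul, one_mul]
    rw [← τ.vec_sub, e]
    calc _ ≤ _ := τ.norm_left_vec_le _ _
      _ ≤ 1 * (‖((y⁻¹ : Mˣ) : M)‖ * ‖τ.vec (x - c n)‖) :=
        mul_le_mul (hw1 n) (τ.norm_right_vec_le _ _) (norm_nonneg _) zero_le_one
      _ ≤ 1 * (1 * ‖s n - τ.vec x‖) := by
        gcongr
        exact hcx n
      _ = _ := by ring
  obtain ⟨b, hbA, hb⟩ := τ.exists_vec_eq_of_tendsto hwA hw1 hl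
  have hyA : ((y : M) : H →L[ℂ] H) ∈ A := by
    have := coe_inv_mem (A := A) (y⁻¹) (by rw [← τ.vec_injective hb]; exact hbA)
    rwa [inv_inv] at this
  have e : x = (y : M) - algebraMap ℂ M Complex.I := by rw [hy]; abel
  rw [e, Algebra.algebraMap_eq_smul_one]
  exact sub_mem hyA (SMulMemClass.smul_mem _ (one_mem A))

end WeakLimits

/-! ### Fine partitions of unity in a diffuse algebra. -/

section Partitions

variable {H : Type u} [NormedAddCommGroup H] [InnerProductSpace ℂ H] [CompleteSpace H]

section StarRing

variable {R : Type*} [Ring R] [StarRing R] {p q : R}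

theorem mul_eq_of_isStarProjection (hp : IsStarProjection p) (hq : IsStarProjection q)
    (h : p * q = q) : q * p = q := by
  have := congrArg star h
  rwa [star_mul, hp.isSelfAdjoint.star_eq, hq.isSelfAdjoint.star_eq] at this

theorem isStarProjection_sub (hp : IsStarProjection p) (hq : IsStarProjection q)
    (h : p * q = q) : IsStarProjection (p - q) where
  isSelfAdjoint := hp.isSelfAdjoint.sub hq.isSelfAdjoint
  isIdempotentElem := by
    rw [IsIdempotentElem, sub_mul, mul_sub, mul_sub, h, mul_eq_of_isStarProjection hp hq h,
      hp.isIdempotentElem.eq, hq.isIdempotentElem.eq]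
    abel

end StarRing

variable {M : VonNeumannAlgebra H} (τ : Trace M) {A : VonNeumannAlgebra H}

theorem isStarProjection_coe {p : M} : IsStarProjection (p : H →L[ℂ] H) ↔ IsStarProjection p :=
  ⟨fun h => ⟨Subtype.ext h.isIdempotentElem, Subtype.ext h.isSelfAdjoint⟩,
    fun h => ⟨congrArg Subtype.val h.isIdempotentElem, congrArg Subtype.val h.isSelfAdjoint⟩⟩

theorem Trace.re_sub (p q : M) : (τ.toFunctional (p - q)).re =
    (τ.toFunctional p).re - (τ.toFunctional q).re := by rw [map_sub, Complex.sub_re]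

theorem Trace.re_nonneg {p : M} (hp : IsStarProjection p) : 0 ≤ (τ.toFunctional p).re := by
  rw [← τ.norm_vec_sq_of_isStarProjection hp]; positivity

theorem Trace.re_pos {p : M} (hp : IsStarProjection p) (h0 : p ≠ 0) :
    0 < (τ.toFunctional p).re := by
  rw [← τ.norm_vec_sq_of_isStarProjection hp]
  have : τ.vec p ≠ 0 := fun h => h0 (τ.vec_eq_zero h)
  positivity

/-- Below every nonzero projection of a diffuse algebra there are nonzero projections of
arbitrarily small trace. -/
theorem Trace.exists_small_projection (hAM : A ≤ M) (hd : HasNoMinimalProjection A) {p : M}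
    (hpA : (p : H →L[ℂ] H) ∈ A) (hp : IsStarProjection p) (h0 : p ≠ 0) {ε : ℝ} (hε : 0 < ε) :
    ∃ q : M, (q : H →L[ℂ] H) ∈ A ∧ IsStarProjection q ∧ q ≠ 0 ∧ p * q = q ∧
      (τ.toFunctional q).re ≤ ε := by
  have halve : ∀ n : ℕ, ∃ q : M, (q : H →L[ℂ] H) ∈ A ∧ IsStarProjection q ∧ q ≠ 0 ∧ p * q = q ∧
      (τ.toFunctional q).re ≤ (τ.toFunctional p).re * (1 / 2) ^ n := by
    intro n
    induction n with
    | zero => exact ⟨p, hpA, hp, h0, hp.isIdempotentElem.eq, by simp⟩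
    | succ n ih =>
      obtain ⟨q, hqA, hq, hq0, hpq, hqn⟩ := ih
      obtain ⟨r', hrA, hr', hr0', hrq', hqr'⟩ := hd q hqA (isStarProjection_coe.2 hq)
        (fun h => hq0 (Subtype.ext h))
      obtain ⟨r, rfl⟩ : ∃ r : M, (r : H →L[ℂ] H) = r' := ⟨⟨r', hAM hrA⟩, rfl⟩
      have hr : IsStarProjection r := isStarProjection_coe.1 hr'
      have hr0 : r ≠ 0 := fun h => hr0' (congrArg Subtype.val h)
      have hrq : r ≠ q := fun h => hrq' (congrArg Subtype.val h)
      have hqr : q * r = r := Subtype.ext hqr'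
      have hs := isStarProjection_sub hq hr hqr
      rw [pow_succ, ← mul_assoc]
      -- Of `r` and its complement in `q`, one has at most half of the trace of `q`.
      rcases le_total (τ.toFunctional r).re (τ.toFunctional (q - r)).re with hle | hle
      · refine ⟨r, hrA, hr, hr0, by rw [← hqr, ← mul_assoc, hpq], ?_⟩
        rw [τ.re_sub] at hle; linarith
      · refine ⟨q - r, sub_mem hqA hrA, hs, sub_ne_zero.2 hrq.symm, ?_, ?_⟩
        · rw [mul_sub, hpq, ← hqr, ← mul_assoc, hpq]
        · rw [τ.re_sub] at hle ⊢; linarith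
  have hlim : Tendsto (fun n : ℕ => (τ.toFunctional p).re * (1 / 2 : ℝ) ^ n) atTop (𝓝 0) := by
    simpa using (tendsto_pow_atTop_nhds_zero_of_lt_one (r := (1 / 2 : ℝ)) (by norm_num)
      (by norm_num)).const_mul (τ.toFunctional p).re
  obtain ⟨n, hn⟩ := (hlim.eventually (ge_mem_nhds hε)).exists
  obtain ⟨q, h1, h2, h3, h4, h5⟩ := halve n
  exact ⟨q, h1, h2, h3, h4, h5.trans hn⟩

/-- A decreasing sequence of projections of `A` has a limit in `A`. -/
theorem Trace.exists_limit_projection {r : ℕ → M} (hrA : ∀ n, (r n : H →L[ℂ] H) ∈ A)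
    (hr : ∀ n, IsStarProjection (r n)) (hanti : ∀ n m, n ≤ m → r n * r m = r m) :
    ∃ b : M, (b : H →L[ℂ] H) ∈ A ∧ IsStarProjection b ∧ (∀ n, r n * b = b) ∧
      Tendsto (fun n => τ.vec (r n)) atTop (𝓝 (τ.vec b)) := by
  -- For nested projections the squared distance is the difference of the traces, so the monotone
  -- convergence of the traces makes the sequence Cauchy.
  have hdist : ∀ n m, n ≤ m → ‖τ.vec (r n) - τ.vec (r m)‖ ^ 2 =
      (τ.toFunctional (r n)).re - (τ.toFunctional (r m)).re := fun n m h => by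
    rw [← τ.vec_sub, τ.norm_vec_sq_of_isStarProjection
      (isStarProjection_sub (hr n) (hr m) (hanti n m h)), τ.re_sub]
  have hta : Antitone fun n => (τ.toFunctional (r n)).re := fun n m h => by
    have := hdist n m h
    have h2 := sq_nonneg ‖τ.vec (r n) - τ.vec (r m)‖
    simp only; linarith
  have htc : CauchySeq fun n => (τ.toFunctional (r n)).re :=
    (tendsto_atTop_ciInf hta ⟨0, by rintro _ ⟨n, rfl⟩; exact τ.re_nonneg (hr n)⟩).cauchySeq
  have hc : CauchySeq fun n => τ.vec (r n) := by
    rw [Metric.cauchySeq_iff'] at htc ⊢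
    intro ε hε
    obtain ⟨N, hN⟩ := htc (ε ^ 2) (by positivity)
    refine ⟨N, fun n hn => ?_⟩
    have h1 := hN n hn
    rw [Real.dist_eq, abs_sub_comm] at h1
    have h2 := (le_abs_self _).trans_lt h1
    rw [← hdist N n hn] at h2
    rw [dist_comm, dist_eq_norm]
    exact lt_of_pow_lt_pow_left₀ 2 hε.le h2
  obtain ⟨ξ, hξ⟩ := cauchySeq_tendsto_of_complete hc
  obtain ⟨b, hbA, rfl⟩ := τ.exists_vec_eq_of_tendsto hrA (fun n => (hr n).norm_le) hξ
  have hb1 : ∀ n, r n * b = b := fun n => by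
    refine τ.vec_injective ?_
    rw [← τ.left_vec]
    refine tendsto_nhds_unique (((τ.left (r n)).continuous.tendsto _).comp hξ) (hξ.congr' ?_)
    filter_upwards [eventually_ge_atTop n] with m hm
    rw [Function.comp, τ.left_vec, hanti n m hm]
  have hbs : star b = b := by
    refine τ.vec_injective (sub_eq_zero.1 (norm_eq_zero.1 ?_))
    have h1 : Tendsto (fun n => ‖τ.vec (star b) - τ.vec (r n)‖) atTop
        (𝓝 ‖τ.vec (star b) - τ.vec b‖) := (tendsto_const_nhds.sub hξ).norm
    have h2 : Tendsto (fun n => ‖τ.vec b - τ.vec (r n)‖) atTop (𝓝 ‖τ.vec b - τ.vec b‖) :=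
      (tendsto_const_nhds.sub hξ).norm
    rw [sub_self, norm_zero] at h2
    refine tendsto_nhds_unique h1 (h2.congr fun n => ?_)
    rw [← τ.vec_sub, ← τ.norm_vec_star, star_sub, (hr n).isSelfAdjoint.star_eq, τ.vec_sub]
  refine ⟨b, hbA, ⟨?_, hbs⟩, hb1, hξ⟩
  refine τ.vec_injective ?_
  rw [← τ.left_vec]
  refine tendsto_nhds_unique (((τ.left b).continuous.tendsto _).comp hξ)
    (tendsto_const_nhds.congr fun n => ?_)
  have := congrArg star (hb1 n)
  rw [star_mul, hbs, (hr n).isSelfAdjoint.star_eq] at this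
  rw [Function.comp, τ.left_vec, this]

/-- A finite partition of `1` by projections of `A` of trace at most `ε`. -/
structure Trace.Partition (A : VonNeumannAlgebra H) (ε : ℝ) where
  len : ℕ
  proj : ℕ → M
  mem : ∀ i, (proj i : H →L[ℂ] H) ∈ A
  isProj : ∀ i, IsStarProjection (proj i)
  orth : ∀ i j, i ≠ j → proj i * proj j = 0
  sum : ∑ i ∈ Finset.range len, proj i = 1
  small : ∀ i, (τ.toFunctional (proj i)).re ≤ ε

/-- Greedy exhaustion: from each remainder remove a projection of trace at most `ε` whose trace is
at least half of the possible supremum. The remainders decrease to a projection `b`. If `b ≠ 0`, a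
small nonzero projection under `b` is a candidate at every step, which bounds the removed traces
from below although they tend to `0`. So the traces of the remainders tend to `0`, and after
finitely many steps the remainder itself is small enough to be the last piece. -/
theorem Trace.exists_partition (hAM : A ≤ M) (hd : HasNoMinimalProjection A) {ε : ℝ}
    (hε : 0 < ε) : Nonempty (τ.Partition A ε) := by
  let Pr := {p : M // (p : H →L[ℂ] H) ∈ A ∧ IsStarProjection p}
  have greedy : ∀ r : Pr, ∃ q : Pr, r.1 * q.1 = q.1 ∧ (τ.toFunctional q.1).re ≤ ε ∧
      ∀ q' : Pr, r.1 * q'.1 = q'.1 → (τ.toFunctional q'.1).re ≤ ε →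
        (τ.toFunctional q'.1).re ≤ 2 * (τ.toFunctional q.1).re := by
    intro r
    let S : Set ℝ := {t | ∃ q : Pr, r.1 * q.1 = q.1 ∧ (τ.toFunctional q.1).re ≤ ε ∧
      (τ.toFunctional q.1).re = t}
    have hS0 : (0 : ℝ) ∈ S := ⟨⟨0, zero_mem A, .zero M⟩, by simp, by simpa using hε.le, by simp⟩
    have hSb : BddAbove S := ⟨ε, by rintro _ ⟨q, _, h, rfl⟩; exact h⟩
    rcases (le_csSup hSb hS0).eq_or_lt with h | h
    · refine ⟨⟨0, zero_mem A, .zero M⟩, by simp, by simpa using hε.le, fun q' h1 h2 => ?_⟩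
      have : (τ.toFunctional q'.1).re ≤ sSup S := le_csSup hSb ⟨q', h1, h2, rfl⟩
      rw [← h] at this
      simpa using this
    · obtain ⟨_, ⟨q, h1, h2, rfl⟩, h3⟩ := exists_lt_of_lt_csSup ⟨0, hS0⟩ (half_lt_self h)
      refine ⟨q, h1, h2, fun q' h1' h2' => ?_⟩
      have : (τ.toFunctional q'.1).re ≤ sSup S := le_csSup hSb ⟨q', h1', h2', rfl⟩
      linarith
  choose g hg1 hg2 hg3 using greedy
  let r : ℕ → Pr := fun n => Nat.rec ⟨1, one_mem A, .one M⟩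
    (fun _ p => ⟨p.1 - (g p).1, sub_mem p.2.1 (g p).2.1,
      isStarProjection_sub p.2.2 (g p).2.2 (hg1 p)⟩) n
  have hr0 : (r 0).1 = 1 := rfl
  have hrs : ∀ n, (r (n + 1)).1 = (r n).1 - (g (r n)).1 := fun n => rfl
  have hanti : ∀ n m, n ≤ m → (r n).1 * (r m).1 = (r m).1 := by
    intro n m h
    induction m, h using Nat.le_induction with
    | base => exact (r n).2.2.isIdempotentElem.eq
    | succ m h ih => rw [hrs, mul_sub, ih, ← hg1, ← mul_assoc, ih, hg1]
  obtain ⟨b, hbA, hb, hrb, hlim⟩ := τ.exists_limit_projection (fun n => (r n).2.1)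
    (fun n => (r n).2.2) hanti
  have hnorm : Tendsto (fun n => (τ.toFunctional (r n).1).re) atTop (𝓝 (τ.toFunctional b).re) := by
    rw [← τ.norm_vec_sq_of_isStarProjection hb]
    exact (hlim.norm.pow 2).congr fun n => τ.norm_vec_sq_of_isStarProjection (r n).2.2
  have hg0 : Tendsto (fun n => (τ.toFunctional (g (r n)).1).re) atTop (𝓝 0) := by
    have := hnorm.sub (hnorm.comp (tendsto_add_atTop_nat 1))
    rw [sub_self] at this
    refine this.congr fun n => ?_
    rw [Function.comp, hrs, τ.re_sub]; ring
  have hb0 : b = 0 := by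
    by_contra hne
    obtain ⟨q, hqA, hq, hq0, hbq, hqε⟩ := τ.exists_small_projection hAM hd hbA hb hne hε
    have hpos := τ.re_pos hq hq0
    have h2 : ∀ n, (τ.toFunctional q).re ≤ 2 * (τ.toFunctional (g (r n)).1).re := fun n =>
      hg3 (r n) ⟨q, hqA, hq⟩ (by simp only; rw [← hbq, ← mul_assoc, hrb]) hqε
    have h3 := ge_of_tendsto' (hg0.const_mul 2) h2
    linarith
  rw [hb0, map_zero, Complex.zero_re] at hnorm
  obtain ⟨n, hn⟩ := (hnorm.eventually (ge_mem_nhds hε)).exists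
  -- Replacing the remainders after step `n` by `0` makes `s i - s (i + 1)` the removed piece for `i
  -- < n` and the remainder `r n` for `i = n`. The sum telescopes to `1`.
  let s : ℕ → M := fun i => if i ≤ n then (r i).1 else 0
  have hsA : ∀ i, (s i : H →L[ℂ] H) ∈ A := fun i => by
    simp only [s]; split_ifs
    exacts [(r i).2.1, zero_mem A]
  have hsp : ∀ i, IsStarProjection (s i) := fun i => by
    simp only [s]; split_ifs
    exacts [(r i).2.2, .zero M]
  have hss : ∀ i j, i ≤ j → s i * s j = s j := fun i j h => by
    by_cases hj : j ≤ n
    · simp only [s, hj, h.trans hj, if_true]; exact hanti i j h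
    · simp [s, hj]
  have hss' : ∀ i j, i ≤ j → s j * s i = s j := fun i j h =>
    mul_eq_of_isStarProjection (hsp i) (hsp j) (hss i j h)
  have horth : ∀ i j, i < j → (s i - s (i + 1)) * (s j - s (j + 1)) = 0 := fun i j h => by
    rw [sub_mul, mul_sub, mul_sub, hss i j h.le, hss i (j + 1) (by omega), hss (i + 1) j h,
      hss (i + 1) (j + 1) (by omega), sub_self]
  have hproj : ∀ i, IsStarProjection (s i - s (i + 1)) := fun i =>
    isStarProjection_sub (hsp i) (hsp _) (hss i _ i.le_succ)
  refine ⟨⟨n + 1, fun i => s i - s (i + 1), fun i => sub_mem (hsA i) (hsA _), hproj,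
    fun i j h => ?_, ?_, fun i => ?_⟩⟩
  · rcases h.lt_or_gt with h | h
    · exact horth i j h
    · have := congrArg star (horth j i h)
      rwa [star_mul, (hproj i).isSelfAdjoint.star_eq, (hproj j).isSelfAdjoint.star_eq,
        star_zero] at this
  · rw [Finset.sum_range_sub']
    simp [s, hr0]
  · rcases lt_trichotomy i n with h | rfl | h
    · have h' : i + 1 ≤ n := h
      simp only [s, h.le, h', if_true, hrs, sub_sub_cancel]
      exact hg2 _
    · simpa [s] using hn
    · have h1 : ¬ i ≤ n := not_le.2 h
      have h2 : ¬ i + 1 ≤ n := by omega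
      simpa [s, h1, h2] using hε.le

end Partitions

/-! ### Commutants of abelian operator families with a cyclic vector. -/

section Cyclic

variable {E : Type*} [NormedAddCommGroup E] [InnerProductSpace ℂ E] [CompleteSpace E]

theorem norm_star_apply_of_commute {N : E →L[ℂ] E} (h : star N * N = N * star N) (x : E) :
    ‖star N x‖ = ‖N x‖ :=
  (ContinuousLinearMap.isStarNormal_iff_norm_eq_adjoint.1 ⟨h⟩ x).symm

/-- The closed subspace generated by the vectors `d Ω`, `d ∈ G`. -/
def cyclicSubspace (G : Set (E →L[ℂ] E)) (Ω : E) : Submodule ℂ E :=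
  (Submodule.span ℂ ((fun d : E →L[ℂ] E => d Ω) '' G)).topologicalClosure

omit [CompleteSpace E] in
theorem apply_mem_cyclicSubspace {G : Set (E →L[ℂ] E)} {Ω : E} {d : E →L[ℂ] E} (hd : d ∈ G) :
    d Ω ∈ cyclicSubspace G Ω :=
  Submodule.le_topologicalClosure _ (Submodule.subset_span ⟨d, hd, rfl⟩)

omit [CompleteSpace E] in
theorem cyclicSubspace_induction {G : Set (E →L[ℂ] E)} {Ω : E} {V : Submodule ℂ E}
    (hV : IsClosed (V : Set E)) (h : ∀ d ∈ G, d Ω ∈ V) : cyclicSubspace G Ω ≤ V := by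
  refine Submodule.topologicalClosure_minimal _ (Submodule.span_le.2 ?_) hV
  rintro _ ⟨d, hd, rfl⟩
  exact h d hd

omit [CompleteSpace E] in
theorem map_mem_cyclicSubspace {G : Set (E →L[ℂ] E)} {Ω : E} {T : E →L[ℂ] E}
    (h : ∀ d ∈ G, T (d Ω) ∈ cyclicSubspace G Ω) {ξ : E} (hξ : ξ ∈ cyclicSubspace G Ω) :
    T ξ ∈ cyclicSubspace G Ω := by
  have : cyclicSubspace G Ω ≤ (cyclicSubspace G Ω).comap T.toLinearMap :=
    cyclicSubspace_induction
      ((Submodule.isClosed_topologicalClosure _).preimage T.continuous) h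
  exact this hξ

variable {G : Set (E →L[ℂ] E)} (hmul : ∀ c ∈ G, ∀ d ∈ G, c * d ∈ G) (hstar : ∀ d ∈ G, star d ∈ G)
  (hcomm : ∀ c ∈ G, ∀ d ∈ G, c * d = d * c) {Ω : E} {S T : E →L[ℂ] E} (hS : IsSelfAdjoint S)
  (hSG : ∀ d ∈ G, S * d = d * S) (hTG : ∀ d ∈ G, T * d = d * T)
  (hSΩ : S Ω ∈ cyclicSubspace G Ω) (hTΩ : T Ω ∈ cyclicSubspace G Ω)

include hmul hstar hcomm hS hSG hTG hSΩ hTΩ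

/-- The commutant of an abelian self-adjoint semigroup of operators is commutative on the closed
subspace generated by a vector. -/
theorem commute_apply_of_cyclic {ξ : E} (hξ : ξ ∈ cyclicSubspace G Ω) : T (S ξ) = S (T ξ) := by
  have span_comm : ∀ {R : E →L[ℂ] E}, (∀ d ∈ G, R * d = d * R) →
      ∀ s ∈ Submodule.span ℂ G, R * s = s * R := by
    intro R hR s hs
    induction hs using Submodule.span_induction with
    | mem x hx => exact hR x hx
    | zero => simp
    | add x y _ _ hx hy => rw [mul_add, add_mul, hx, hy]
    | smul c x _ hx => rw [mul_smul_comm, smul_mul_assoc, hx]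
  have span_star : ∀ s ∈ Submodule.span ℂ G, star s ∈ Submodule.span ℂ G := by
    intro s hs
    induction hs using Submodule.span_induction with
    | mem x hx => exact Submodule.subset_span (hstar x hx)
    | zero => simp
    | add x y _ _ hx hy => rw [star_add]; exact Submodule.add_mem _ hx hy
    | smul c x _ hx => rw [star_smul]; exact Submodule.smul_mem _ _ hx
  have span_comm' : ∀ s ∈ Submodule.span ℂ G, ∀ t ∈ Submodule.span ℂ G, s * t = t * s :=
    fun s hs t ht => span_comm (fun d hd => (span_comm (fun c hc => hcomm d hd c hc) s hs).symm) t ht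
  have hmem : ∀ {R : E →L[ℂ] E}, (∀ d ∈ G, R * d = d * R) → R Ω ∈ cyclicSubspace G Ω →
      ∀ {η}, η ∈ cyclicSubspace G Ω → R η ∈ cyclicSubspace G Ω := by
    intro R hR hRΩ η hη
    refine map_mem_cyclicSubspace (fun d hd => ?_) hη
    have : R (d Ω) = d (R Ω) := DFunLike.congr_fun (hR d hd) Ω
    rw [this]
    refine map_mem_cyclicSubspace (fun c hc => ?_) hRΩ
    exact apply_mem_cyclicSubspace (hmul d hd c hc)
  have base : T (S Ω) = S (T Ω) := by
    have hs : ∃ s : ℕ → E →L[ℂ] E, (∀ n, s n ∈ Submodule.span ℂ G) ∧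
        Tendsto (fun n => s n Ω) atTop (𝓝 (S Ω)) := by
      obtain ⟨v, hv, hlim⟩ := mem_closure_iff_seq_limit.1 hSΩ
      have : ∀ n, ∃ s ∈ Submodule.span ℂ G, s Ω = v n := fun n => by
        have h := hv n
        have e : (fun d : E →L[ℂ] E => d Ω) = (ContinuousLinearMap.apply ℂ E Ω).toLinearMap := rfl
        rw [e, ← Submodule.map_span] at h
        exact h
      choose s hs1 hs2 using this
      exact ⟨s, hs1, by simpa only [hs2] using hlim⟩
    obtain ⟨s, hsG, hs⟩ := hs
    -- `s n - S` is normal, so it and its adjoint have the same norm on `Ω`: the adjoints of the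
    -- approximants also converge to `S` on `Ω`.
    have hs' : Tendsto (fun n => star (s n) Ω) atTop (𝓝 (S Ω)) := by
      rw [tendsto_iff_norm_sub_tendsto_zero] at hs ⊢
      refine hs.congr fun n => ?_
      have e1 : star (s n) Ω - S Ω = star (s n - S) Ω := by
        rw [star_sub, hS.star_eq, sub_apply]
      have e2 : s n Ω - S Ω = (s n - S) Ω := by rw [sub_apply]
      rw [e1, e2]
      refine (norm_star_apply_of_commute ?_ _).symm
      rw [star_sub, hS.star_eq, sub_mul, mul_sub, mul_sub, sub_mul, mul_sub, mul_sub,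
        span_comm' _ (span_star _ (hsG n)) _ (hsG n), span_comm hSG _ (hsG n),
        span_comm hSG _ (span_star _ (hsG n))]
      abel
    rw [← sub_eq_zero]
    -- In `⟨d Ω, T (s n) Ω⟩` the operator `s n` commutes with `T`, passes to the left as its
    -- adjoint, commutes with `d`, and becomes `S` in the limit.
    have hort : T (S Ω) - S (T Ω) ∈ (cyclicSubspace G Ω)ᗮ := by
      rw [Submodule.mem_orthogonal]
      have : cyclicSubspace G Ω ≤ (Submodule.span ℂ {T (S Ω) - S (T Ω)})ᗮ := by
        refine cyclicSubspace_induction (Submodule.isClosed_orthogonal _) fun d hd => ?_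
        rw [Submodule.mem_orthogonal_singleton_iff_inner_left, inner_sub_right, sub_eq_zero]
        have h1 : Tendsto (fun n => ⟪d Ω, T (s n Ω)⟫_ℂ) atTop (𝓝 ⟪d Ω, T (S Ω)⟫_ℂ) :=
          tendsto_const_nhds.inner ((T.continuous.tendsto _).comp hs)
        have h2 : Tendsto (fun n => ⟪d (star (s n) Ω), T Ω⟫_ℂ) atTop (𝓝 ⟪d (S Ω), T Ω⟫_ℂ) :=
          ((d.continuous.tendsto _).comp hs').inner tendsto_const_nhds
        have e : ⟪d (S Ω), T Ω⟫_ℂ = ⟪d Ω, S (T Ω)⟫_ℂ := by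
          have : d (S Ω) = S (d Ω) := (DFunLike.congr_fun (hSG d hd) Ω).symm
          rw [this]
          exact hS.isSymmetric _ _
        rw [← e]
        refine tendsto_nhds_unique h1 (h2.congr fun n => ?_)
        have e1 : T (s n Ω) = s n (T Ω) := DFunLike.congr_fun (span_comm hTG _ (hsG n)) Ω
        have e2 : d (star (s n) Ω) = star (s n) (d Ω) :=
          DFunLike.congr_fun (span_comm (fun c hc => hcomm d hd c hc) _ (span_star _ (hsG n))) Ω
        rw [e1, e2]
        exact ContinuousLinearMap.adjoint_inner_left _ _ _
      intro η hη
      exact Submodule.mem_orthogonal_singleton_iff_inner_left.1 (this hη)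
    have hin : T (S Ω) - S (T Ω) ∈ cyclicSubspace G Ω :=
      Submodule.sub_mem _ (hmem hTG hTΩ hSΩ) (hmem hSG hSΩ hTΩ)
    exact Submodule.disjoint_def.1 (Submodule.orthogonal_disjoint _) _ hin hort
  have : cyclicSubspace G Ω ≤ LinearMap.eqLocus (T * S).toLinearMap (S * T).toLinearMap := by
    refine cyclicSubspace_induction (isClosed_eq (T * S).continuous (S * T).continuous)
      fun d hd => ?_
    have e1 : S (d Ω) = d (S Ω) := DFunLike.congr_fun (hSG d hd) Ω
    have e2 : T (d Ω) = d (T Ω) := DFunLike.congr_fun (hTG d hd) Ω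
    have e3 : T (d (S Ω)) = d (T (S Ω)) := DFunLike.congr_fun (hTG d hd) (S Ω)
    have e4 : S (d (T Ω)) = d (S (T Ω)) := DFunLike.congr_fun (hSG d hd) (T Ω)
    change T (S (d Ω)) = S (T (d Ω))
    rw [e1, e2, e3, e4, base]
  exact this hξ

end Cyclic

/-! ### Vectors without coarse component. -/

section Coarse

variable {H : Type u} [NormedAddCommGroup H] [InnerProductSpace ℂ H] [CompleteSpace H]

section Triple

variable {E : Type u} [NormedAddCommGroup E] [InnerProductSpace ℂ E]
  {K : Type v} [NormedAddCommGroup K] [InnerProductSpace ℂ K]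

/-- The inclusion of the algebraic tensor product. -/
def tripleCoe : E ⊗[ℂ] (K ⊗[ℂ] E) →ₗ[ℂ] TripleTensor E K where
  toFun s := (s : UniformSpace.Completion (E ⊗[ℂ] (K ⊗[ℂ] E)))
  map_add' := UniformSpace.Completion.coe_add
  map_smul' c s := by
    have h : ∀ {X : Type (max u v)} [NormedAddCommGroup X] [InnerProductSpace ℂ X] (x : X),
      ((c • x : X) : UniformSpace.Completion X) = c • (x : UniformSpace.Completion X) :=
        fun x => UniformSpace.Completion.coe_smul c x
    exact h s

theorem tripleCoe_tmul (x : E) (k : K) (y : E) :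
    tripleCoe (x ⊗ₜ[ℂ] (k ⊗ₜ[ℂ] y)) = tmul x k y := rfl

theorem denseRange_tripleCoe : DenseRange (tripleCoe (E := E) (K := K)) :=
  UniformSpace.Completion.denseRange_coe (α := E ⊗[ℂ] (K ⊗[ℂ] E))

theorem norm_tmul (x : E) (k : K) (y : E) : ‖tmul x k y‖ = ‖x‖ * ‖k‖ * ‖y‖ := by
  rw [← sq_eq_sq₀ (norm_nonneg _) (by positivity)]
  have h : ((‖tmul x k y‖ ^ 2 : ℝ) : ℂ) = ((‖x‖ * ‖k‖ * ‖y‖) ^ 2 : ℝ) := by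
    have := inner_self_eq_norm_sq_to_K (𝕜 := ℂ) (tmul x k y)
    rw [inner_tmul, inner_self_eq_norm_sq_to_K, inner_self_eq_norm_sq_to_K,
      inner_self_eq_norm_sq_to_K] at this
    simp only [Complex.coe_algebraMap] at this
    push_cast
    rw [← this]; ring
  exact_mod_cast h

theorem continuous_tmul : Continuous fun p : E × K × E => tmul p.1 p.2.1 p.2.2 := by
  refine (UniformSpace.Completion.continuous_coe (E ⊗[ℂ] (K ⊗[ℂ] E))).comp ?_
  fun_prop

/-- A closed subspace that contains all elementary tensors is everything. -/
theorem TripleTensor.mem_of_tmul {V : Submodule ℂ (TripleTensor E K)}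
    (hV : IsClosed (V : Set (TripleTensor E K))) (h : ∀ x k y, tmul x k y ∈ V)
    (t : TripleTensor E K) : t ∈ V := by
  refine denseRange_tripleCoe.induction_on (p := fun t => t ∈ V) t hV fun s => ?_
  induction s with
  | zero => rw [map_zero]; exact V.zero_mem
  | add a b ha hb => rw [map_add]; exact V.add_mem ha hb
  | tmul x z =>
    induction z with
    | zero => rw [TensorProduct.tmul_zero, map_zero]; exact V.zero_mem
    | add a b ha hb => rw [TensorProduct.tmul_add, map_add]; exact V.add_mem ha hb
    | tmul k y => exact h x k y

end Triple

variable {M : VonNeumannAlgebra H} {τ : Trace M} {A : VonNeumannAlgebra H}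

/-- The image in `L²(A)` of an element of `A`. -/
def Trace.vecA (τ : Trace M) {a : M} (ha : (a : H →L[ℂ] H) ∈ A) : τ.L2A A :=
  ⟨τ.vec a, τ.vec_mem_L2sub ha⟩

theorem Trace.leftA_vecA {a b : M} (ha : (a : H →L[ℂ] H) ∈ A) (hb : (b : H →L[ℂ] H) ∈ A) :
    τ.leftA ha (τ.vecA hb) = τ.vecA (a := a * b) (mul_mem ha hb) :=
  Subtype.ext (τ.left_vec a b)

theorem Trace.rightA_vecA {a b : M} (ha : (a : H →L[ℂ] H) ∈ A) (hb : (b : H →L[ℂ] H) ∈ A) :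
    τ.rightA ha (τ.vecA hb) = τ.vecA (a := b * a) (mul_mem hb ha) :=
  Subtype.ext (τ.right_vec a b)

theorem Trace.norm_vecA {a : M} (ha : (a : H →L[ℂ] H) ∈ A) : ‖τ.vecA ha‖ = ‖τ.vec a‖ := rfl

theorem Trace.inner_vecA {a b : M} (ha : (a : H →L[ℂ] H) ∈ A) (hb : (b : H →L[ℂ] H) ∈ A) :
    ⟪τ.vecA ha, τ.vecA hb⟫_ℂ = τ.toFunctional (star a * b) := τ.inner_vec a b

theorem Trace.dense_vecA : Dense {x : τ.L2A A | ∃ a, ∃ ha : ((a : M) : H →L[ℂ] H) ∈ A,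
    τ.vecA ha = x} := by
  intro x
  have hx := τ.mem_L2sub_iff.1 x.2
  rw [mem_closure_iff_seq_limit] at hx ⊢
  obtain ⟨s, hs, hl⟩ := hx
  choose a ha has using hs
  refine ⟨fun n => τ.vecA (ha n), fun n => ⟨a n, ha n, rfl⟩, tendsto_subtype_rng.2 ?_⟩
  exact hl.congr fun n => (has n).symm

theorem Trace.left_eq_right_of_mem (hA : IsAbelian A) {a : M} (ha : (a : H →L[ℂ] H) ∈ A) {ξ : τ.L2}
    (hξ : ξ ∈ τ.L2sub A) : τ.left a ξ = τ.right a ξ := by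
  rw [τ.mem_L2sub_iff] at hξ
  refine closure_minimal (s := {ξ | ∃ a : M, (a : H →L[ℂ] H) ∈ A ∧ τ.vec a = ξ})
    (t := {ξ | τ.left a ξ = τ.right a ξ}) ?_
    (isClosed_eq (τ.left a).continuous (τ.right a).continuous) hξ
  rintro _ ⟨b, hb, rfl⟩
  change τ.left a _ = τ.right a _
  rw [τ.left_vec, τ.right_vec]
  congr 1
  exact Subtype.ext (hA _ ha _ hb)

variable {K : Type v} [NormedAddCommGroup K] [InnerProductSpace ℂ K]

namespace CoarseDecomposition

variable (C : CoarseDecomposition τ A K)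

/-- The embedding of the trivial bimodule. -/
def triv : τ.L2A A →ₗᵢ[ℂ] τ.L2 where
  toLinearMap := C.toEquiv.toLinearEquiv.toLinearMap ∘ₗ
    (WithLp.linearEquiv 2 ℂ (τ.L2A A × TripleTensor (τ.L2A A) K)).symm.toLinearMap ∘ₗ
      LinearMap.inl ℂ _ _
  norm_map' x := (C.toEquiv.norm_map _).trans (WithLp.norm_toLp_fst 2 _ _ x)

/-- The embedding of the coarse bimodule. -/
def coarse : TripleTensor (τ.L2A A) K →ₗᵢ[ℂ] τ.L2 where
  toLinearMap := C.toEquiv.toLinearEquiv.toLinearMap ∘ₗ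
    (WithLp.linearEquiv 2 ℂ (τ.L2A A × TripleTensor (τ.L2A A) K)).symm.toLinearMap ∘ₗ
      LinearMap.inr ℂ _ _
  norm_map' x := (C.toEquiv.norm_map _).trans (WithLp.norm_toLp_snd 2 _ _ x)

theorem triv_apply (x : τ.L2A A) : C.triv x = C.toEquiv (WithLp.toLp 2 (x, 0)) := rfl

theorem coarse_apply (t : TripleTensor (τ.L2A A) K) :
    C.coarse t = C.toEquiv (WithLp.toLp 2 (0, t)) := rfl

theorem exists_eq_add (ξ : τ.L2) : ∃ x t, ξ = C.triv x + C.coarse t := by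
  obtain ⟨p, rfl⟩ := C.toEquiv.surjective ξ
  refine ⟨p.fst, p.snd, ?_⟩
  rw [triv_apply, coarse_apply, ← map_add]
  congr 1
  refine (WithLp.ofLp_injective 2) ?_
  ext <;> simp

theorem inner_triv_coarse (x : τ.L2A A) (t : TripleTensor (τ.L2A A) K) :
    ⟪C.triv x, C.coarse t⟫_ℂ = 0 := by
  rw [triv_apply, coarse_apply, C.toEquiv.inner_map_map]
  simp [WithLp.prod_inner_apply]

theorem left_triv {a : M} (ha : (a : H →L[ℂ] H) ∈ A) (x : τ.L2A A) :
    τ.left a (C.triv x) = C.triv (τ.leftA ha x) := C.left_trivial a ha x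

theorem right_triv {a : M} (ha : (a : H →L[ℂ] H) ∈ A) (x : τ.L2A A) :
    τ.right a (C.triv x) = C.triv (τ.rightA ha x) := C.right_trivial a ha x

theorem left_coarse_tmul {a : M} (ha : (a : H →L[ℂ] H) ∈ A) (x : τ.L2A A) (k : K) (y : τ.L2A A) :
    τ.left a (C.coarse (tmul x k y)) = C.coarse (tmul (τ.leftA ha x) k y) :=
  C.left_coarse a ha x k y

theorem right_coarse_tmul {a : M} (ha : (a : H →L[ℂ] H) ∈ A) (x : τ.L2A A) (k : K) (y : τ.L2A A) :
    τ.right a (C.coarse (tmul x k y)) = C.coarse (tmul x k (τ.rightA ha y)) :=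
  C.right_coarse a ha x k y

/-- A closed subspace that contains the elementary tensors of elements of `A` contains the coarse
bimodule. -/
theorem coarse_mem_of_vecA {V : Submodule ℂ τ.L2} (hV : IsClosed (V : Set τ.L2))
    (h : ∀ (a b : M) (ha : (a : H →L[ℂ] H) ∈ A) (hb : (b : H →L[ℂ] H) ∈ A) (k : K),
      C.coarse (tmul (τ.vecA ha) k (τ.vecA hb)) ∈ V) (t : TripleTensor (τ.L2A A) K) :
    C.coarse t ∈ V := by
  refine TripleTensor.mem_of_tmul (V := V.comap C.coarse.toLinearMap)
    (hV.preimage C.coarse.continuous) (fun x k y => ?_) t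
  change C.coarse (tmul x k y) ∈ V
  have h1 : Continuous fun p : τ.L2A A × τ.L2A A => C.coarse (tmul p.1 k p.2) :=
    C.coarse.continuous.comp (continuous_tmul.comp
      (continuous_fst.prodMk (continuous_const.prodMk continuous_snd)))
  have h2 := (τ.dense_vecA (A := A)).prod (τ.dense_vecA (A := A))
  refine h2.induction (P := fun p => C.coarse (tmul p.1 k p.2) ∈ V) ?_ (hV.preimage h1) (x, y)
  rintro ⟨x, y⟩ ⟨⟨a, ha, hax⟩, b, hb, hby⟩
  simp only at hax hby ⊢
  rw [← hax, ← hby]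
  exact h a b ha hb k

/-- Vectors orthogonal to the coarse bimodule. -/
theorem exists_triv_of_inner_eq_zero {ξ : τ.L2} (h : ∀ (a b : M) (ha : (a : H →L[ℂ] H) ∈ A)
    (hb : (b : H →L[ℂ] H) ∈ A) (k : K), ⟪ξ, C.coarse (tmul (τ.vecA ha) k (τ.vecA hb))⟫_ℂ = 0) :
    ∃ x, C.triv x = ξ := by
  obtain ⟨x, t, rfl⟩ := C.exists_eq_add ξ
  have h1 : ∀ s, C.coarse s ∈ (Submodule.span ℂ {C.triv x + C.coarse t})ᗮ :=
    C.coarse_mem_of_vecA (Submodule.isClosed_orthogonal _) fun a b ha hb k =>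
      Submodule.mem_orthogonal_singleton_iff_inner_right.2 (h a b ha hb k)
  have h2 := Submodule.mem_orthogonal_singleton_iff_inner_right.1 (h1 t)
  rw [inner_add_left, inner_triv_coarse, zero_add, inner_self_eq_zero] at h2
  exact ⟨x, by rw [h2, add_zero]⟩

/-- A vector `ξ` with `w e w⋆ ξ = ξ e` for the projections `e` of `A` has no coarse component. -/
theorem exists_triv_of_left_eq_right (hAM : A ≤ M) (hd : HasNoMinimalProjection A) {w : M}
    (hw : star w * w = 1) (hwA : ∀ a : M, (a : H →L[ℂ] H) ∈ A →
      ((w * a * star w : M) : H →L[ℂ] H) ∈ A) {ξ : τ.L2}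
    (hξ : ∀ e : M, (e : H →L[ℂ] H) ∈ A → IsStarProjection e →
      τ.left (w * e * star w) ξ = τ.right e ξ) : ∃ x, C.triv x = ξ := by
  refine C.exists_triv_of_inner_eq_zero fun a b ha hb k => ?_
  set c : ℝ := ‖a‖ * ‖k‖ * ‖b‖ with hc
  have hc0 : 0 ≤ c := by positivity
  set η := C.coarse (tmul (τ.vecA ha) k (τ.vecA hb)) with hη
  have main : ∀ ε : ℝ, 0 < ε → ‖⟪ξ, η⟫_ℂ‖ ≤ ε * (c * ((‖ξ‖ ^ 2 + 1) / 2)) := by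
    intro ε hε
    -- Trace at most `ε ^ 2` means that the pieces have `L²` norm at most `ε`.
    obtain ⟨P⟩ := τ.exists_partition hAM hd (ε := ε ^ 2) (by positivity)
    set e := P.proj
    have hsum1 : ∑ i ∈ Finset.range P.len, τ.right (e i) = 1 := by
      rw [← τ.right_sum, P.sum, τ.right_one]
    have hse : ∀ i, star (e i) = e i := fun i => (P.isProj i).isSelfAdjoint.star_eq
    have hr : ∀ i (ζ ζ' : τ.L2), ⟪ζ, τ.right (e i) ζ'⟫_ℂ = ⟪τ.right (e i) ζ, τ.right (e i) ζ'⟫_ℂ :=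
      fun i ζ ζ' => by
        rw [← hse i, ← τ.inner_right, hse, ← τ.right_mul_apply, (P.isProj i).isIdempotentElem.eq]
    -- By the hypothesis on `ξ` a right cut of `ξ` is also a left cut by `w e w⋆`. Moved to the
    -- other side of the inner product, `η` is cut on both legs.
    have hterm : ∀ i, ⟪ξ, τ.right (e i) η⟫_ℂ =
        ⟪τ.right (e i) ξ, τ.left (w * e i * star w) (τ.right (e i) η)⟫_ℂ := fun i => by
      have h1 : (w * e i * star w) * (w * e i * star w) = w * e i * star w := by
        have : (w * e i * star w) * (w * e i * star w) = w * (e i * (star w * w) * e i) * star w := by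
          noncomm_ring
        rw [this, hw, mul_one, (P.isProj i).isIdempotentElem.eq]
      have h2 : star (w * e i * star w) = w * e i * star w := by
        rw [star_mul, star_mul, star_star, hse, mul_assoc]
      rw [hr, τ.inner_left, h2, ← hξ _ (P.mem i) (P.isProj i), ← τ.left_mul_apply, h1]
    -- Each leg contributes a factor `‖e i‖₂`, conjugation by `w` being harmless for the trace. One
    -- of the two factors is bounded by `ε`; the other is square-summable with sum `1`.
    have hest : ∀ i, ‖τ.left (w * e i * star w) (τ.right (e i) η)‖ ≤ c * ‖τ.vec (e i)‖ ^ 2 :=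
      fun i => by
        have hwe : ‖τ.vec (w * e i * star w)‖ ^ 2 = ‖τ.vec (e i)‖ ^ 2 := by
          rw [τ.norm_vec_sq, τ.norm_vec_sq, star_mul, star_mul, star_star, hse]
          have : w * (e i * star w) * (w * e i * star w) =
              w * (e i * (star w * w) * e i * star w) := by noncomm_ring
          rw [this, hw, mul_one, τ.map_mul_comm, mul_assoc, hw, mul_one]
        rw [sq_eq_sq₀ (norm_nonneg _) (norm_nonneg _)] at hwe
        rw [hη, C.right_coarse_tmul (P.mem i), C.left_coarse_tmul (hwA _ (P.mem i)),
          C.coarse.norm_map, norm_tmul, τ.leftA_vecA, τ.rightA_vecA, τ.norm_vecA, τ.norm_vecA]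
        have h1 := τ.norm_right_vec_le a (w * e i * star w)
        have h2 := τ.norm_left_vec_le b (e i)
        rw [hwe] at h1
        calc _ ≤ (‖a‖ * ‖τ.vec (e i)‖) * ‖k‖ * (‖b‖ * ‖τ.vec (e i)‖) := by gcongr
          _ = _ := by rw [hc]; ring
    have hsmall : ∀ i, ‖τ.vec (e i)‖ ≤ ε := fun i => by
      refine (sq_le_sq₀ (norm_nonneg _) hε.le).1 ?_
      rw [τ.norm_vec_sq_of_isStarProjection (P.isProj i)]; exact P.small i
    have hS1 : ∑ i ∈ Finset.range P.len, ‖τ.right (e i) ξ‖ ^ 2 = ‖ξ‖ ^ 2 := by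
      have h1 : ⟪ξ, ∑ i ∈ Finset.range P.len, τ.right (e i) ξ⟫_ℂ = ⟪ξ, ξ⟫_ℂ := by
        rw [← sum_apply, hsum1]; rfl
      rw [inner_sum, inner_self_eq_norm_sq_to_K] at h1
      rw [Finset.sum_congr rfl fun i _ => (hr i ξ ξ).trans (inner_self_eq_norm_sq_to_K _)] at h1
      simp only [Complex.coe_algebraMap] at h1
      exact_mod_cast h1
    have hS2 : ∑ i ∈ Finset.range P.len, ‖τ.vec (e i)‖ ^ 2 = 1 := by
      have : ∀ i, ‖τ.vec (e i)‖ ^ 2 = (τ.toFunctional (e i)).re := fun i =>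
        τ.norm_vec_sq_of_isStarProjection (P.isProj i)
      simp only [this]
      rw [← Complex.re_sum, ← map_sum, P.sum, τ.map_one, Complex.one_re]
    have e1 : ⟪ξ, η⟫_ℂ = ∑ i ∈ Finset.range P.len, ⟪ξ, τ.right (e i) η⟫_ℂ := by
      rw [← inner_sum, ← sum_apply, hsum1]; rfl
    rw [e1]
    calc _ ≤ ∑ i ∈ Finset.range P.len, ‖⟪ξ, τ.right (e i) η⟫_ℂ‖ := norm_sum_le _ _
      _ ≤ ∑ i ∈ Finset.range P.len,
          ε * c * ((‖τ.right (e i) ξ‖ ^ 2 + ‖τ.vec (e i)‖ ^ 2) / 2) := by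
        refine Finset.sum_le_sum fun i _ => ?_
        rw [hterm]
        calc _ ≤ _ := norm_inner_le_norm _ _
          _ ≤ ‖τ.right (e i) ξ‖ * (c * (ε * ‖τ.vec (e i)‖)) := by
            refine mul_le_mul_of_nonneg_left ((hest i).trans ?_) (norm_nonneg _)
            rw [sq]
            have := hsmall i
            gcongr
          _ = ε * c * (‖τ.right (e i) ξ‖ * ‖τ.vec (e i)‖) := by ring
          _ ≤ _ := by
            refine mul_le_mul_of_nonneg_left ?_ (by positivity)
            nlinarith [sq_nonneg (‖τ.right (e i) ξ‖ - ‖τ.vec (e i)‖)]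
      _ = _ := by
        rw [← Finset.mul_sum, ← Finset.sum_div, Finset.sum_add_distrib, hS1, hS2]; ring
  have hlim : Tendsto (fun ε : ℝ => ε * (c * ((‖ξ‖ ^ 2 + 1) / 2))) (𝓝[>] 0) (𝓝 0) := by
    have : Tendsto (fun ε : ℝ => ε * (c * ((‖ξ‖ ^ 2 + 1) / 2))) (𝓝 0) (𝓝 (0 * _)) :=
      tendsto_id.mul_const _
    rw [zero_mul] at this
    exact this.mono_left nhdsWithin_le_nhds
  refine norm_le_zero_iff.1 (ge_of_tendsto hlim ?_)
  filter_upwards [self_mem_nhdsWithin] with ε hε using main ε hε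

end CoarseDecomposition

end Coarse

open scoped ComplexStarModule

/-! ### Relative commutant, normalizer and centre. -/

section Masa

variable {H : Type u} [NormedAddCommGroup H] [InnerProductSpace ℂ H] [CompleteSpace H]
variable {M : VonNeumannAlgebra H} {τ : Trace M} {A : VonNeumannAlgebra H}
variable {K : Type v} [NormedAddCommGroup K] [InnerProductSpace ℂ K]

theorem starProjection_comm {E : Type*} [NormedAddCommGroup E] [InnerProductSpace ℂ E]
    [CompleteSpace E] {V : Submodule ℂ E} [V.HasOrthogonalProjection] {T : E →L[ℂ] E}
    (h : ∀ ξ ∈ V, T ξ ∈ V) (h' : ∀ ξ ∈ V, star T ξ ∈ V) :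
    V.starProjection * T = T * V.starProjection := by
  ext ξ
  refine Submodule.eq_starProjection_of_mem_orthogonal (h _ (Submodule.starProjection_apply_mem _ _)) ?_
  change T ξ - T (V.starProjection ξ) ∈ _
  rw [← map_sub, Submodule.mem_orthogonal]
  intro η hη
  rw [← ContinuousLinearMap.adjoint_inner_left]
  exact (Submodule.mem_orthogonal _ _).1 (Submodule.sub_starProjection_mem_orthogonal _) _ (h' η hη)

instance (τ : Trace M) (A : VonNeumannAlgebra H) : CompleteSpace (τ.L2sub A) :=
  (Submodule.isClosed_topologicalClosure _).completeSpace_coe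

/-- The orthogonal projection of `L²(M)` onto `L²(A)`. -/
def Trace.eA (τ : Trace M) (A : VonNeumannAlgebra H) : τ.L2 →L[ℂ] τ.L2 :=
  (τ.L2sub A).starProjection

theorem Trace.eA_mem (ξ : τ.L2) : τ.eA A ξ ∈ τ.L2sub A := Submodule.starProjection_apply_mem _ _

theorem Trace.eA_of_mem {ξ : τ.L2} (h : ξ ∈ τ.L2sub A) : τ.eA A ξ = ξ :=
  Submodule.starProjection_eq_self_iff.2 h

theorem Trace.eA_left {a : M} (ha : (a : H →L[ℂ] H) ∈ A) :
    τ.eA A * τ.left a = τ.left a * τ.eA A :=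
  starProjection_comm (fun _ h => τ.left_mem A ha h) fun _ h => by
    rw [τ.left_star]; exact τ.left_mem A (star_mem ha) h

namespace CoarseDecomposition

variable (C : CoarseDecomposition τ A K)

/-- A vector is central for `A` if and only if it belongs to the trivial bimodule. -/
theorem central_iff (hAM : A ≤ M) (hA : IsAbelian A) (hd : HasNoMinimalProjection A) {ξ : τ.L2} :
    (∃ x, C.triv x = ξ) ↔ ∀ a : M, (a : H →L[ℂ] H) ∈ A → τ.left a ξ = τ.right a ξ := by
  constructor
  · rintro ⟨x, rfl⟩ a ha
    rw [C.left_triv ha, C.right_triv ha]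
    congr 1
    exact Subtype.ext (τ.left_eq_right_of_mem hA ha x.2)
  · intro h
    refine C.exists_triv_of_left_eq_right hAM hd (w := 1) (by simp) (by simp) fun e he _ => ?_
    simpa using h e he

/-- A closed subspace of the trivial bimodule which contains the images of the elements of `A` is
everything. -/
theorem triv_mem_of_vecA {V : Submodule ℂ τ.L2} (hV : IsClosed (V : Set τ.L2))
    (h : ∀ (a : M) (ha : (a : H →L[ℂ] H) ∈ A), C.triv (τ.vecA ha) ∈ V) (x : τ.L2A A) :
    C.triv x ∈ V := by
  refine (τ.dense_vecA (A := A)).induction (P := fun x => C.triv x ∈ V) ?_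
    (hV.preimage C.triv.continuous) x
  rintro _ ⟨a, ha, rfl⟩
  exact h a ha

-- The isomorphism is not assumed to carry the trivial summand to `L²(A)`; so far it is only the
-- space of `A`-central vectors, and it is cyclic for `A` with generator the image `Ω` of `1`. Both
-- `e_A` and left multiplication by `x` commute with `A` and send `Ω` to central vectors, so they
-- commute there. Evaluated at the central vector `τ.vec 1`, this says that `e_A` fixes `τ.vec x`.
include C in
theorem mem_of_commute_of_isSelfAdjoint (hAM : A ≤ M) (hA : IsAbelian A)
    (hd : HasNoMinimalProjection A) {x : M} (hx : IsSelfAdjoint x)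
    (hxA : ∀ a : M, (a : H →L[ℂ] H) ∈ A → x * a = a * x) : (x : H →L[ℂ] H) ∈ A := by
  refine τ.mem_of_vec_mem_L2sub hx ?_
  set G : Set (τ.L2 →L[ℂ] τ.L2) := {T | ∃ a : M, (a : H →L[ℂ] H) ∈ A ∧ τ.left a = T} with hG
  have h1A : ((1 : M) : H →L[ℂ] H) ∈ A := one_mem A
  set Ω := C.triv (τ.vecA h1A) with hΩ
  have hcyc : ∀ y, C.triv y ∈ cyclicSubspace G Ω := fun y => by
    refine C.triv_mem_of_vecA (Submodule.isClosed_topologicalClosure _) (fun a ha => ?_) y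
    have h1 : C.triv (τ.vecA ha) = τ.left a Ω := by
      rw [hΩ, C.left_triv ha, τ.leftA_vecA]; congr 1
    rw [h1]
    exact apply_mem_cyclicSubspace ⟨a, ha, rfl⟩
  have hc : ∀ {ξ}, (∀ a : M, (a : H →L[ℂ] H) ∈ A → τ.left a ξ = τ.right a ξ) →
      ξ ∈ cyclicSubspace G Ω := fun h => by
    obtain ⟨y, rfl⟩ := (C.central_iff hAM hA hd).2 h
    exact hcyc y
  have hΩc := (C.central_iff hAM hA hd).1 ⟨_, hΩ.symm⟩
  have hcomm : ∀ a : M, (a : H →L[ℂ] H) ∈ A → τ.left x * τ.left a = τ.left a * τ.left x :=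
    fun a ha => by rw [← map_mul, hxA a ha, map_mul]
  have key := commute_apply_of_cyclic (G := G) (Ω := Ω) (S := τ.eA A) (T := τ.left x)
    (by rintro _ ⟨a, ha, rfl⟩ _ ⟨b, hb, rfl⟩; exact ⟨a * b, mul_mem ha hb, map_mul _ _ _⟩)
    (by rintro _ ⟨a, ha, rfl⟩; exact ⟨star a, star_mem ha, (τ.left_star a).symm⟩)
    (by
      rintro _ ⟨a, ha, rfl⟩ _ ⟨b, hb, rfl⟩
      rw [← map_mul, ← map_mul, show a * b = b * a from Subtype.ext (hA _ ha _ hb)])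
    (isSelfAdjoint_starProjection _)
    (by rintro _ ⟨a, ha, rfl⟩; exact τ.eA_left ha)
    (by rintro _ ⟨a, ha, rfl⟩; exact hcomm a ha)
    (hc fun a ha => τ.left_eq_right_of_mem hA ha (τ.eA_mem Ω))
    (hc fun a ha => by
      have : τ.left a (τ.left x Ω) = τ.left x (τ.left a Ω) :=
        (DFunLike.congr_fun (hcomm a ha) Ω).symm
      rw [this, hΩc a ha, τ.left_right_apply])
    (ξ := τ.vec 1) (hc fun a ha => by rw [τ.left_vec, τ.right_vec, mul_one, one_mul])
  rw [τ.eA_of_mem (τ.vec_mem_L2sub h1A), τ.left_vec, mul_one] at key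
  rw [key]
  exact τ.eA_mem _

include C in
/-- The relative commutant of `A` in `M` is `A`. -/
theorem mem_of_commute (hAM : A ≤ M) (hA : IsAbelian A) (hd : HasNoMinimalProjection A) {x : M}
    (hxA : ∀ a : M, (a : H →L[ℂ] H) ∈ A → x * a = a * x) : (x : H →L[ℂ] H) ∈ A := by
  have hxs : ∀ a : M, (a : H →L[ℂ] H) ∈ A → star x * a = a * star x := fun a ha => by
    have := congrArg star (hxA (star a) (star_mem ha))
    rw [star_mul, star_mul, star_star] at this
    exact this.symm
  have h1 : ((ℜ x : M) : H →L[ℂ] H) ∈ A :=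
    C.mem_of_commute_of_isSelfAdjoint hAM hA hd (ℜ x).2 fun a ha => by
      rw [realPart_apply_coe, smul_mul_assoc, mul_smul_comm, add_mul, mul_add, hxA a ha, hxs a ha]
  have h2 : ((ℑ x : M) : H →L[ℂ] H) ∈ A :=
    C.mem_of_commute_of_isSelfAdjoint hAM hA hd (ℑ x).2 fun a ha => by
      rw [imaginaryPart_apply_coe]
      simp only [smul_mul_assoc, mul_smul_comm, sub_mul, mul_sub, hxA a ha, hxs a ha]
  rw [← realPart_add_I_smul_imaginaryPart x]
  exact add_mem h1 (SMulMemClass.smul_mem _ h2)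

end CoarseDecomposition

theorem isMasa_of_relative_commutant (hAM : A ≤ M) (hA : IsAbelian A)
    (h : ∀ x : M, (∀ a : M, (a : H →L[ℂ] H) ∈ A → x * a = a * x) → (x : H →L[ℂ] H) ∈ A) :
    IsMasa A M := by
  refine ⟨hAM, hA, fun B hB hAB hBM => le_antisymm (fun b hb => ?_) hAB⟩
  exact h ⟨b, hBM hb⟩ fun a ha => Subtype.ext (hB _ hb _ (hAB ha))

/-- An operator that commutes with the unitaries of `A` commutes with `A`. -/
theorem commute_of_commute_unitary {x : H →L[ℂ] H}
    (h : ∀ w ∈ A, w ∈ unitary (H →L[ℂ] H) → w * x = x * w) {a : H →L[ℂ] H} (ha : a ∈ A) :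
    a * x = x * a := by
  obtain ⟨w, c, hw, -⟩ := CStarAlgebra.exists_sum_four_unitary (⟨a, ha⟩ : A)
  have : a = ∑ i, c i • ((w i : A) : H →L[ℂ] H) := by
    have := congrArg Subtype.val hw
    simpa using this
  rw [this, Finset.sum_mul, Finset.mul_sum]
  refine Finset.sum_congr rfl fun i _ => ?_
  rw [smul_mul_assoc, mul_smul_comm, h _ (w i : A).2]
  exact ⟨congrArg Subtype.val (w i).2.1, congrArg Subtype.val (w i).2.2⟩

theorem norm_le_one_of_star_mul_self {w : M} (h : star w * w = 1) : ‖w‖ ≤ 1 := by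
  have h2 := CStarRing.norm_star_mul_self (x := w)
  rw [h] at h2
  have h3 : ‖(1 : M)‖ ≤ 1 := ContinuousLinearMap.norm_id_le
  nlinarith [norm_nonneg w]

/-- A family of isometries that preserve a set `S` has a common fixed point in the closed convex
hull of `S`. -/
theorem exists_fixed_point {E : Type*} [NormedAddCommGroup E] [InnerProductSpace ℂ E]
    [CompleteSpace E] {S : Set E} (hS : S.Nonempty) :
    ∃ v ∈ closure (convexHull ℝ S), ∀ α : E →L[ℂ] E, (∀ ξ, ‖α ξ‖ = ‖ξ‖) → Set.MapsTo α S S →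
      α v = v := by
  let _ : InnerProductSpace ℝ E := InnerProductSpace.complexToReal
  have hconv : Convex ℝ (closure (convexHull ℝ S)) := (convex_convexHull ℝ S).closure
  -- `v` is the point of least norm. Its image under `α` lies in the same closed convex set and has
  -- the same norm, so uniqueness of the minimizer makes them equal.
  obtain ⟨v, hvL, hv⟩ := exists_norm_eq_iInf_of_complete_convex
    (hS.convexHull (𝕜 := ℝ)).closure isClosed_closure.isComplete hconv 0
  have hv' := (norm_eq_iInf_iff_real_inner_le_zero hconv hvL).1 hv
  refine ⟨v, hvL, fun α hα hαS => ?_⟩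
  have hαL : closure (convexHull ℝ S) ⊆ α ⁻¹' closure (convexHull ℝ S) := by
    refine closure_minimal (convexHull_min (fun x hx => ?_) ?_)
      (isClosed_closure.preimage α.continuous)
    · exact subset_closure (subset_convexHull ℝ S (hαS hx))
    · exact hconv.linear_preimage (α.restrictScalars ℝ).toLinearMap
  have h1 := hv' _ (hαL hvL)
  rw [← sub_eq_zero, ← norm_eq_zero, ← sq_eq_zero_iff]
  have h2 := norm_sub_sq_real (α v) v
  rw [hα, real_inner_comm] at h2
  rw [zero_sub, inner_neg_left, inner_sub_right, real_inner_self_eq_norm_sq] at h1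
  nlinarith [sq_nonneg ‖α v - v‖]

/-- The average of an element of `M` over the unitaries of `A`. -/
theorem Trace.exists_average (τ : Trace M) (m : M)
    (h : ∀ x : M, (∀ a : M, (a : H →L[ℂ] H) ∈ A → x * a = a * x) → (x : H →L[ℂ] H) ∈ A)
    (hAM : A ≤ M) :
    ∃ x : M, (x : H →L[ℂ] H) ∈ A ∧ ∀ ξ : τ.L2,
      (∀ a : M, (a : H →L[ℂ] H) ∈ A → τ.left a ξ = τ.right a ξ) →
        ⟪ξ, τ.vec x⟫_ℂ = ⟪ξ, τ.vec m⟫_ℂ := by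
  let UA : Set M := {w | (w : H →L[ℂ] H) ∈ A ∧ star w * w = 1 ∧ w * star w = 1}
  let S : Set τ.L2 := {ξ | ∃ w ∈ UA, τ.vec (w * m * star w) = ξ}
  -- The conjugates of `m` and their convex combinations stay in this operator-norm ball, so limits
  -- in `L²(M)` still come from elements of `M`.
  let Q : Set τ.L2 := {ξ | ∃ c : M, ‖c‖ ≤ ‖m‖ ∧ τ.vec c = ξ}
  let L : Set τ.L2 := closure (convexHull ℝ S)
  have hsmul : ∀ (s : ℝ) (ξ : τ.L2), s • ξ = (s : ℂ) • ξ := fun s ξ => rfl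
  have hQconv : Convex ℝ Q := by
    rintro _ ⟨c, hc, rfl⟩ _ ⟨d, hd, rfl⟩ s t hs ht hst
    refine ⟨(s : ℂ) • c + (t : ℂ) • d, ?_, ?_⟩
    · refine (norm_add_le _ _).trans ?_
      rw [norm_smul, norm_smul, Complex.norm_real, Complex.norm_real, Real.norm_of_nonneg hs,
        Real.norm_of_nonneg ht]
      calc _ ≤ s * ‖m‖ + t * ‖m‖ := by gcongr
        _ = ‖m‖ := by rw [← add_mul, hst, one_mul]
    · rw [τ.vec_add, τ.vec_smul, τ.vec_smul]; rfl
  have hSQ : S ⊆ Q := by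
    rintro _ ⟨w, ⟨hwA, hw1, hw2⟩, rfl⟩
    refine ⟨_, ?_, rfl⟩
    have h1 := norm_le_one_of_star_mul_self hw1
    calc _ ≤ ‖w‖ * ‖m‖ * ‖star w‖ := (norm_mul_le _ _).trans (by gcongr; exact norm_mul_le _ _)
      _ ≤ 1 * ‖m‖ * 1 := by rw [norm_star]; gcongr
      _ = _ := by ring
  have hLQ : ∀ ξ ∈ L, ∃ c : M, τ.vec c = ξ := by
    intro ξ hξ
    obtain ⟨s, hs, hlim⟩ := mem_closure_iff_seq_limit.1 hξ
    choose c hc hcs using fun n => convexHull_min hSQ hQconv (hs n)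
    rw [show s = _ from funext fun n => (hcs n).symm] at hlim
    obtain ⟨d, _, hd⟩ := τ.exists_vec_eq_of_tendsto (N := M) (fun n => (c n).2) hc hlim
    exact ⟨d, hd⟩
  have hSL : S ⊆ L := (subset_convexHull ℝ S).trans subset_closure
  have hmin : ∀ {V : Set τ.L2}, IsClosed V → Convex ℝ V → S ⊆ V → L ⊆ V := fun hc hv hs =>
    closure_minimal (convexHull_min hs hv) hc
  obtain ⟨v, hvL, hv⟩ := exists_fixed_point (S := S) ⟨_, 1, ⟨one_mem A, by simp, by simp⟩, rfl⟩
  obtain ⟨x, rfl⟩ := hLQ v hvL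
  have hfix : ∀ w ∈ UA, τ.vec (w * x * star w) = τ.vec x := by
    rintro w ⟨hwA, hw1, hw2⟩
    set α : τ.L2 →L[ℂ] τ.L2 := τ.left w * τ.right (star w) with hα
    have hαv : ∀ c, α (τ.vec c) = τ.vec (w * c * star w) := fun c => by
      change τ.left w (τ.right (star w) _) = _
      rw [τ.right_vec, τ.left_vec, mul_assoc]
    rw [← hαv]
    refine hv α (fun ξ => ?_) ?_
    · refine τ.denseRange_vec.induction_on (p := fun ξ => ‖α ξ‖ = ‖ξ‖) ξ
        (isClosed_eq (by fun_prop) (by fun_prop)) fun c => ?_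
      rw [hαv, ← sq_eq_sq₀ (norm_nonneg _) (norm_nonneg _), τ.norm_vec_sq, τ.norm_vec_sq, star_mul,
        star_mul, star_star]
      have : w * (star c * star w) * (w * c * star w) =
          w * (star c * (star w * w) * c * star w) := by noncomm_ring
      rw [this, hw1, mul_one, τ.map_mul_comm, mul_assoc, hw1, mul_one]
    · rintro _ ⟨y, ⟨hyA, hy1, hy2⟩, rfl⟩
      refine ⟨w * y, ⟨mul_mem hwA hyA, ?_, ?_⟩, ?_⟩
      · rw [star_mul, mul_assoc, ← mul_assoc (star w), hw1, one_mul, hy1]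
      · rw [star_mul, mul_assoc, ← mul_assoc y, hy2, one_mul, hw2]
      · rw [hαv, star_mul]; congr 1
  have hxA : (x : H →L[ℂ] H) ∈ A := by
    refine h x fun a ha => Subtype.ext ?_
    refine (commute_of_commute_unitary (A := A) (x := (x : H →L[ℂ] H)) ?_ ha).symm
    intro w hwA hw
    have h1 : (⟨w, hAM hwA⟩ : M) ∈ UA := ⟨hwA, Subtype.ext hw.1, Subtype.ext hw.2⟩
    have h2 := congrArg Subtype.val (τ.vec_injective (hfix _ h1))
    change w * x * star w = x at h2
    calc w * (x : H →L[ℂ] H) = w * x * star w * w := by rw [mul_assoc _ _ w, hw.1, mul_one]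
      _ = _ := by rw [h2]
  refine ⟨x, hxA, fun ξ hξ => ?_⟩
  -- Pairing with an `A`-central vector is invariant under conjugation by the unitaries of `A`,
  -- hence constant on the closed convex hull of the orbit.
  refine hmin (V := {v | ⟪ξ, v⟫_ℂ = ⟪ξ, τ.vec m⟫_ℂ}) (isClosed_eq (by fun_prop) (by fun_prop))
    ?_ ?_ hvL
  · intro a ha b hb s t hs ht hst
    change ⟪ξ, _⟫_ℂ = _
    rw [hsmul, hsmul, inner_add_right, inner_smul_right, inner_smul_right,
      show ⟪ξ, a⟫_ℂ = _ from ha, show ⟪ξ, b⟫_ℂ = _ from hb, ← add_mul, ← Complex.ofReal_add, hst,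
      Complex.ofReal_one, one_mul]
  · rintro _ ⟨w, ⟨hwA, hw1, hw2⟩, rfl⟩
    change ⟪ξ, _⟫_ℂ = _
    rw [← τ.right_vec, ← τ.left_vec, τ.inner_right, τ.inner_left, star_star, ← hξ w hwA,
      ← τ.left_mul_apply, hw1, _root_.map_one]
    rfl

namespace CoarseDecomposition

variable (C : CoarseDecomposition τ A K)

/-- The trivial bimodule is `L²(A)`. -/
theorem range_triv (hAM : A ≤ M) (hA : IsAbelian A) (hd : HasNoMinimalProjection A) {ξ : τ.L2} :
    (∃ x, C.triv x = ξ) ↔ ξ ∈ τ.L2sub A := by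
  rw [C.central_iff hAM hA hd]
  refine ⟨fun h => ?_, fun h a ha => τ.left_eq_right_of_mem hA ha h⟩
  have hr := fun x => C.mem_of_commute hAM hA hd (x := x)
  -- The component of `ξ` orthogonal to `L²(A)` is again central, so pairing it with `m` is the same
  -- as pairing it with an average of `m`, which lies in `A`.
  have h0 : ξ - τ.eA A ξ = 0 := by
    refine τ.eq_zero_of_inner_vec fun m => ?_
    obtain ⟨x, hxA, hx⟩ := τ.exists_average m hr hAM
    have h1 : ⟪ξ - τ.eA A ξ, τ.vec m⟫_ℂ = 0 := by
      rw [← hx]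
      · exact (Submodule.mem_orthogonal' _ _).1 (Submodule.sub_starProjection_mem_orthogonal _) _
          (τ.vec_mem_L2sub hxA)
      · intro a ha
        rw [map_sub, map_sub, h a ha, τ.left_eq_right_of_mem hA ha (τ.eA_mem ξ)]
    rw [← inner_conj_symm, h1, map_zero]
  rw [sub_eq_zero.1 h0]
  exact τ.eA_mem ξ

theorem range_coarse (hAM : A ≤ M) (hA : IsAbelian A) (hd : HasNoMinimalProjection A) {ξ : τ.L2} :
    (∃ t, C.coarse t = ξ) ↔ ξ ∈ (τ.L2sub A)ᗮ := by
  rw [Submodule.mem_orthogonal]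
  constructor
  · rintro ⟨t, rfl⟩ η hη
    obtain ⟨x, rfl⟩ := (C.range_triv hAM hA hd).2 hη
    exact C.inner_triv_coarse x t
  · intro h
    obtain ⟨x, t, rfl⟩ := C.exists_eq_add ξ
    have h1 := h (C.triv x) ((C.range_triv hAM hA hd).1 ⟨x, rfl⟩)
    rw [inner_add_right, inner_triv_coarse, add_zero, inner_self_eq_zero] at h1
    exact ⟨t, by rw [h1, zero_add]⟩

include C in
theorem isMasa (hAM : A ≤ M) (hA : IsAbelian A) (hd : HasNoMinimalProjection A) : IsMasa A M :=
  isMasa_of_relative_commutant hAM hA fun _ => C.mem_of_commute hAM hA hd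

-- For a normalizing `w`, both `(w e w⋆) w` and `w e` are the same vector, so `w` has no coarse
-- component; it is then `A`-central and lies in `A`. Conversely the unitaries of `A` normalize `A`
-- and span it linearly.
include C in
theorem isSingular (hAM : A ≤ M) (hA : IsAbelian A) (hd : HasNoMinimalProjection A) :
    IsSingular A M := by
  have hsub : normalizer A M ⊆ (A : Set (H →L[ℂ] H)) := by
    rintro w ⟨hwM, hw, hwA⟩
    set w' : M := ⟨w, hwM⟩
    have hw1 : star w' * w' = 1 := Subtype.ext hw.1
    have hwA' : ∀ a : M, (a : H →L[ℂ] H) ∈ A → ((w' * a * star w' : M) : H →L[ℂ] H) ∈ A :=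
      fun a ha => by
        rw [← SetLike.mem_coe, ← hwA]
        exact ⟨a, ha, rfl⟩
    have h1 : ∃ x, C.triv x = τ.vec w' := by
      refine C.exists_triv_of_left_eq_right hAM hd hw1 hwA' fun e _ _ => ?_
      rw [τ.left_vec, τ.right_vec, mul_assoc, hw1, mul_one]
    rw [C.central_iff hAM hA hd] at h1
    refine C.mem_of_commute hAM hA hd (x := w') fun a ha => ?_
    have := h1 a ha
    rw [τ.left_vec, τ.right_vec] at this
    exact (τ.vec_injective this).symm
  refine Set.Subset.antisymm ?_ ?_
  · have := Set.centralizer_subset (Set.centralizer_subset hsub)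
    rwa [A.centralizer_centralizer] at this
  · intro a ha x hx
    refine (commute_of_commute_unitary (A := A) (x := x) (fun w hwA hw => hx w ?_) ha).symm
    refine ⟨hAM hwA, hw, Set.Subset.antisymm ?_ fun b hb => ?_⟩
    · rintro _ ⟨b, hb, rfl⟩
      exact mul_mem (mul_mem hwA hb) (star_mem hwA)
    · refine ⟨star w * b * w, mul_mem (mul_mem (star_mem hwA) hb) hwA, ?_⟩
      have : w * (star w * b * w) * star w = (w * star w) * b * (w * star w) := by noncomm_ring
      simp only [this, hw.2, one_mul, mul_one]

-- A central `x` lies in `A` and its two actions agree, so `x ⊗ k ⊗ 1 = 1 ⊗ k ⊗ x` for some `k ≠ 0`.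
-- Pairing with `c ⊗ k ⊗ 1` gives `τ(c⋆ x) = τ(c⋆) τ(x)`, and `c = x - τ(x)` then has `τ(c⋆ c) = 0`.
include C in
theorem isFactor [Nontrivial K] (hAM : A ≤ M) (hA : IsAbelian A) (hd : HasNoMinimalProjection A) :
    IsFactor M := by
  refine ⟨fun h => ?_, fun x hxM hx => ?_⟩
  · have h1 : (1 : M) = 0 := Subtype.ext h
    have h2 := τ.map_one
    rw [h1, map_zero] at h2
    exact zero_ne_one h2
  · set x' : M := ⟨x, hxM⟩
    have hxc : ∀ y : M, x' * y = y * x' := fun y => Subtype.ext (hx y y.2)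
    have hxA : (x' : H →L[ℂ] H) ∈ A := C.mem_of_commute hAM hA hd fun a _ => hxc a
    have hlr : τ.left x' = τ.right x' := τ.clm_ext fun y => by
      rw [τ.left_vec, τ.right_vec, hxc]
    obtain ⟨k, hk⟩ := exists_ne (0 : K)
    have h1A : ((1 : M) : H →L[ℂ] H) ∈ A := one_mem A
    have key : ∀ c : M, (c : H →L[ℂ] H) ∈ A →
        τ.toFunctional (star c * x') = τ.toFunctional (star c) * τ.toFunctional x' := fun c hc => by
      have h1 : C.coarse (tmul (τ.leftA hxA (τ.vecA h1A)) k (τ.vecA h1A)) =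
          C.coarse (tmul (τ.vecA h1A) k (τ.rightA hxA (τ.vecA h1A))) := by
        rw [← C.left_coarse_tmul, ← C.right_coarse_tmul, hlr]
      have h2 := congrArg (fun t => ⟪tmul (τ.vecA hc) k (τ.vecA h1A), t⟫_ℂ) (C.coarse.injective h1)
      simp only [inner_tmul, τ.leftA_vecA, τ.rightA_vecA, τ.inner_vecA, star_one, one_mul, mul_one,
        τ.map_one] at h2
      have hk0 : ⟪k, k⟫_ℂ ≠ 0 := inner_self_ne_zero.2 hk
      have h3 : ⟪k, k⟫_ℂ * (τ.toFunctional (star c * x') -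
          τ.toFunctional (star c) * τ.toFunctional x') = 0 := by linear_combination h2
      exact sub_eq_zero.1 ((mul_eq_zero.1 h3).resolve_left hk0)
    set t := τ.toFunctional x'
    refine ⟨t, ?_⟩
    have hc : ((x' - t • 1 : M) : H →L[ℂ] H) ∈ A :=
      sub_mem hxA (SMulMemClass.smul_mem _ (one_mem A))
    have h0 : x' - t • 1 = 0 := by
      refine τ.faithful _ ?_
      rw [mul_sub, mul_smul_comm, mul_one, map_sub, map_smul, key _ hc, smul_eq_mul]
      ring
    exact congrArg Subtype.val (sub_eq_zero.1 h0)

end CoarseDecomposition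

theorem Trace.isFinite (τ : Trace M) : IsFinite M := by
  intro w hw h
  set w' : M := ⟨w, hw⟩
  have hw1 : star w' * w' = 1 := Subtype.ext h
  have h1 : IsStarProjection (1 - w' * star w') :=
    IsStarProjection.one_sub ⟨by
      rw [IsIdempotentElem, mul_assoc, ← mul_assoc (star w'), hw1, one_mul],
      IsSelfAdjoint.mul_star_self w'⟩
  have h2 : (1 : M) - w' * star w' = 0 := by
    refine τ.faithful _ ?_
    rw [h1.isSelfAdjoint.star_eq, h1.isIdempotentElem.eq, map_sub, τ.map_mul_comm, hw1, sub_self]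
  exact (congrArg Subtype.val (sub_eq_zero.1 h2)).symm

end Masa

/-! ### Absence of minimal projections in `M`. -/

section MinimalProjections

variable {H : Type u} [NormedAddCommGroup H] [InnerProductSpace ℂ H] [CompleteSpace H]
variable {M : VonNeumannAlgebra H} {τ : Trace M} {A : VonNeumannAlgebra H}

/-- The range projection of an element of a von Neumann algebra. -/
theorem exists_range_projection (y : M) : ∃ q : M, IsStarProjection q ∧ q * y = y ∧
    ∀ z : M, z * y = 0 → z * q = 0 := by
  let V : Submodule ℂ H := ((y : H →L[ℂ] H).range).topologicalClosure
  have : CompleteSpace V := (Submodule.isClosed_topologicalClosure _).completeSpace_coe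
  have hsp : IsStarProjection V.starProjection := isStarProjection_starProjection
  have hyV : ∀ ξ, (y : H →L[ℂ] H) ξ ∈ V := fun ξ =>
    Submodule.le_topologicalClosure _ ⟨ξ, rfl⟩
  have hqM : V.starProjection ∈ M := by
    rw [VonNeumannAlgebra.IsStarProjection.mem_iff hsp]
    intro g hg
    rw [Submodule.range_starProjection, Module.End.mem_invtSubmodule]
    intro ξ hξ
    refine map_mem_closure g.continuous hξ ?_
    rintro _ ⟨η, rfl⟩
    have := DFunLike.congr_fun ((VonNeumannAlgebra.mem_commutant_iff.1 hg) _ y.2) η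
    exact ⟨g η, this⟩
  refine ⟨⟨_, hqM⟩, isStarProjection_coe.1 hsp, Subtype.ext ?_, fun z hz => Subtype.ext ?_⟩
  · ext ξ
    exact Submodule.starProjection_eq_self_iff.2 (hyV ξ)
  · ext ξ
    have h1 : ∀ η ∈ V, (z : H →L[ℂ] H) η = 0 := by
      intro η hη
      refine closure_minimal (s := ((y : H →L[ℂ] H).range : Set H))
        (t := {η | (z : H →L[ℂ] H) η = 0}) ?_
        (isClosed_eq (z : H →L[ℂ] H).continuous continuous_const) hη
      rintro _ ⟨ζ, rfl⟩
      exact DFunLike.congr_fun (congrArg Subtype.val hz) ζ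
    exact h1 _ (Submodule.starProjection_apply_mem _ _)

theorem mul_eq_zero_of_mul_mul_star {B : Type*} [CStarAlgebra B] {z y : B}
    (h : z * (y * star y) * star z = 0) : z * y = 0 := by
  refine (CStarRing.mul_star_self_eq_zero_iff (z * y)).1 ?_
  rw [star_mul, ← h]; noncomm_ring

/-- If `p` is minimal, self-adjoint elements of `p M p` are comparable with `0`. -/
theorem nonneg_or_nonpos_of_minimal {p : M} (hp : IsStarProjection p)
    (hmin : ∀ q : M, IsStarProjection q → q ≠ 0 → p * q = q → q = p) {y : M}
    (hy : IsSelfAdjoint y) (hpy : p * y = y) : y ≤ 0 ∨ 0 ≤ y := by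
  have hpos : star y⁺ = y⁺ := (CFC.posPart_nonneg y).isSelfAdjoint.star_eq
  have hneg : star y⁻ = y⁻ := (CFC.negPart_nonneg y).isSelfAdjoint.star_eq
  have hdec : y⁺ - y⁻ = y := CFC.posPart_sub_negPart y hy
  have h0 : y⁺ * y⁻ = 0 := CFC.posPart_mul_negPart y
  have h0' : y⁻ * y⁺ = 0 := CFC.negPart_mul_posPart y
  have hp1 : (1 - p) * y = 0 := by rw [sub_mul, one_mul, hpy, sub_self]
  have h1 : (1 - p) * y⁺ = 0 := by
    refine mul_eq_zero_of_mul_mul_star ?_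
    rw [hpos]
    have : y⁺ * y⁺ = y * y⁺ := by
      calc y⁺ * y⁺ = (y⁺ - y⁻) * y⁺ := by rw [sub_mul, h0', sub_zero]
        _ = y * y⁺ := by rw [hdec]
    rw [this, ← mul_assoc, hp1, zero_mul, zero_mul]
  have h2 : (1 - p) * y⁻ = 0 := by
    calc (1 - p) * y⁻ = (1 - p) * y⁺ - (1 - p) * (y⁺ - y⁻) := by rw [mul_sub, sub_sub_cancel]
      _ = 0 := by rw [hdec, h1, hp1, sub_zero]
  -- The range projection of `y⁺` lies under `p`, so it is `0` or `p`. In the second case `y⁻ y⁺ =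
  -- 0` gives `y⁻ p = 0`, and hence `y⁻ = 0`.
  obtain ⟨q, hq, hqy, hzq⟩ := exists_range_projection (y⁺)
  have hpq : p * q = q := by
    have := hzq _ h1
    rw [sub_mul, one_mul, sub_eq_zero] at this
    exact this.symm
  by_cases hq0 : q = 0
  · left
    have : y⁺ = 0 := by rw [← hqy, hq0, zero_mul]
    rw [this, zero_sub] at hdec
    exact hdec.symm.le.trans (neg_nonpos.2 (CFC.negPart_nonneg y))
  · right
    have h3 := hzq _ h0'
    rw [hmin q hq hq0 hpq] at h3
    have h4 : y⁻ = 0 := by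
      have h5 := congrArg star h2
      rw [star_mul, hneg, star_sub, star_one, hp.isSelfAdjoint.star_eq, star_zero, mul_sub, h3,
        mul_one, sub_zero] at h5
      exact h5
    rw [h4, sub_zero] at hdec
    exact (CFC.posPart_nonneg y).trans hdec.le

/-- If `p` is minimal, then `p e p` is a multiple of `p`. -/
theorem exists_eq_smul_of_minimal {p : M} (hp : IsStarProjection p)
    (hmin : ∀ q : M, IsStarProjection q → q ≠ 0 → p * q = q → q = p) {e : M}
    (he : IsStarProjection e) : ∃ c : ℝ, p * e * p = (c : ℂ) • p := by
  have hps := hp.isSelfAdjoint.star_eq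
  have hpp : p * p = p := hp.isIdempotentElem
  set x := p * e * p with hx
  have hxs : IsSelfAdjoint x := by
    rw [isSelfAdjoint_iff, hx, star_mul, star_mul, hps, he.isSelfAdjoint.star_eq, mul_assoc]
  have hc : Continuous fun r : ℝ => (r : ℂ) • p := Complex.continuous_ofReal.smul continuous_const
  -- The real numbers `r` with `x ≤ r p` and those with `r p ≤ x` form two closed sets covering the
  -- line, one containing `1` and the other `0`. By connectedness they meet, and a common point is
  -- the scalar.
  have h := isPreconnected_closed_iff.1 (isPreconnected_univ (α := ℝ))
    {r : ℝ | x ≤ (r : ℂ) • p} {r : ℝ | (r : ℂ) • p ≤ x}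
    (isClosed_le continuous_const hc) (isClosed_le hc continuous_const)
    (fun r _ => by
      have h1 : IsSelfAdjoint (x - (r : ℂ) • p) := hxs.sub (by
        rw [isSelfAdjoint_iff, star_smul, hps, Complex.star_def, Complex.conj_ofReal])
      have h2 : p * (x - (r : ℂ) • p) = x - (r : ℂ) • p := by
        rw [mul_sub, mul_smul_comm, hpp, hx, ← mul_assoc, ← mul_assoc, hpp]
      rcases nonneg_or_nonpos_of_minimal hp hmin h1 h2 with h | h
      · exact Or.inl (sub_nonpos.1 h)
      · exact Or.inr (sub_nonneg.1 h))
    ⟨1, trivial, by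
      have h1 := star_left_conjugate_le_conjugate he.le_one p
      rw [hps, mul_one, hpp] at h1
      simpa using h1⟩
    ⟨0, trivial, by
      have h1 := star_left_conjugate_le_conjugate he.nonneg p
      rw [hps, mul_zero, zero_mul] at h1
      simpa using h1⟩
  obtain ⟨c, -, h1, h2⟩ := h
  exact ⟨c, le_antisymm h1 h2⟩

/-- A minimal projection of `M` is annihilated by the projections of smaller trace. -/
theorem Trace.mul_eq_zero_of_minimal (τ : Trace M) {p : M} (hp : IsStarProjection p)
    (hmin : ∀ q : M, IsStarProjection q → q ≠ 0 → p * q = q → q = p) {e : M}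
    (he : IsStarProjection e) (hlt : (τ.toFunctional e).re < (τ.toFunctional p).re) :
    e * p = 0 := by
  have hps := hp.isSelfAdjoint.star_eq
  have hes := he.isSelfAdjoint.star_eq
  have hpp : p * p = p := hp.isIdempotentElem
  have hee : e * e = e := he.isIdempotentElem
  obtain ⟨c, hc⟩ := exists_eq_smul_of_minimal hp hmin he
  by_cases hc0 : (c : ℂ) = 0
  · refine (CStarRing.star_mul_self_eq_zero_iff _).1 ?_
    rw [star_mul, hps, hes, mul_assoc, ← mul_assoc e, hee, ← mul_assoc, hc, hc0, zero_smul]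
  · exfalso
    -- If `p e p = c p` with `c ≠ 0`, this is a projection under `e` with the trace of `p`, which is
    -- too large.
    set f : M := (c : ℂ)⁻¹ • (e * p * e) with hf
    have hff : IsStarProjection f := by
      refine ⟨?_, ?_⟩
      · have h1 : e * p * e * (e * p * e) = (c : ℂ) • (e * p * e) := by
          calc e * p * e * (e * p * e) = e * (p * (e * e) * p) * e := by noncomm_ring
            _ = _ := by rw [hee, hc, mul_smul_comm, smul_mul_assoc]
        rw [IsIdempotentElem, hf, smul_mul_smul_comm, h1, smul_smul, mul_assoc,
          inv_mul_cancel₀ hc0, mul_one]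
      · rw [isSelfAdjoint_iff, hf, star_smul, star_mul, star_mul, hps, hes, star_inv₀,
          Complex.star_def, Complex.conj_ofReal, mul_assoc]
    have hef : e * f = f := by
      rw [hf, mul_smul_comm, ← mul_assoc, ← mul_assoc, hee]
    have ht : τ.toFunctional f = τ.toFunctional p := by
      have h1 : τ.toFunctional (e * p * e) = τ.toFunctional (p * e * p) := by
        rw [τ.map_mul_comm, ← mul_assoc, hee, τ.map_mul_comm (p * e), ← mul_assoc, hpp,
          τ.map_mul_comm]
      rw [hf, map_smul, h1, hc, map_smul, smul_smul, inv_mul_cancel₀ hc0, one_smul]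
    have h2 := τ.re_nonneg (isStarProjection_sub he hff hef)
    rw [τ.re_sub, ht] at h2
    linarith

/-- An algebra with a diffuse subalgebra has no minimal projections. -/
theorem Trace.hasNoMinimalProjection (τ : Trace M) (hAM : A ≤ M) (hd : HasNoMinimalProjection A) :
    HasNoMinimalProjection M := by
  intro p' hp'M hp' hp0'
  by_contra hcon
  push Not at hcon
  obtain ⟨p, rfl⟩ : ∃ p : M, (p : H →L[ℂ] H) = p' := ⟨⟨p', hp'M⟩, rfl⟩
  have hp : IsStarProjection p := isStarProjection_coe.1 hp'
  have hp0 : p ≠ 0 := fun h => hp0' (congrArg Subtype.val h)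
  have hmin : ∀ q : M, IsStarProjection q → q ≠ 0 → p * q = q → q = p := by
    intro q hq hq0 hpq
    by_contra hne
    exact hcon q q.2 (isStarProjection_coe.2 hq) (fun h => hq0 (Subtype.ext h))
      (fun h => hne (Subtype.ext h)) (congrArg Subtype.val hpq)
  have hpos := τ.re_pos hp hp0
  obtain ⟨P⟩ := τ.exists_partition hAM hd (half_pos hpos)
  refine hp0 ?_
  rw [← one_mul p, ← P.sum, Finset.sum_mul]
  refine Finset.sum_eq_zero fun i _ => τ.mul_eq_zero_of_minimal hp hmin (P.isProj i) ?_
  have := P.small i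
  linarith

end MinimalProjections

/-! ### Uniqueness of the type of a homogeneous summand. -/

section TypeUniqueness

/-- A matrix with more columns than rows whose columns are orthogonal for a bilinear pairing. -/
theorem pow_eq_zero_of_wide {R : Type*} [CommRing R] {m : ℕ} (Z X : Fin m → Fin (m + 1) → R) {y : R}
    (h : ∀ r s, ∑ k, Z k r * X k s = if r = s then y else 0) : y ^ (m + 1) = 0 := by
  -- A zero row makes both matrices square without changing the product of the transpose of `Z` with
  -- `X`, whose determinant is `y ^ (m + 1)`.
  let X' : Matrix (Fin (m + 1)) (Fin (m + 1)) R := Matrix.of (Fin.cons (fun _ => 0) X)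
  let Z' : Matrix (Fin (m + 1)) (Fin (m + 1)) R := Matrix.of (Fin.cons (fun _ => 0) Z)
  have h1 : Z'.transpose * X' = Matrix.scalar (Fin (m + 1)) y := by
    ext r s
    rw [Matrix.mul_apply, Fin.sum_univ_succ, Matrix.scalar_apply, Matrix.diagonal_apply, ← h]
    simp [X', Z']
  have h2 : X'.det = 0 := Matrix.det_eq_zero_of_row_eq_zero 0 fun j => rfl
  have h3 := congrArg Matrix.det h1
  rw [Matrix.det_mul, h2, mul_zero, Matrix.scalar_apply, Matrix.det_diagonal, Finset.prod_const,
    Finset.card_univ, Fintype.card_fin] at h3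
  exact h3.symm

theorem eq_zero_of_isSelfAdjoint_of_pow {B : Type*} [CStarAlgebra B] {y : B} (hy : IsSelfAdjoint y)
    {n : ℕ} (h : y ^ n = 0) : y = 0 := by
  have h1 : y ^ 2 ^ n = 0 := pow_eq_zero_of_le Nat.lt_two_pow_self.le h
  have h2 := hy.nnnorm_pow_two_pow n
  rw [h1, nnnorm_zero] at h2
  exact nnnorm_eq_zero.1 (pow_eq_zero_iff (by positivity) |>.1 h2.symm)

theorem mul_eq_of_star_mul_self {B : Type*} [CStarAlgebra B] {w e : B} (he : IsStarProjection e)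
    (h : star w * w = e) : w * e = w := by
  refine sub_eq_zero.1 ((CStarRing.star_mul_self_eq_zero_iff _).1 ?_)
  have hs := he.isSelfAdjoint.star_eq
  have hee : e * e = e := he.isIdempotentElem
  calc star (w * e - w) * (w * e - w)
      = e * (star w * w) * e - e * (star w * w) - (star w * w) * e + star w * w := by
        rw [star_sub, star_mul, hs]; noncomm_ring
    _ = 0 := by rw [h, hee, hee]; simp

/-- If `z` is a sum of `m` abelian projections equivalent to `e`, there are at most `m` orthogonal
equivalent nonzero projections under `z`. -/
theorem eq_zero_of_equivalents {B : Type*} [CStarAlgebra B] {P : Set B}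
    (hmul : ∀ x ∈ P, ∀ y ∈ P, x * y ∈ P) (hstar : ∀ x ∈ P, star x ∈ P) {e z F : B} (he : IsStarProjection e)
    (hab : ∀ x ∈ P, ∀ y ∈ P, (e * x * e) * (e * y * e) = (e * y * e) * (e * x * e)) {m : ℕ}
    {w : Fin m → B} (hwP : ∀ k, w k ∈ P) (hw : ∀ k, star (w k) * w k = e)
    (hwz : ∑ k, w k * star (w k) = z) {v : Fin (m + 1) → B} (hvP : ∀ r, v r ∈ P)
    (hv : ∀ r s, star (v r) * v s = if r = s then F else 0) (hzv : ∀ r, z * v r = v r)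
    (hvz : v 0 * z = v 0) : F = 0 := by
  have hs := he.isSelfAdjoint.star_eq
  have hee : e * e = e := he.isIdempotentElem
  have hwe : ∀ k, w k * e = w k := fun k => mul_eq_of_star_mul_self he (hw k)
  have hew : ∀ k, e * star (w k) = star (w k) := fun k => by
    have := congrArg star (hwe k)
    rwa [star_mul, hs] at this
  let S : Set B := {x | x ∈ P ∧ e * x * e = x}
  have hS : ∀ x ∈ S, ∀ y ∈ S, x * y = y * x := by
    rintro x ⟨hxP, hx⟩ y ⟨hyP, hy⟩
    have := hab x hxP y hyP
    rwa [hx, hy] at this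
  have hmem : ∀ k x l, x ∈ P → star (w k) * x * w l ∈ S := fun k x l hx =>
    ⟨hmul _ (hmul _ (hstar _ (hwP k)) _ hx) _ (hwP l), by
      calc e * (star (w k) * x * w l) * e = (e * star (w k)) * x * (w l * e) := by noncomm_ring
        _ = _ := by rw [hew, hwe]⟩
  have hFP : F ∈ P := by
    have := hv 0 0
    rw [if_pos rfl] at this
    rw [← this]
    exact hmul _ (hstar _ (hvP 0)) _ (hvP 0)
  -- `P` is only closed under products and adjoints, so determinants are taken in the algebra
  -- generated by its commutative corner.
  let _ : CommRing (Algebra.adjoin ℂ S) :=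
    { (inferInstance : Ring (Algebra.adjoin ℂ S)) with
      mul_comm := (Algebra.isMulCommutative_adjoin ℂ hS).is_comm.comm }
  -- For fixed `l` the entries `w_k⋆ v_s w_l` lie in the commutative corner. Since the `w_k w_k⋆`
  -- sum to `z`, the `m + 1` columns of length `m` are orthogonal with common square `w_l⋆ F w_l`.
  -- This element is therefore nilpotent, and it equals `(v_0 w_l)⋆ (v_0 w_l)`.
  have key : ∀ l, v 0 * w l = 0 := by
    intro l
    have h1 : (star (w l) * F * w l) ^ (m + 1) = 0 := by
      have hst : ∀ k r, star (w l) * star (v r) * w k ∈ S := fun k r =>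
        hmem l _ k (hstar _ (hvP r))
      have := pow_eq_zero_of_wide (R := Algebra.adjoin ℂ S)
        (fun k r => ⟨star (w l) * star (v r) * w k, Algebra.subset_adjoin (hst k r)⟩)
        (fun k s => ⟨star (w k) * v s * w l, Algebra.subset_adjoin (hmem k _ l (hvP s))⟩)
        (y := ⟨star (w l) * F * w l, Algebra.subset_adjoin (hmem l _ l hFP)⟩) (fun r s => by
          refine Subtype.ext ?_
          have e1 : ∀ k, star (w l) * star (v r) * w k * (star (w k) * v s * w l) =
              star (w l) * star (v r) * (w k * star (w k)) * (v s * w l) := fun k => by noncomm_ring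
          have e2 : ∑ k, star (w l) * star (v r) * w k * (star (w k) * v s * w l) =
              star (w l) * (star (v r) * v s) * w l := by
            simp only [e1]
            rw [← Finset.sum_mul, ← Finset.mul_sum, hwz, mul_assoc _ z, ← mul_assoc z, hzv]
            noncomm_ring
          refine (AddSubmonoidClass.coe_finsetSum _ _).trans (e2.trans ?_)
          rw [hv]
          split_ifs
          · rfl
          · rw [mul_zero, zero_mul]; rfl)
      exact congrArg Subtype.val this
    have h2 : star (w l) * F * w l = star (v 0 * w l) * (v 0 * w l) := by
      have := hv 0 0
      rw [if_pos rfl] at this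
      rw [← this, star_mul]; noncomm_ring
    rw [h2] at h1
    exact (CStarRing.star_mul_self_eq_zero_iff _).1
      (eq_zero_of_isSelfAdjoint_of_pow (IsSelfAdjoint.star_mul_self _) h1)
  have h0 : v 0 = 0 := by
    rw [← hvz, ← hwz, Finset.mul_sum]
    refine Finset.sum_eq_zero fun k _ => ?_
    rw [← mul_assoc, key, zero_mul]
  have := hv 0 0
  rw [h0, if_pos rfl, mul_zero] at this
  exact this.symm

variable {H : Type*} [NormedAddCommGroup H] [InnerProductSpace ℂ H] [CompleteSpace H]

/-- A homogeneous family of abelian projections of `P` with sum `z`. -/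
structure IsHomogeneous (P E : Set (H →L[ℂ] H)) (z : H →L[ℂ] H) : Prop where
  abelian : ∀ e ∈ E, IsAbelianProjection P e
  equiv : ∀ e ∈ E, ∀ f ∈ E, MvNEquiv P e f
  orth : ∀ e ∈ E, ∀ f ∈ E, e ≠ f → e * f = 0
  hasSum : ∀ ξ : H, HasSum (fun e : E => (e : H →L[ℂ] H) ξ) (z ξ)

/-- If `E` has `m` elements and `E'` more, pick `m + 1` elements `f_r` of `E'` and partial
isometries `v_r` from `f_0` to `f_r`. Cut down by `z` they contradict `eq_zero_of_equivalents`
unless `z f_0 = 0`. By equivalence `z` then kills all of `E'`, and so `z z' = 0`. -/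
theorem IsHomogeneous.encard_le {P E E' : Set (H →L[ℂ] H)} {z z' : H →L[ℂ] H}
    (hmul : ∀ x ∈ P, ∀ y ∈ P, x * y ∈ P) (hstar : ∀ x ∈ P, star x ∈ P) (hzP : z ∈ P)
    (hz : IsStarProjection z) (hzc : ∀ x ∈ P, z * x = x * z)
    (h : IsHomogeneous P E z) (h' : IsHomogeneous P E' z') (h0 : z * z' ≠ 0) :
    E'.encard ≤ E.encard := by
  by_contra hlt
  rw [not_le] at hlt
  have hfin : E.Finite := Set.encard_lt_top_iff.1 (hlt.trans_le le_top)
  obtain ⟨m, hm⟩ : ∃ m : ℕ, E.encard = m := ⟨_, hfin.encard_eq_coe⟩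
  have hm1 : ((m + 1 : ℕ) : ℕ∞) ≤ E'.encard := by
    rw [hm] at hlt
    exact_mod_cast Order.add_one_le_of_lt hlt
  obtain ⟨E₁, hE₁, hcard⟩ := Set.exists_subset_encard_eq hm1
  have hzz : z * z = z := hz.isIdempotentElem
  have hzs := hz.isSelfAdjoint.star_eq
  have hEm : Nat.card E = m := by
    rw [Nat.card_coe_set_eq, Set.ncard, hm]; rfl
  have : Finite E := hfin
  have hE₁m : Nat.card E₁ = m + 1 := by
    rw [Nat.card_coe_set_eq, Set.ncard, hcard]; rfl
  have : Finite E₁ := Nat.finite_of_card_ne_zero (by omega)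
  let σ : Fin m ≃ E := (Finite.equivFinOfCardEq hEm).symm
  let σ' : Fin (m + 1) ≃ E₁ := (Finite.equivFinOfCardEq hE₁m).symm
  set f : Fin (m + 1) → H →L[ℂ] H := fun r => σ' r with hf
  have hfE : ∀ r, f r ∈ E' := fun r => hE₁ (σ' r).2
  have hsumE : ∑ k, ((σ k : E) : H →L[ℂ] H) = z := by
    ext ξ
    have h1 := (σ.hasSum_iff.2 (h.hasSum ξ))
    have h2 := hasSum_fintype (fun k => ((σ k : E) : H →L[ℂ] H) ξ)
    rw [sum_apply]
    exact h2.unique h1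
  choose v hvP hv1 hv2 using fun r => h'.equiv (f 0) (hfE 0) (f r) (hfE r)
  have hF : z * f 0 = 0 := by
    rcases Set.eq_empty_or_nonempty E with rfl | ⟨e, he⟩
    · have : z = 0 := by
        ext ξ
        exact (h.hasSum ξ).unique hasSum_empty
      rw [this, zero_mul]
    choose w hwP hw1 hw2 using fun k => h.equiv e he (σ k) (σ k).2
    obtain ⟨-, hep, hab⟩ := h.abelian e he
    refine eq_zero_of_equivalents hmul hstar hep hab (z := z) hwP hw1 ?_
      (v := fun r => z * v r) (fun r => hmul _ hzP _ (hvP r)) (fun r s => ?_) (fun r => ?_) ?_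
    · rw [← hsumE]
      exact Finset.sum_congr rfl fun k _ => hw2 k
    · have e1 : star (z * v r) * (z * v s) = z * (star (v r) * v s) := by
        rw [star_mul, hzs, mul_assoc, ← mul_assoc z, hzz, ← mul_assoc, ← hzc _ (hstar _ (hvP r)),
          mul_assoc]
      rw [e1]
      split_ifs with hrs
      · rw [← hrs, hv1]
      · have h1 : f r * f s = 0 := h'.orth _ (hfE r) _ (hfE s) fun h =>
          hrs (σ'.injective (Subtype.ext h))
        have h2 : ∀ r, f r * v r = v r := fun r => by
          have h3 : star (v r) * f r = star (v r) :=
            mul_eq_of_star_mul_self (h'.abelian _ (hfE r)).2.1 (by rw [star_star, hv2])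
          have h4 := congrArg star h3
          rwa [star_mul, star_star, (h'.abelian _ (hfE r)).2.1.isSelfAdjoint.star_eq] at h4
        have h3 : star (v r) * f r = star (v r) :=
            mul_eq_of_star_mul_self (h'.abelian _ (hfE r)).2.1 (by rw [star_star, hv2])
        rw [← h3, ← h2 s, mul_assoc, ← mul_assoc (f r), h1, zero_mul, mul_zero, mul_zero]
    · rw [← mul_assoc, hzz]
    · change z * v 0 * z = z * v 0
      rw [mul_assoc, ← hzc _ (hvP 0), ← mul_assoc, hzz]
  refine h0 ?_
  ext ξ
  have key : ∀ g : E', z * (g : H →L[ℂ] H) = 0 := by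
    intro g
    obtain ⟨w, hwP, hw1, hw2⟩ := h'.equiv (f 0) (hfE 0) g g.2
    have h3 : w * f 0 = w := mul_eq_of_star_mul_self (h'.abelian _ (hfE 0)).2.1 hw1
    rw [← hw2, ← mul_assoc, hzc _ hwP, ← h3, mul_assoc w, ← hzc _ (h'.abelian _ (hfE 0)).1, hF,
      mul_zero, zero_mul]
  have h2 : (fun g : E' => z ((g : H →L[ℂ] H) ξ)) = fun _ => 0 :=
    funext fun g => DFunLike.congr_fun (key g) ξ
  have h1 := (h'.hasSum ξ).mapL z
  rw [h2] at h1
  exact h1.unique hasSum_zero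

end TypeUniqueness

/-! ### The copies of `L²(A) ⊗ L²(A)` inside the coarse bimodule. -/

section Legs

variable {E : Type u} [NormedAddCommGroup E] [InnerProductSpace ℂ E]
  {K : Type v} [NormedAddCommGroup K] [InnerProductSpace ℂ K]

theorem TripleTensor.clm_ext {F : Type*} [NormedAddCommGroup F] [NormedSpace ℂ F]
    {S T : TripleTensor E K →L[ℂ] F} (h : ∀ x k y, S (tmul x k y) = T (tmul x k y)) : S = T :=
  ContinuousLinearMap.ext fun t =>
    TripleTensor.mem_of_tmul (V := LinearMap.eqLocus S.toLinearMap T.toLinearMap)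
      (isClosed_eq S.continuous T.continuous) h t

/-- The map `x ⊗ y ↦ x ⊗ k ⊗ y` on the algebraic tensor product. -/
def legLin (k : K) : E ⊗[ℂ] (ℂ ⊗[ℂ] E) →ₗ[ℂ] TripleTensor E K :=
  tripleCoe ∘ₗ TensorProduct.map LinearMap.id
    (TensorProduct.map (LinearMap.toSpanSingleton ℂ K k) LinearMap.id)

/-- For a unit vector `k`, the map `c ↦ c k` is isometric on the middle factor. Hence `legLin k` is
isometric on algebraic tensors and extends to the completion. -/
theorem inner_legLin {k : K} (hk : ‖k‖ = 1) (s t : E ⊗[ℂ] (ℂ ⊗[ℂ] E)) :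
    ⟪legLin k s, legLin k t⟫_ℂ = ⟪tripleCoe s, tripleCoe t⟫_ℂ := by
  have hkk : ⟪k, k⟫_ℂ = 1 := by rw [inner_self_eq_norm_sq_to_K, hk]; simp
  induction s with
  | zero => simp
  | add a b ha hb => simp only [map_add, inner_add_left, ha, hb]
  | tmul x z =>
    induction z with
    | zero => simp
    | add a b ha hb => simp only [TensorProduct.tmul_add, map_add, inner_add_left, ha, hb]
    | tmul c y =>
      induction t with
      | zero => simp
      | add a b ha hb => simp only [map_add, inner_add_right, ha, hb]
      | tmul x' z' =>
        induction z' with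
        | zero => simp
        | add a b ha hb => simp only [TensorProduct.tmul_add, map_add, inner_add_right, ha, hb]
        | tmul c' y' =>
          change ⟪tmul x (c • k) y, tmul x' (c' • k) y'⟫_ℂ = ⟪tmul x c y, tmul x' c' y'⟫_ℂ
          rw [inner_tmul, inner_tmul, inner_smul_left, inner_smul_right, hkk, mul_one,
            RCLike.inner_apply, mul_comm (starRingEnd ℂ c)]

/-- The isometry `x ⊗ y ↦ x ⊗ k ⊗ y`, for a unit vector `k`. -/
def leg (k : K) : TripleTensor E ℂ →L[ℂ] TripleTensor E K := (legLin k).extendOfNorm tripleCoe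

theorem leg_tmul {k : K} (hk : ‖k‖ = 1) (x : E) (c : ℂ) (y : E) :
    leg k (tmul x c y) = tmul x (c • k) y := by
  rw [← tripleCoe_tmul, leg, LinearMap.extendOfNorm_eq denseRange_tripleCoe ⟨1, fun s => ?_⟩]
  · rfl
  · rw [one_mul, ← sq_le_sq₀ (norm_nonneg _) (norm_nonneg _),
      ← inner_self_eq_norm_sq (𝕜 := ℂ), ← inner_self_eq_norm_sq (𝕜 := ℂ), inner_legLin hk]

theorem adjoint_leg_tmul {k : K} (hk : ‖k‖ = 1) (x : E) (l : K) (y : E) :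
    ContinuousLinearMap.adjoint (leg k) (tmul x l y) = tmul x ⟪k, l⟫_ℂ y := by
  refine ext_inner_left ℂ fun d => ?_
  have h : innerSL ℂ (ContinuousLinearMap.adjoint (leg k) (tmul x l y)) =
      innerSL ℂ (tmul x ⟪k, l⟫_ℂ y) := by
    refine TripleTensor.clm_ext fun x' c y' => ?_
    rw [innerSL_apply_apply, innerSL_apply_apply, ContinuousLinearMap.adjoint_inner_left,
      leg_tmul hk, inner_tmul, inner_tmul, inner_smul_right, ← inner_conj_symm l k]
    simp only [RCLike.inner_apply]
  have h2 := DFunLike.congr_fun h d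
  rw [innerSL_apply_apply, innerSL_apply_apply] at h2
  rw [← inner_conj_symm, h2, inner_conj_symm]

end Legs

/-! ### The commutant on the coarse bimodule and the Pukánszky invariant. -/

section Pukanszky

variable {H : Type u} [NormedAddCommGroup H] [InnerProductSpace ℂ H] [CompleteSpace H]
variable {M : VonNeumannAlgebra H} {τ : Trace M} {A : VonNeumannAlgebra H}
variable {K : Type v} [NormedAddCommGroup K] [InnerProductSpace ℂ K]

theorem Trace.eA_right {a : M} (ha : (a : H →L[ℂ] H) ∈ A) :
    τ.eA A * τ.right a = τ.right a * τ.eA A :=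
  starProjection_comm (fun _ h => τ.right_mem A ha h) fun _ h => by
    rw [τ.right_star]; exact τ.right_mem A (star_mem ha) h

/-- The commutant of a bicommutant is the commutant of the generators, so commutation need only be
tested on the left and right actions of `A`. -/
theorem mem_pukanszkyAlgebra_iff {T : τ.L2 →L[ℂ] τ.L2} : T ∈ pukanszkyAlgebra τ A ↔
    (∀ a : M, (a : H →L[ℂ] H) ∈ A → T * τ.left a = τ.left a * T ∧ T * τ.right a = τ.right a * T) ∧
      (∀ ξ ∈ τ.L2sub A, T ξ = 0) ∧ ∀ ξ, T ξ ∈ (τ.L2sub A)ᗮ := by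
  have : T ∈ Set.centralizer (leftRightAlgebra τ A) ↔ ∀ a : M, (a : H →L[ℂ] H) ∈ A →
      T * τ.left a = τ.left a * T ∧ T * τ.right a = τ.right a * T := by
    rw [leftRightAlgebra, Set.centralizer_centralizer_centralizer, Set.mem_centralizer_iff]
    constructor
    · exact fun h a ha => ⟨(h _ ⟨a, ha, Or.inl rfl⟩).symm, (h _ ⟨a, ha, Or.inr rfl⟩).symm⟩
    · rintro h _ ⟨a, ha, rfl | rfl⟩
      exacts [(h a ha).1.symm, (h a ha).2.symm]
  rw [pukanszkyAlgebra, Set.mem_ofPred_eq, this]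

theorem mul_mem_pukanszkyAlgebra {S T : τ.L2 →L[ℂ] τ.L2} (hS : S ∈ pukanszkyAlgebra τ A)
    (hT : T ∈ pukanszkyAlgebra τ A) : S * T ∈ pukanszkyAlgebra τ A := by
  rw [mem_pukanszkyAlgebra_iff] at *
  refine ⟨fun a ha => ⟨?_, ?_⟩, fun ξ hξ => ?_, fun ξ => hS.2.2 _⟩
  · rw [mul_assoc, (hT.1 a ha).1, ← mul_assoc, (hS.1 a ha).1, mul_assoc]
  · rw [mul_assoc, (hT.1 a ha).2, ← mul_assoc, (hS.1 a ha).2, mul_assoc]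
  · change S (T ξ) = 0
    rw [hT.2.1 ξ hξ, map_zero]

theorem star_mem_pukanszkyAlgebra {T : τ.L2 →L[ℂ] τ.L2} (hT : T ∈ pukanszkyAlgebra τ A) :
    star T ∈ pukanszkyAlgebra τ A := by
  rw [mem_pukanszkyAlgebra_iff] at *
  have hin : ∀ ξ η, ⟪ξ, star T η⟫_ℂ = ⟪T ξ, η⟫_ℂ := fun ξ η =>
    ContinuousLinearMap.adjoint_inner_right T ξ η
  refine ⟨fun a ha => ⟨?_, ?_⟩, fun ξ hξ => ?_, fun ξ => ?_⟩
  · have := congrArg star (hT.1 (star a) (star_mem ha)).1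
    rw [star_mul, star_mul, τ.left_star, star_star] at this
    exact this.symm
  · have := congrArg star (hT.1 (star a) (star_mem ha)).2
    rw [star_mul, star_mul, τ.right_star, star_star] at this
    exact this.symm
  · refine ext_inner_left ℂ fun η => ?_
    rw [hin, inner_zero_right]
    exact (Submodule.mem_orthogonal' _ _).1 (hT.2.2 η) ξ hξ
  · rw [Submodule.mem_orthogonal]
    intro η hη
    rw [hin, hT.2.1 η hη, inner_zero_left]

theorem combination_mem_pukanszkyAlgebra {S T : τ.L2 →L[ℂ] τ.L2} (hS : S ∈ pukanszkyAlgebra τ A)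
    (hT : T ∈ pukanszkyAlgebra τ A) (c d : ℂ) : c • S + d • T ∈ pukanszkyAlgebra τ A := by
  rw [mem_pukanszkyAlgebra_iff] at *
  refine ⟨fun a ha => ⟨?_, ?_⟩, fun ξ hξ => ?_, fun ξ => ?_⟩
  · simp only [add_mul, mul_add, smul_mul_assoc, mul_smul_comm, (hS.1 a ha).1, (hT.1 a ha).1]
  · simp only [add_mul, mul_add, smul_mul_assoc, mul_smul_comm, (hS.1 a ha).2, (hT.1 a ha).2]
  · change c • S ξ + d • T ξ = 0
    rw [hS.2.1 ξ hξ, hT.2.1 ξ hξ, smul_zero, smul_zero, add_zero]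
  · exact Submodule.add_mem _ (Submodule.smul_mem _ _ (hS.2.2 ξ)) (Submodule.smul_mem _ _ (hT.2.2 ξ))

theorem one_sub_eA_mem : 1 - τ.eA A ∈ pukanszkyAlgebra τ A := by
  rw [mem_pukanszkyAlgebra_iff]
  refine ⟨fun a ha => ⟨?_, ?_⟩, fun ξ hξ => ?_, fun ξ => ?_⟩
  · rw [sub_mul, mul_sub, τ.eA_left ha, one_mul, mul_one]
  · rw [sub_mul, mul_sub, τ.eA_right ha, one_mul, mul_one]
  · change ξ - τ.eA A ξ = 0
    rw [τ.eA_of_mem hξ, sub_self]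
  · exact Submodule.sub_starProjection_mem_orthogonal _

theorem isStarProjection_one_sub_eA : IsStarProjection (1 - τ.eA A) :=
  isStarProjection_starProjection.one_sub

theorem one_sub_eA_mul {T : τ.L2 →L[ℂ] τ.L2} (hT : T ∈ pukanszkyAlgebra τ A) :
    (1 - τ.eA A) * T = T := by
  ext ξ
  change T ξ - τ.eA A (T ξ) = T ξ
  have : τ.eA A (T ξ) = 0 := (Submodule.starProjection_apply_eq_zero_iff _).2
    ((mem_pukanszkyAlgebra_iff.1 hT).2.2 ξ)
  rw [this, sub_zero]

theorem mul_one_sub_eA {T : τ.L2 →L[ℂ] τ.L2} (hT : T ∈ pukanszkyAlgebra τ A) :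
    T * (1 - τ.eA A) = T := by
  ext ξ
  change T (ξ - τ.eA A ξ) = T ξ
  rw [map_sub, (mem_pukanszkyAlgebra_iff.1 hT).2.1 _ (τ.eA_mem ξ), sub_zero]

namespace CoarseDecomposition

variable (C : CoarseDecomposition τ A K)

theorem mem_of_triv_of_tmul {V : Submodule ℂ τ.L2} (hV : IsClosed (V : Set τ.L2))
    (h : ∀ x, C.triv x ∈ V) (h' : ∀ x k y, C.coarse (tmul x k y) ∈ V) (ξ : τ.L2) : ξ ∈ V := by
  obtain ⟨x, t, rfl⟩ := C.exists_eq_add ξ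
  exact V.add_mem (h x) (TripleTensor.mem_of_tmul (V := V.comap C.coarse.toLinearMap)
    (hV.preimage C.coarse.continuous) h' t)

theorem clm_ext {S T : τ.L2 →L[ℂ] τ.L2} (h : ∀ x, S (C.triv x) = T (C.triv x))
    (h' : ∀ x k y, S (C.coarse (tmul x k y)) = T (C.coarse (tmul x k y))) : S = T :=
  ContinuousLinearMap.ext fun ξ =>
    C.mem_of_triv_of_tmul (V := LinearMap.eqLocus S.toLinearMap T.toLinearMap)
      (isClosed_eq S.continuous T.continuous) h h' ξ

/-- The embedding of the copy of `L²(A) ⊗ L²(A)` given by `k`. -/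
def emb (k : K) : TripleTensor (τ.L2A A) ℂ →L[ℂ] τ.L2 := C.coarse.toContinuousLinearMap ∘L leg k

theorem emb_tmul {k : K} (hk : ‖k‖ = 1) (x : τ.L2A A) (c : ℂ) (y : τ.L2A A) :
    C.emb k (tmul x c y) = C.coarse (tmul x (c • k) y) := by
  rw [← leg_tmul hk]; rfl

open ContinuousLinearMap in
theorem adjoint_emb_coarse {k : K} (hk : ‖k‖ = 1) (x : τ.L2A A) (l : K) (y : τ.L2A A) :
    adjoint (C.emb k) (C.coarse (tmul x l y)) = tmul x ⟪k, l⟫_ℂ y := by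
  rw [← adjoint_leg_tmul hk]
  refine ext_inner_left ℂ fun d => ?_
  rw [adjoint_inner_right, adjoint_inner_right]
  exact C.coarse.inner_map_map _ _

open ContinuousLinearMap in
theorem adjoint_emb_triv (k : K) (x : τ.L2A A) : adjoint (C.emb k) (C.triv x) = 0 := by
  refine ext_inner_left ℂ fun d => ?_
  rw [adjoint_inner_right, inner_zero_right, ← inner_conj_symm]
  change starRingEnd ℂ ⟪C.triv x, C.coarse _⟫_ℂ = 0
  rw [C.inner_triv_coarse, map_zero]

open ContinuousLinearMap in
theorem adjoint_emb_emb {k l : K} (hk : ‖k‖ = 1) (hl : ‖l‖ = 1) (d : TripleTensor (τ.L2A A) ℂ) :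
    adjoint (C.emb k) (C.emb l d) = ⟪k, l⟫_ℂ • d := by
  have : adjoint (C.emb k) ∘L C.emb l = ⟪k, l⟫_ℂ • ContinuousLinearMap.id ℂ _ := by
    refine TripleTensor.clm_ext fun x c y => ?_
    rw [comp_apply, C.emb_tmul hl, C.adjoint_emb_coarse hk]
    change _ = ⟪k, l⟫_ℂ • tripleCoe (x ⊗ₜ[ℂ] (c ⊗ₜ[ℂ] y))
    rw [← map_smul, ← TensorProduct.tmul_smul, TensorProduct.smul_tmul', tripleCoe_tmul,
      inner_smul_right, smul_eq_mul, mul_comm]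
  exact DFunLike.congr_fun this d

/-- The operator `1 ⊗ |l⟩⟨k| ⊗ 1` on the coarse bimodule. -/
def matUnit (l k : K) : τ.L2 →L[ℂ] τ.L2 := C.emb l ∘L ContinuousLinearMap.adjoint (C.emb k)

theorem star_matUnit (l k : K) : star (C.matUnit l k) = C.matUnit k l := by
  rw [matUnit, matUnit, ContinuousLinearMap.star_eq_adjoint, ContinuousLinearMap.adjoint_comp,
    ContinuousLinearMap.adjoint_adjoint]

theorem matUnit_mul {i j k l : K} (hj : ‖j‖ = 1) (hk : ‖k‖ = 1) :
    C.matUnit i j * C.matUnit k l = ⟪j, k⟫_ℂ • C.matUnit i l := by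
  ext ξ
  change C.emb i (ContinuousLinearMap.adjoint (C.emb j) (C.emb k _)) = ⟪j, k⟫_ℂ • C.emb i _
  rw [C.adjoint_emb_emb hj hk, map_smul]

theorem matUnit_triv (k l : K) (x : τ.L2A A) : C.matUnit l k (C.triv x) = 0 := by
  change C.emb l (ContinuousLinearMap.adjoint (C.emb k) (C.triv x)) = 0
  rw [C.adjoint_emb_triv, map_zero]

theorem matUnit_coarse {k l : K} (hk : ‖k‖ = 1) (hl : ‖l‖ = 1) (x : τ.L2A A) (j : K)
    (y : τ.L2A A) :
    C.matUnit l k (C.coarse (tmul x j y)) = C.coarse (tmul x (⟪k, j⟫_ℂ • l) y) := by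
  change C.emb l (ContinuousLinearMap.adjoint (C.emb k) (C.coarse (tmul x j y))) = _
  rw [C.adjoint_emb_coarse hk, C.emb_tmul hl]

theorem matUnit_mem (hAM : A ≤ M) (hA : IsAbelian A) (hd : HasNoMinimalProjection A) {k l : K}
    (hk : ‖k‖ = 1) (hl : ‖l‖ = 1) : C.matUnit l k ∈ pukanszkyAlgebra τ A := by
  rw [mem_pukanszkyAlgebra_iff]
  refine ⟨fun a ha => ⟨C.clm_ext (fun x => ?_) fun x j y => ?_,
    C.clm_ext (fun x => ?_) fun x j y => ?_⟩, fun ξ hξ => ?_, fun ξ => ?_⟩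
  · change C.matUnit l k (τ.left a _) = τ.left a (C.matUnit l k _)
    rw [C.left_triv ha, C.matUnit_triv, C.matUnit_triv, map_zero]
  · change C.matUnit l k (τ.left a _) = τ.left a (C.matUnit l k _)
    rw [C.left_coarse_tmul ha, C.matUnit_coarse hk hl, C.matUnit_coarse hk hl,
      C.left_coarse_tmul ha]
  · change C.matUnit l k (τ.right a _) = τ.right a (C.matUnit l k _)
    rw [C.right_triv ha, C.matUnit_triv, C.matUnit_triv, map_zero]
  · change C.matUnit l k (τ.right a _) = τ.right a (C.matUnit l k _)
    rw [C.right_coarse_tmul ha, C.matUnit_coarse hk hl, C.matUnit_coarse hk hl,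
      C.right_coarse_tmul ha]
  · obtain ⟨x, rfl⟩ := (C.range_triv hAM hA hd).2 hξ
    exact C.matUnit_triv k l x
  · exact (C.range_coarse hAM hA hd).1 ⟨_, rfl⟩

theorem isStarProjection_matUnit {k : K} (hk : ‖k‖ = 1) : IsStarProjection (C.matUnit k k) := by
  refine ⟨?_, C.star_matUnit k k⟩
  rw [IsIdempotentElem, C.matUnit_mul hk hk, inner_self_eq_norm_sq_to_K, hk]
  simp

-- The range of this projection is generated by `1 ⊗ k ⊗ 1` under the abelian family of operators `ξ
-- ↦ a ξ b`, so the commutant is commutative on it. `commute_apply_of_cyclic` needs one self-adjoint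
-- operator, hence the splitting of `x` into real and imaginary parts.
open scoped ComplexStarModule in
theorem isAbelianProjection_matUnit (hAM : A ≤ M) (hA : IsAbelian A)
    (hd : HasNoMinimalProjection A) {k : K} (hk : ‖k‖ = 1) :
    IsAbelianProjection (pukanszkyAlgebra τ A) (C.matUnit k k) := by
  set e := C.matUnit k k with he
  have heP := C.matUnit_mem hAM hA hd hk hk
  have hep := C.isStarProjection_matUnit hk
  have hee : e * e = e := hep.isIdempotentElem
  refine ⟨heP, hep, fun x hx y hy => ?_⟩
  have h1A : ((1 : M) : H →L[ℂ] H) ∈ A := one_mem A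
  set Ω := C.coarse (tmul (τ.vecA h1A) k (τ.vecA h1A)) with hΩ
  set G : Set (τ.L2 →L[ℂ] τ.L2) := {T | ∃ a b : M, (a : H →L[ℂ] H) ∈ A ∧ (b : H →L[ℂ] H) ∈ A ∧
    T = τ.left a * τ.right b} with hG
  have hAc : ∀ a b : M, (a : H →L[ℂ] H) ∈ A → (b : H →L[ℂ] H) ∈ A → a * b = b * a :=
    fun a b ha hb => Subtype.ext (hA _ ha _ hb)
  have hGm : ∀ a b c d : M, τ.left a * τ.right b * (τ.left c * τ.right d) =
      τ.left (a * c) * τ.right (d * b) := fun a b c d => by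
    rw [map_mul, τ.right_mul]
    calc _ = τ.left a * (τ.right b * τ.left c) * τ.right d := by noncomm_ring
      _ = _ := by rw [← τ.left_right_comm]; noncomm_ring
  have hcyc : ∀ ξ, e ξ ∈ cyclicSubspace G Ω := by
    intro ξ
    have hcl : IsClosed (cyclicSubspace G Ω : Set τ.L2) := Submodule.isClosed_topologicalClosure _
    refine TripleTensor.mem_of_tmul (V := (cyclicSubspace G Ω).comap (C.emb k).toLinearMap)
      (hcl.preimage (C.emb k).continuous) (fun x c y => ?_) _
    change C.emb k (tmul x c y) ∈ cyclicSubspace G Ω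
    rw [C.emb_tmul hk]
    have h1 : Continuous fun p : τ.L2A A × τ.L2A A => C.coarse (tmul p.1 (c • k) p.2) :=
      C.coarse.continuous.comp (continuous_tmul.comp
        (continuous_fst.prodMk (continuous_const.prodMk continuous_snd)))
    have h2 := (τ.dense_vecA (A := A)).prod (τ.dense_vecA (A := A))
    refine h2.induction (P := fun p => C.coarse (tmul p.1 (c • k) p.2) ∈ cyclicSubspace G Ω) ?_
      (hcl.preimage h1) (x, y)
    rintro ⟨x, y⟩ ⟨⟨a, ha, hax⟩, b, hb, hby⟩
    simp only at hax hby ⊢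
    have h3 : C.coarse (tmul x (c • k) y) = c • (τ.left a * τ.right b) Ω := by
      change _ = c • τ.left a (τ.right b Ω)
      rw [hΩ, C.right_coarse_tmul hb, C.left_coarse_tmul ha, τ.leftA_vecA, τ.rightA_vecA,
        ← map_smul C.coarse, ← hax, ← hby]
      congr 1
      rw [← tripleCoe_tmul, ← tripleCoe_tmul, ← map_smul, ← TensorProduct.tmul_smul,
        TensorProduct.smul_tmul']
      congr
    rw [h3]
    exact Submodule.smul_mem _ _ (apply_mem_cyclicSubspace ⟨a, b, ha, hb, rfl⟩)
  have hcommG : ∀ T ∈ pukanszkyAlgebra τ A, ∀ d ∈ G, T * d = d * T := by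
    rintro T hT _ ⟨a, b, ha, hb, rfl⟩
    rw [mem_pukanszkyAlgebra_iff] at hT
    rw [← mul_assoc, (hT.1 a ha).1, mul_assoc, (hT.1 b hb).2, mul_assoc]
  have heP' : ∀ T ∈ pukanszkyAlgebra τ A, e * T * e ∈ pukanszkyAlgebra τ A := fun T hT =>
    mul_mem_pukanszkyAlgebra (mul_mem_pukanszkyAlgebra heP hT) heP
  have main : ∀ S ∈ pukanszkyAlgebra τ A, IsSelfAdjoint S → ∀ T ∈ pukanszkyAlgebra τ A,
      (e * T * e) * (e * S * e) = (e * S * e) * (e * T * e) := by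
    intro S hS hSs T hT
    have hSs' : IsSelfAdjoint (e * S * e) := by
      rw [isSelfAdjoint_iff, star_mul, star_mul, hSs.star_eq, hep.isSelfAdjoint.star_eq, mul_assoc]
    ext ξ
    have := commute_apply_of_cyclic (G := G) (Ω := Ω) (S := e * S * e) (T := e * T * e)
      (by
        rintro _ ⟨a, b, ha, hb, rfl⟩ _ ⟨c, d, hc, hd, rfl⟩
        exact ⟨a * c, d * b, mul_mem ha hc, mul_mem hd hb, hGm a b c d⟩)
      (by
        rintro _ ⟨a, b, ha, hb, rfl⟩
        refine ⟨star a, star b, star_mem ha, star_mem hb, ?_⟩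
        rw [star_mul, τ.left_star, τ.right_star, τ.left_right_comm])
      (by
        rintro _ ⟨a, b, ha, hb, rfl⟩ _ ⟨c, d, hc, hd, rfl⟩
        rw [hGm, hGm, hAc a c ha hc, hAc b d hb hd])
      hSs' (hcommG _ (heP' S hS)) (hcommG _ (heP' T hT)) (hcyc _) (hcyc _) (hcyc ξ)
    have h1 : ∀ T : τ.L2 →L[ℂ] τ.L2, e * T * e * e = e * T * e := fun T => by rw [mul_assoc, hee]
    have h2 : ∀ T : τ.L2 →L[ℂ] τ.L2, (e * T * e) (e ξ) = (e * T * e) ξ := fun T =>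
      DFunLike.congr_fun (h1 T) ξ
    rw [h2, h2] at this
    exact this
  have hre : (ℜ x : τ.L2 →L[ℂ] τ.L2) ∈ pukanszkyAlgebra τ A := by
    rw [realPart_apply_coe, smul_add]
    exact combination_mem_pukanszkyAlgebra hx (star_mem_pukanszkyAlgebra hx) ((2⁻¹ : ℝ) : ℂ)
      ((2⁻¹ : ℝ) : ℂ)
  have him : (ℑ x : τ.L2 →L[ℂ] τ.L2) ∈ pukanszkyAlgebra τ A := by
    rw [imaginaryPart_apply_coe, smul_sub, smul_sub, sub_eq_add_neg, ← neg_smul]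
    have := combination_mem_pukanszkyAlgebra hx (star_mem_pukanszkyAlgebra hx)
      (-Complex.I * ((2⁻¹ : ℝ) : ℂ)) (-(-Complex.I) * ((2⁻¹ : ℝ) : ℂ))
    rw [mul_smul, mul_smul] at this
    exact this
  rw [← realPart_add_I_smul_imaginaryPart x]
  simp only [mul_add, add_mul, mul_smul_comm, smul_mul_assoc]
  rw [main _ hre (ℜ x).2 y hy, main _ him (ℑ x).2 y hy]

theorem matUnit_ne_zero {k : K} (hk : ‖k‖ = 1) : C.matUnit k k ≠ 0 := by
  intro h
  have h1A : ((1 : M) : H →L[ℂ] H) ∈ A := one_mem A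
  have h1 := C.matUnit_coarse hk hk (τ.vecA h1A) k (τ.vecA h1A)
  rw [h, zero_apply, inner_self_eq_norm_sq_to_K, hk] at h1
  have h2 := congrArg norm h1
  have h3 : ‖τ.vecA h1A‖ = 1 := by
    rw [τ.norm_vecA, ← sq_eq_sq₀ (norm_nonneg _) zero_le_one, τ.norm_vec_sq]
    simp [τ.map_one]
  rw [C.coarse.norm_map, norm_tmul, h3] at h2
  simp [hk] at h2

/-- The projections of an orthonormal basis of `K`. -/
def basisProjections (b : Set K) : Set (τ.L2 →L[ℂ] τ.L2) := Set.range fun k : b => C.matUnit k k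

theorem injective_matUnit {b : Set K} (hb : Orthonormal ℂ ((↑) : b → K)) :
    Function.Injective fun k : b => C.matUnit (k : K) k := by
  intro k l hkl
  by_contra hne
  refine C.matUnit_ne_zero (hb.1 k) ?_
  have h1 : C.matUnit (k : K) k * C.matUnit (k : K) k = C.matUnit (k : K) k * C.matUnit (l : K) l :=
    congrArg _ hkl
  rwa [(C.isStarProjection_matUnit (hb.1 k)).isIdempotentElem.eq, C.matUnit_mul (hb.1 k) (hb.1 l),
    hb.2 hne, zero_smul] at h1

/-- The matrix units give the equivalences. For the strong sum, the partial sums are projections and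
hence equicontinuous, so the vectors on which the series converges as required form a closed
subspace. On an elementary tensor the series is the expansion of its middle vector in the basis. -/
theorem isHomogeneous_basisProjections [CompleteSpace K] (hAM : A ≤ M) (hA : IsAbelian A)
    (hd : HasNoMinimalProjection A) {b : Set K} (β : HilbertBasis b ℂ K) (hβ : ⇑β = ((↑) : b → K)) :
    IsHomogeneous (pukanszkyAlgebra τ A) (C.basisProjections b) (1 - τ.eA A) := by
  have hb : Orthonormal ℂ ((↑) : b → K) := hβ ▸ β.orthonormal
  have hb1 : ∀ k : b, ‖(k : K)‖ = 1 := hb.1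
  have hmul : ∀ k l : b, k ≠ l → C.matUnit (k : K) k * C.matUnit (l : K) l = 0 := fun k l h => by
    rw [C.matUnit_mul (hb1 k) (hb1 l), hb.2 h, zero_smul]
  refine ⟨?_, ?_, ?_, ?_⟩
  · rintro _ ⟨k, rfl⟩
    exact C.isAbelianProjection_matUnit hAM hA hd (hb1 k)
  · rintro _ ⟨k, rfl⟩ _ ⟨l, rfl⟩
    refine ⟨C.matUnit l k, C.matUnit_mem hAM hA hd (hb1 k) (hb1 l), ?_, ?_⟩
    · rw [C.star_matUnit, C.matUnit_mul (hb1 l) (hb1 l), inner_self_eq_norm_sq_to_K, hb1]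
      simp
    · rw [C.star_matUnit, C.matUnit_mul (hb1 k) (hb1 k), inner_self_eq_norm_sq_to_K, hb1]
      simp
  · rintro _ ⟨k, rfl⟩ _ ⟨l, rfl⟩ hkl
    exact hmul k l fun h => hkl (by rw [h])
  · intro ξ
    refine (Equiv.ofInjective _ (C.injective_matUnit hb)).hasSum_iff.1 ?_
    have hproj : ∀ s : Finset b, IsStarProjection (∑ k ∈ s, C.matUnit (k : K) k) := fun s => by
      refine ⟨?_, isSelfAdjoint_sum _ fun k _ => (C.isStarProjection_matUnit (hb1 k)).isSelfAdjoint⟩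
      rw [IsIdempotentElem, Finset.sum_mul]
      refine Finset.sum_congr rfl fun k hk => ?_
      rw [Finset.mul_sum, Finset.sum_eq_single k (fun l _ hlk => hmul k l hlk.symm)
        fun h => absurd hk h]
      exact (C.isStarProjection_matUnit (hb1 k)).isIdempotentElem
    have hequi : Equicontinuous fun (s : Finset b) (ξ : τ.L2) => ∑ k ∈ s, C.matUnit (k : K) k ξ := by
      refine (LipschitzWith.uniformEquicontinuous _ 1 fun s => ?_).equicontinuous
      have h1 := (∑ k ∈ s, C.matUnit (k : K) k).lipschitz.weaken (K' := 1)
        (NNReal.coe_le_coe.1 ((hproj s).norm_le _))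
      exact fun ξ η => by simpa only [sum_apply] using h1 ξ η
    let V : Submodule ℂ τ.L2 :=
      { carrier := {ξ | HasSum (fun k : b => C.matUnit (k : K) k ξ) ((1 - τ.eA A) ξ)}
        zero_mem' := by simp
        add_mem' := fun h h' => by
          simpa only [Set.mem_ofPred_eq, map_add] using HasSum.add h h'
        smul_mem' := fun c ξ h => by
          simpa only [Set.mem_ofPred_eq, map_smul] using HasSum.const_smul c h }
    refine C.mem_of_triv_of_tmul (V := V) ?_ (fun x => ?_) (fun x j y => ?_) ξ
    · exact hequi.isClosed_setOfPred_tendsto (1 - τ.eA A).continuous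
    · change HasSum _ _
      have h1 : (1 - τ.eA A) (C.triv x) = 0 := by
        change C.triv x - τ.eA A (C.triv x) = 0
        rw [τ.eA_of_mem ((C.range_triv hAM hA hd).1 ⟨x, rfl⟩), sub_self]
      simp only [C.matUnit_triv, h1]
      exact hasSum_zero
    · change HasSum _ _
      have h1 : (1 - τ.eA A) (C.coarse (tmul x j y)) = C.coarse (tmul x j y) := by
        change C.coarse (tmul x j y) - τ.eA A (C.coarse (tmul x j y)) = _
        have : τ.eA A (C.coarse (tmul x j y)) = 0 := (Submodule.starProjection_apply_eq_zero_iff _).2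
          ((C.range_coarse hAM hA hd).1 ⟨_, rfl⟩)
        rw [this, sub_zero]
      rw [h1]
      simp only [fun k : b => C.matUnit_coarse (hb1 k) (hb1 k) x j y]
      let L : K →+ τ.L2 :=
        { toFun := fun k => C.coarse (tmul x k y)
          map_zero' := by
            rw [← tripleCoe_tmul, TensorProduct.zero_tmul, TensorProduct.tmul_zero, map_zero,
              map_zero]
          map_add' := fun k l => by
            simp only [← tripleCoe_tmul]
            rw [TensorProduct.add_tmul, TensorProduct.tmul_add, map_add, map_add] }
      have hL : Continuous L := C.coarse.continuous.comp (continuous_tmul.comp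
        (continuous_const.prodMk (continuous_id.prodMk continuous_const)))
      have h3 : HasSum (fun k : b => ⟪(k : K), j⟫_ℂ • (k : K)) j := by
        simpa only [β.repr_apply_apply, hβ] using β.hasSum_repr j
      exact h3.map L hL

/-- In the infinite case the algebraic dimension may exceed the cardinality of a Hilbert basis, but
both become `⊤`. -/
theorem toENat_rank [CompleteSpace K] {b : Set K} (β : HilbertBasis b ℂ K) :
    Cardinal.toENat (Module.rank ℂ K) = b.encard := by
  rw [← Set.toENat_cardinalMk]
  rcases b.finite_or_infinite with h | h
  · have := h.fintype
    rw [rank_eq_card_basis β.toOrthonormalBasis.toBasis, Cardinal.mk_fintype]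
  · have h1 : Cardinal.aleph0 ≤ Cardinal.mk b := Cardinal.infinite_iff.1 h.to_subtype
    have h2 : Cardinal.mk b ≤ Module.rank ℂ K := β.orthonormal.linearIndependent.cardinal_le_rank
    rw [Cardinal.toENat_eq_top.2 h1, Cardinal.toENat_eq_top.2 (h1.trans h2)]

-- `1 - e_A` is the unit of the algebra and is homogeneous of type `dim K`. Compared with it in both
-- directions, every other homogeneous summand has the same type.
include C in
theorem pukanszkyInvariant_eq [CompleteSpace K] [Nontrivial K] (hAM : A ≤ M) (hA : IsAbelian A)
    (hd : HasNoMinimalProjection A) :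
    pukanszkyInvariant τ A = {Cardinal.toENat (Module.rank ℂ K)} := by
  obtain ⟨b, β, hβ⟩ := exists_hilbertBasis ℂ K
  have hb : Orthonormal ℂ ((↑) : b → K) := hβ ▸ β.orthonormal
  have hcard : (C.basisProjections b).encard = Cardinal.toENat (Module.rank ℂ K) := by
    rw [toENat_rank β, basisProjections, ← Set.image_univ, (C.injective_matUnit hb).encard_image,
      Set.encard_univ, ENat.card_coe_set_eq]
  have hom := C.isHomogeneous_basisProjections hAM hA hd β hβ
  have hmul : ∀ x ∈ pukanszkyAlgebra τ A, ∀ y ∈ pukanszkyAlgebra τ A,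
      x * y ∈ pukanszkyAlgebra τ A := fun x hx y hy => mul_mem_pukanszkyAlgebra hx hy
  have hstar : ∀ x ∈ pukanszkyAlgebra τ A, star x ∈ pukanszkyAlgebra τ A :=
    fun x hx => star_mem_pukanszkyAlgebra hx
  have hc : ∀ x ∈ pukanszkyAlgebra τ A, (1 - τ.eA A) * x = x * (1 - τ.eA A) :=
    fun x hx => by rw [one_sub_eA_mul hx, mul_one_sub_eA hx]
  ext n
  rw [Set.mem_singleton_iff]
  constructor
  · rintro ⟨z, hzP, hz, hzc, hz0, E, hE, h1, h2, h3, h4⟩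
    have hom' : IsHomogeneous (pukanszkyAlgebra τ A) E z := ⟨h1, h2, h3, h4⟩
    rw [← hE, ← hcard]
    refine le_antisymm ?_ ?_
    · exact hom.encard_le hmul hstar one_sub_eA_mem isStarProjection_one_sub_eA hc hom'
        (by rwa [one_sub_eA_mul hzP])
    · exact hom'.encard_le hmul hstar hzP hz hzc hom (by rwa [mul_one_sub_eA hzP])
  · rintro rfl
    refine ⟨1 - τ.eA A, one_sub_eA_mem, isStarProjection_one_sub_eA, hc, fun h0 => ?_,
      C.basisProjections b, hcard, hom.abelian, hom.equiv, hom.orth, hom.hasSum⟩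
    obtain ⟨k, hk⟩ := exists_norm_eq K zero_le_one
    refine C.matUnit_ne_zero hk ?_
    rw [← one_sub_eA_mul (C.matUnit_mem hAM hA hd hk hk), h0, zero_mul]

end CoarseDecomposition

end Pukanszky

/-! ### `L²(M)` inside `ℓ²(ℕ, H)`, and strong approximation by `B`. -/

section Density

variable {H : Type u} [NormedAddCommGroup H] [InnerProductSpace ℂ H] [CompleteSpace H]

/-- The diagonal action of an operator on `ℓ²(ℕ, H)`. -/
def amplify (x : H →L[ℂ] H) : lp (fun _ : ℕ => H) 2 →L[ℂ] lp (fun _ : ℕ => H) 2 :=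
  lp.mapCLM 2 (fun _ => x) (norm_nonneg x) (fun _ => le_rfl)

omit [CompleteSpace H] in
theorem amplify_apply (x : H →L[ℂ] H) (ξ : lp (fun _ : ℕ => H) 2) (n : ℕ) :
    amplify x ξ n = x (ξ n) := rfl

theorem star_amplify (x : H →L[ℂ] H) : star (amplify x) = amplify (star x) := by
  refine ((ContinuousLinearMap.eq_adjoint_iff _ _).2 fun ξ η => ?_).symm
  rw [lp.inner_eq_tsum, lp.inner_eq_tsum]
  refine tsum_congr fun n => ?_
  rw [amplify_apply, amplify_apply]
  exact ContinuousLinearMap.adjoint_inner_left _ _ _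

variable {M : VonNeumannAlgebra H} (τ : Trace M)

/-- A vector of `ℓ²(ℕ, H)` whose vector state dominates the trace. -/
theorem Trace.exists_dominating : ∃ ζ : lp (fun _ : ℕ => H) 2, ∀ x : M,
    ‖τ.vec x‖ ≤ ‖amplify (x : H →L[ℂ] H) ζ‖ := by
  obtain ⟨ξ, η, h⟩ := τ.normal
  -- The identity `Re ⟨u, v⟩ = ‖(u + v)/2‖² - ‖(u - v)/2‖²`, with the second term dropped.
  refine ⟨(2⁻¹ : ℂ) • (ξ + η), fun x => ?_⟩
  have h1 : τ.toFunctional (star x * x) =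
      ⟪amplify (x : H →L[ℂ] H) ξ, amplify (x : H →L[ℂ] H) η⟫_ℂ := by
    rw [h, lp.inner_eq_tsum]
    exact tsum_congr fun n => inner_star_mul x x (ξ n) (η n)
  rw [← sq_le_sq₀ (norm_nonneg _) (norm_nonneg _), τ.norm_vec_sq, h1, map_smul, map_add, norm_smul,
    mul_pow, norm_add_sq (𝕜 := ℂ)]
  have h2 := norm_sub_sq (𝕜 := ℂ) (amplify (x : H →L[ℂ] H) ξ) (amplify (x : H →L[ℂ] H) η)
  have h3 := sq_nonneg ‖amplify (x : H →L[ℂ] H) ξ - amplify (x : H →L[ℂ] H) η‖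
  have h4 : ‖(2⁻¹ : ℂ)‖ = 2⁻¹ := by simp
  rw [h4]
  simp only [RCLike.re_to_complex] at *
  nlinarith

theorem commute_of_intertwines {E F : Type*} [NormedAddCommGroup E] [InnerProductSpace ℂ E]
    [CompleteSpace E] [NormedAddCommGroup F] [InnerProductSpace ℂ F] [CompleteSpace F]
    {W : E →L[ℂ] F} {a : E →L[ℂ] E} {b : F →L[ℂ] F} (h : W ∘L a = b ∘L W)
    (h' : W ∘L star a = star b ∘L W) :
    Commute (ContinuousLinearMap.adjoint W ∘L W : E →L[ℂ] E) a := by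
  have h2 := congrArg ContinuousLinearMap.adjoint h'
  rw [ContinuousLinearMap.adjoint_comp, ContinuousLinearMap.adjoint_comp,
    ContinuousLinearMap.star_eq_adjoint, ContinuousLinearMap.star_eq_adjoint,
    ContinuousLinearMap.adjoint_adjoint, ContinuousLinearMap.adjoint_adjoint] at h2
  change ContinuousLinearMap.adjoint W ∘L W ∘L a = (a ∘L ContinuousLinearMap.adjoint W) ∘L W
  rw [h, h2]
  rfl

/-- If `e x ↦ f x` is contractive, then it is implemented, up to a partial isometry, by an operator
that commutes with all intertwiners. -/
theorem exists_operator_of_norm_le {E F X : Type*} [NormedAddCommGroup E] [InnerProductSpace ℂ E]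
    [CompleteSpace E] [NormedAddCommGroup F] [InnerProductSpace ℂ F] [CompleteSpace F]
    [AddCommGroup X] [Module ℂ X] (e₀ : X →ₗ[ℂ] E) (f : X →ₗ[ℂ] F) (hf : ∀ x, ‖f x‖ ≤ ‖e₀ x‖) :
    ∃ S : E →L[ℂ] E, (∀ x, ‖S (e₀ x)‖ = ‖f x‖) ∧
      ∀ (a : E →L[ℂ] E) (b : F →L[ℂ] F) (c c' : X → X), (∀ x, a (e₀ x) = e₀ (c x)) →
        (∀ x, star a (e₀ x) = e₀ (c' x)) → (∀ x, b (f x) = f (c x)) →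
        (∀ x, star b (f x) = f (c' x)) → Commute S a := by
  set R : Submodule ℂ E := (LinearMap.range e₀).topologicalClosure with hR
  have hRc : IsClosed (R : Set E) := Submodule.isClosed_topologicalClosure _
  have : CompleteSpace R := hRc.completeSpace_coe
  have heR : ∀ x, e₀ x ∈ R := fun x => Submodule.le_topologicalClosure _ ⟨x, rfl⟩
  let e : X →ₗ[ℂ] R := e₀.codRestrict R heR
  have hdense : DenseRange e := by
    intro r
    have hr : (r : E) ∈ closure (Set.range e₀) := r.2
    rw [mem_closure_iff_seq_limit] at hr ⊢
    obtain ⟨s, hs, hl⟩ := hr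
    choose x hx using hs
    refine ⟨fun n => e (x n), fun n => ⟨x n, rfl⟩, tendsto_subtype_rng.2 ?_⟩
    exact hl.congr fun n => (hx n).symm
  -- `W` sends `e₀ x` to `f x` and vanishes off the closed range of `e₀`. The operator sought is the
  -- square root of `W⋆ W`, which has the same norms as `W` on vectors and commutes with whatever
  -- `W⋆ W` commutes with.
  let W : E →L[ℂ] F := f.extendOfNorm e ∘L R.orthogonalProjectionOnto
  have hWe : ∀ x, W (e₀ x) = f x := fun x => by
    change f.extendOfNorm e (R.orthogonalProjectionOnto ((e x : R) : E)) = _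
    rw [Submodule.orthogonalProjectionOnto_mem_subspace_eq_self,
      LinearMap.extendOfNorm_eq hdense ⟨1, fun y => ?_⟩]
    rw [one_mul]; exact hf y
  have hWP : ∀ α, W (R.starProjection α) = W α := fun α => by
    change f.extendOfNorm e (R.orthogonalProjectionOnto
      ((R.orthogonalProjectionOnto α : R) : E)) = _
    rw [Submodule.orthogonalProjectionOnto_mem_subspace_eq_self]
    rfl
  have hRa : ∀ (a : E →L[ℂ] E) (c : X → X), (∀ x, a (e₀ x) = e₀ (c x)) → ∀ α ∈ R, a α ∈ R :=
    fun a c hac α hα => by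
      refine map_mem_closure a.continuous hα ?_
      rintro _ ⟨x, rfl⟩
      exact ⟨c x, (hac x).symm⟩
  have hW : ∀ (a : E →L[ℂ] E) (b : F →L[ℂ] F) (c c' : X → X), (∀ x, a (e₀ x) = e₀ (c x)) →
      (∀ x, star a (e₀ x) = e₀ (c' x)) → (∀ x, b (f x) = f (c x)) → W ∘L a = b ∘L W := by
    intro a b c c' ha ha' hb
    ext α
    have h1 : ∀ β ∈ R, W (a β) = b (W β) := by
      intro β hβ
      refine closure_minimal (s := Set.range e₀) (t := {β | W (a β) = b (W β)}) ?_
        (isClosed_eq (by fun_prop) (by fun_prop)) hβ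
      rintro _ ⟨x, rfl⟩
      change W (a (e₀ x)) = b (W (e₀ x))
      rw [ha, hWe, hWe, hb]
    have h2 : R.starProjection (a α) = a (R.starProjection α) :=
      DFunLike.congr_fun (starProjection_comm (hRa a c ha) (hRa _ c' ha')) α
    change W (a α) = b (W α)
    rw [← hWP, h2, h1 _ (Submodule.starProjection_apply_mem _ _), hWP]
  set G : E →L[ℂ] E := ContinuousLinearMap.adjoint W ∘L W with hG
  have hG0 : 0 ≤ G := (ContinuousLinearMap.nonneg_iff_isPositive _).2
    (ContinuousLinearMap.isPositive_adjoint_comp_self W)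
  refine ⟨CFC.sqrt G, fun x => ?_, fun a b c c' ha ha' hb hb' => ?_⟩
  · have hs : IsSelfAdjoint (CFC.sqrt G) := IsSelfAdjoint.of_nonneg (CFC.sqrt_nonneg _)
    have h3 : CFC.sqrt G (CFC.sqrt G (e₀ x)) = G (e₀ x) :=
      DFunLike.congr_fun (CFC.sqrt_mul_sqrt_self G hG0) _
    have h4 : ⟪CFC.sqrt G (e₀ x), CFC.sqrt G (e₀ x)⟫_ℂ = ⟪W (e₀ x), W (e₀ x)⟫_ℂ := by
      rw [← ContinuousLinearMap.adjoint_inner_right W]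
      exact (hs.isSymmetric _ _).trans (by rw [ContinuousLinearMap.coe_coe, h3]; rfl)
    rw [← hWe, ← sq_eq_sq₀ (norm_nonneg _) (norm_nonneg _), ← inner_self_eq_norm_sq (𝕜 := ℂ),
      ← inner_self_eq_norm_sq (𝕜 := ℂ), h4]
  · exact Commute.cfcₙ_nnreal (commute_of_intertwines (hW a b c c' ha ha' hb)
      (hW _ _ c' c ha' (by rwa [star_star]) hb')) _

/-- The trace is a vector state on `ℓ²(ℕ, H)`. -/
theorem Trace.exists_norm_vec_eq : ∃ θ : lp (fun _ : ℕ => H) 2, ∀ x : M,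
    ‖amplify (x : H →L[ℂ] H) θ‖ = ‖τ.vec x‖ := by
  obtain ⟨ζ, hζ⟩ := τ.exists_dominating
  let e₀ : M →ₗ[ℂ] lp (fun _ : ℕ => H) 2 :=
    { toFun := fun x => amplify (x : H →L[ℂ] H) ζ
      map_add' := fun x y => lp.ext (funext fun n => rfl)
      map_smul' := fun c x => lp.ext (funext fun n => rfl) }
  obtain ⟨S, hS, hcomm⟩ := exists_operator_of_norm_le e₀ τ.vecₗ hζ
  -- `S` commutes with the amplifications of `M`, so `x (S ζ) = S (x ζ)` has the norm of `τ.vec x`.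
  refine ⟨S ζ, fun x => ?_⟩
  have h := hcomm (amplify (x : H →L[ℂ] H)) (τ.left x) (fun y => x * y) (fun y => star x * y)
    (fun y => rfl) (fun y => by rw [star_amplify]; rfl) (fun y => τ.left_vec x y)
    (fun y => by rw [τ.left_star]; exact τ.left_vec _ y)
  have h1 : amplify (x : H →L[ℂ] H) (S ζ) = S (e₀ x) := (DFunLike.congr_fun h ζ).symm
  rw [h1, hS]; rfl

/-- `L²(M)` embeds as a left `M`-module in `ℓ²(ℕ, H)`. -/
theorem Trace.exists_isometry : ∃ V : τ.L2 →ₗᵢ[ℂ] lp (fun _ : ℕ => H) 2, ∀ (y : M) (α : τ.L2),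
    V (τ.left y α) = amplify (y : H →L[ℂ] H) (V α) := by
  obtain ⟨θ, hθ⟩ := τ.exists_norm_vec_eq
  let f : M →ₗ[ℂ] lp (fun _ : ℕ => H) 2 :=
    { toFun := fun x => amplify (x : H →L[ℂ] H) θ
      map_add' := fun x y => lp.ext (funext fun n => rfl)
      map_smul' := fun c x => lp.ext (funext fun n => rfl) }
  set V₀ := f.extendOfNorm τ.vecₗ with hV₀
  have hV : ∀ x, V₀ (τ.vec x) = amplify (x : H →L[ℂ] H) θ := fun x =>
    LinearMap.extendOfNorm_eq (f := f) (e := τ.vecₗ) τ.denseRange_vec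
      ⟨1, fun y => by rw [one_mul]; exact (hθ y).le⟩ x
  refine ⟨⟨V₀.toLinearMap, fun α => ?_⟩, fun y α => ?_⟩
  · refine τ.denseRange_vec.induction_on (p := fun α => ‖V₀ α‖ = ‖α‖) α
      (isClosed_eq (by fun_prop) (by fun_prop)) fun x => ?_
    rw [hV, hθ]
  · refine τ.denseRange_vec.induction_on
      (p := fun α => V₀ (τ.left y α) = amplify (y : H →L[ℂ] H) (V₀ α)) α
      (isClosed_eq (by fun_prop) (by fun_prop)) fun x => ?_
    rw [τ.left_vec, hV, hV]
    rfl

/-- Strong approximation, in `L²(M)`, of the self-adjoint elements of `M` by those of an ultraweakly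
dense subalgebra. -/
theorem Trace.exists_approx {B : NonUnitalStarSubalgebra ℂ (H →L[ℂ] H)} (hB : IsDenseSeparable M B)
    {x : M} (hx : IsSelfAdjoint x) {N : ℕ} (η : Fin N → τ.L2) {ε : ℝ} (hε : 0 < ε) :
    ∃ b : M, (b : H →L[ℂ] H) ∈ B ∧ IsSelfAdjoint b ∧ ∀ j, ‖τ.left b (η j) - τ.left x (η j)‖ < ε := by
  obtain ⟨V, hV⟩ := τ.exists_isometry
  let Φ : M → Fin N → τ.L2 := fun b j => τ.left b (η j)
  let S : Set (Fin N → τ.L2) := {v | ∃ b : M, (b : H →L[ℂ] H) ∈ B ∧ IsSelfAdjoint b ∧ Φ b = v}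
  have hSsmul : ∀ (c : ℝ) (b : M), IsSelfAdjoint b → IsSelfAdjoint ((c : ℂ) • b) := fun c b hb => by
    rw [isSelfAdjoint_iff, star_smul, hb.star_eq, Complex.star_def, Complex.conj_ofReal]
  have hΦs : ∀ (c : ℝ) (b : M), c • Φ b = Φ ((c : ℂ) • b) := fun c b => by
    ext1 j
    change (c : ℂ) • τ.left b (η j) = τ.left ((c : ℂ) • b) (η j)
    rw [map_smul]; rfl
  have hΦa : ∀ b c : M, Φ b + Φ c = Φ (b + c) := fun b c => by
    ext1 j
    change τ.left b (η j) + τ.left c (η j) = τ.left (b + c) (η j)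
    rw [map_add]; rfl
  have hconv : Convex ℝ S := by
    rintro _ ⟨b, hb, hbs, rfl⟩ _ ⟨c, hc, hcs, rfl⟩ s t hs ht hst
    refine ⟨(s : ℂ) • b + (t : ℂ) • c, add_mem (SMulMemClass.smul_mem _ hb)
      (SMulMemClass.smul_mem _ hc), (hSsmul _ _ hbs).add (hSsmul _ _ hcs), ?_⟩
    rw [hΦs, hΦs, hΦa]
  by_cases hmem : Φ x ∈ closure S
  · obtain ⟨_, ⟨b, hb, hbs, rfl⟩, hd⟩ := Metric.mem_closure_iff.1 hmem ε hε
    refine ⟨b, hb, hbs, fun j => ?_⟩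
    rw [← dist_eq_norm, dist_comm]
    exact (dist_le_pi_dist (Φ x) (Φ b) j).trans_lt hd
  · exfalso
    obtain ⟨f, u, hf1, hf2⟩ := RCLike.geometric_hahn_banach_closed_point (𝕜 := ℂ) hconv.closure
      isClosed_closure hmem
    -- `S` is stable under real scalars, so a functional bounded above on it has vanishing real part
    -- there.
    have hf0 : ∀ v ∈ S, (f v).re = 0 := by
      rintro _ ⟨b, hb, hbs, rfl⟩
      by_contra hne
      have h1 := hf1 _ (subset_closure ⟨(((u / (f (Φ b)).re : ℝ) : ℂ) • b),
        SMulMemClass.smul_mem _ hb, hSsmul _ _ hbs, (hΦs _ _).symm⟩)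
      rw [show (u / (f (Φ b)).re) • Φ b = ((u / (f (Φ b)).re : ℝ) : ℂ) • Φ b from rfl, map_smul,
        smul_eq_mul, RCLike.re_to_complex, Complex.re_ofReal_mul, div_mul_cancel₀ _ hne] at h1
      exact lt_irrefl _ h1
    have hu : 0 < u := by
      have := hf1 _ (subset_closure ⟨0, zero_mem B, IsSelfAdjoint.zero M, rfl⟩)
      rw [RCLike.re_to_complex, hf0 _ ⟨0, zero_mem B, IsSelfAdjoint.zero M, rfl⟩] at this
      exact this
    let γ : Fin N → τ.L2 := fun j =>
      (InnerProductSpace.toDual ℂ τ.L2).symm (f ∘L ContinuousLinearMap.single ℂ (fun _ => τ.L2) j)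
    have hfγ : ∀ v, f v = ∑ j, ⟪γ j, v j⟫_ℂ := fun v => by
      have h1 : v = ∑ j, Pi.single j (v j) := (Finset.univ_sum_single v).symm
      conv_lhs => rw [h1, map_sum]
      refine Finset.sum_congr rfl fun j _ => ?_
      rw [InnerProductSpace.toDual_symm_apply]
      rfl
    -- The embedding `V` makes the separating functional ultraweakly continuous. Symmetrizing makes
    -- its real part vanish on all of `B`, not just on self-adjoint elements, while at the
    -- self-adjoint `x` it is twice the real part of `f (Φ x)`.
    let ω : (H →L[ℂ] H) → ℂ := fun y => ∑ j, (∑' n, ⟪V (γ j) n, y (V (η j) n)⟫_ℂ +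
      ∑' n, ⟪V (η j) n, y (V (γ j) n)⟫_ℂ)
    have hω : @Continuous _ _ (ultraweakTopology H) _ ω := by
      let _ : TopologicalSpace (H →L[ℂ] H) := ultraweakTopology H
      have h1 : ∀ p : lp (fun _ : ℕ => H) 2 × lp (fun _ : ℕ => H) 2,
          Continuous fun y : H →L[ℂ] H => ∑' n, ⟪p.1 n, y (p.2 n)⟫_ℂ := fun p =>
        continuous_iInf_dom (i := p) continuous_induced_dom
      exact continuous_finsetSum _ fun j _ => (h1 (V (γ j), V (η j))).add (h1 (V (η j), V (γ j)))
    have hωM : ∀ y : M, ω y = f (Φ y) + star (f (Φ (star y))) := fun y => by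
      have h1 : ∀ (α β : τ.L2), ∑' n, ⟪V α n, (y : H →L[ℂ] H) (V β n)⟫_ℂ = ⟪α, τ.left y β⟫_ℂ :=
        fun α β => by
          rw [← V.inner_map_map, hV, lp.inner_eq_tsum]
          rfl
      simp only [ω, h1]
      rw [hfγ, hfγ, star_sum, Finset.sum_add_distrib]
      congr 1
      refine Finset.sum_congr rfl fun j _ => ?_
      rw [τ.inner_left, ← inner_conj_symm]
      rfl
    have hclosed : IsClosed[ultraweakTopology H] {y : H →L[ℂ] H | (ω y).re = 0} := by
      let _ : TopologicalSpace (H →L[ℂ] H) := ultraweakTopology H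
      exact isClosed_eq (Complex.continuous_re.comp hω) continuous_const
    have hBz : (B : Set (H →L[ℂ] H)) ⊆ {y : H →L[ℂ] H | (ω y).re = 0} := by
      intro y hy
      set y' : M := ⟨y, hB.le y hy⟩ with hy'
      have h1 := hf0 _ ⟨y' + star y', add_mem hy (star_mem hy), IsSelfAdjoint.add_star_self y', rfl⟩
      rw [← hΦa, map_add, Complex.add_re] at h1
      change (ω y').re = 0
      rw [hωM, Complex.add_re, Complex.star_def, Complex.conj_re, h1]
    have h1 := (@closure_minimal _ (ultraweakTopology H) _ _ hBz hclosed) (hB.dense x.2)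
    change (ω x).re = 0 at h1
    rw [hωM, hx.star_eq, Complex.add_re, Complex.star_def, Complex.conj_re] at h1
    rw [RCLike.re_to_complex] at hf2
    linarith

end Density

/-! ### Sections of direct integrals. -/

section DirectIntegralBasics

variable {Y : Type} [MeasurableSpace Y] {F : Y → Type}
  [∀ t, NormedAddCommGroup (F t)] [∀ t, InnerProductSpace ℂ (F t)]

namespace MeasurableField

variable (S : MeasurableField Y F)

/-- Only norms of sections are assumed measurable; polarization gives inner products. -/
theorem measurable_inner {ξ η : ∀ t, F t} (hξ : ξ ∈ S.sections) (hη : η ∈ S.sections) :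
    Measurable fun t => ⟪ξ t, η t⟫_ℂ := by
  have h : ∀ c : ℂ, Measurable fun t => ‖ξ t + c • η t‖ := fun c =>
    S.measurable_norm _ (S.sections.add_mem hξ (S.sections.smul_mem c hη))
  have h1 := h 1
  have h2 := h (-1)
  have h3 := h Complex.I
  have h4 := h (-Complex.I)
  simp only [one_smul, neg_smul, ← sub_eq_add_neg] at h1 h2 h3 h4
  simp_rw [inner_eq_sum_norm_sq_div_four (𝕜 := ℂ)]
  simp only [Complex.coe_algebraMap, RCLike.I_to_complex]
  fun_prop

/-- Measurable sections form a module over the measurable functions. -/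
theorem smul_mem {f : Y → ℂ} (hf : Measurable f) {ξ : ∀ t, F t} (hξ : ξ ∈ S.sections) :
    (fun t => f t • ξ t) ∈ S.sections := by
  refine S.mem_of_measurable_inner _ fun η hη => ?_
  simp_rw [inner_smul_right]
  exact hf.mul (S.measurable_inner hη hξ)

/-- A multiple of a measurable section by a positive function is square-integrable. -/
theorem normalize_mem {ν : Measure Y} [IsFiniteMeasure ν] {ξ : ∀ t, F t} (hξ : ξ ∈ S.sections) :
    (fun t => (((1 + ‖ξ t‖)⁻¹ : ℝ) : ℂ) • ξ t) ∈ S.squareIntegrable ν := by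
  have hm : (fun t => (((1 + ‖ξ t‖)⁻¹ : ℝ) : ℂ) • ξ t) ∈ S.sections := by
    refine S.smul_mem (f := fun t => (((1 + ‖ξ t‖)⁻¹ : ℝ) : ℂ)) ?_ hξ
    have := S.measurable_norm ξ hξ
    fun_prop
  refine ⟨hm, Integrable.of_bound (C := 1)
    ((S.measurable_norm _ hm).pow_const 2).aestronglyMeasurable (Eventually.of_forall fun t => ?_)⟩
  have h1 : 0 < 1 + ‖ξ t‖ := by positivity
  have h2 : ‖(((1 + ‖ξ t‖)⁻¹ : ℝ) : ℂ) • ξ t‖ ≤ 1 := by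
    rw [norm_smul, Complex.norm_real, Real.norm_of_nonneg (by positivity), inv_mul_le_iff₀ h1]
    linarith
  rw [Real.norm_of_nonneg (by positivity)]
  exact pow_le_one₀ (norm_nonneg _) h2

theorem bounded_smul_mem {ν : Measure Y} {f : Y → ℂ} (hf : Measurable f) {C : ℝ}
    (hC : ∀ᵐ t ∂ν, ‖f t‖ ≤ C) {ξ : ∀ t, F t} (hξ : ξ ∈ S.squareIntegrable ν) :
    (fun t => f t • ξ t) ∈ S.squareIntegrable ν := by
  refine ⟨S.smul_mem hf hξ.1, (hξ.2.const_mul (C ^ 2)).mono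
    ((S.measurable_norm _ (S.smul_mem hf hξ.1)).pow_const 2).aestronglyMeasurable ?_⟩
  filter_upwards [hC] with t ht
  rw [norm_smul, mul_pow, Real.norm_of_nonneg (by positivity), Real.norm_of_nonneg (by positivity)]
  gcongr

theorem bounded_map_mem {ν : Measure Y} {T : ∀ t, F t →L[ℂ] F t} {C : ℝ} (hC : ∀ t, ‖T t‖ ≤ C)
    {ξ : ∀ t, F t} (hξ : ξ ∈ S.squareIntegrable ν) (hT : (fun t => T t (ξ t)) ∈ S.sections) :
    (fun t => T t (ξ t)) ∈ S.squareIntegrable ν := by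
  refine ⟨hT, (hξ.2.const_mul (C ^ 2)).mono
    ((S.measurable_norm _ hT).pow_const 2).aestronglyMeasurable (Eventually.of_forall fun t => ?_)⟩
  have h := (T t).le_of_opNorm_le (hC t) (ξ t)
  rw [Real.norm_of_nonneg (by positivity), Real.norm_of_nonneg (by positivity), ← mul_pow]
  gcongr

end MeasurableField

namespace DirectIntegralIso

variable {S : MeasurableField Y F} {ν : Measure Y} {L : Type u} [NormedAddCommGroup L]
  [InnerProductSpace ℂ L] (D : DirectIntegralIso S ν L)

theorem norm_toMap_sq (ξ : S.squareIntegrable ν) :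
    ‖D.toMap ξ‖ ^ 2 = ∫ t, ‖(ξ : ∀ t, F t) t‖ ^ 2 ∂ν := by
  have h := D.inner_map ξ ξ
  simp_rw [inner_self_eq_norm_sq_to_K, Complex.coe_algebraMap, ← Complex.ofReal_pow] at h
  rw [integral_complex_ofReal] at h
  exact_mod_cast h

theorem ae_eq_zero {ξ : S.squareIntegrable ν} (h : D.toMap ξ = 0) :
    ∀ᵐ t ∂ν, (ξ : ∀ t, F t) t = 0 := by
  have h1 := D.norm_toMap_sq ξ
  rw [h, norm_zero, zero_pow two_ne_zero, eq_comm,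
    integral_eq_zero_iff_of_nonneg (fun t => by positivity) ξ.2.2] at h1
  filter_upwards [h1] with t ht
  simpa using ht

/-- A square-integrable section representing a vector. -/
def sec (α : L) : ∀ t, F t := (Function.surjInv D.surjective α : S.squareIntegrable ν)

theorem sec_mem (α : L) : D.sec α ∈ S.squareIntegrable ν :=
  (Function.surjInv D.surjective α : S.squareIntegrable ν).2

theorem toMap_sec (α : L) : D.toMap ⟨D.sec α, D.sec_mem α⟩ = α := Function.surjInv_eq D.surjective α

theorem sec_ae_eq {α : L} {ξ : ∀ t, F t} (hξ : ξ ∈ S.squareIntegrable ν)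
    (h : D.toMap ⟨ξ, hξ⟩ = α) : ∀ᵐ t ∂ν, D.sec α t = ξ t := by
  have h1 := D.ae_eq_zero (ξ := ⟨D.sec α, D.sec_mem α⟩ - ⟨ξ, hξ⟩) (by
    rw [map_sub, D.toMap_sec, h, sub_self])
  filter_upwards [h1] with t ht
  exact sub_eq_zero.1 ht

/-- `sec` chooses representatives, so it is additive only off a null set that depends on the
vectors. -/
theorem sec_add (α β : L) : ∀ᵐ t ∂ν, D.sec (α + β) t = D.sec α t + D.sec β t :=
  D.sec_ae_eq (ξ := D.sec α + D.sec β) (Submodule.add_mem _ (D.sec_mem α) (D.sec_mem β)) (by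
    have := map_add D.toMap ⟨D.sec α, D.sec_mem α⟩ ⟨D.sec β, D.sec_mem β⟩
    rw [D.toMap_sec, D.toMap_sec] at this
    exact this)

theorem sec_smul (c : ℂ) (α : L) : ∀ᵐ t ∂ν, D.sec (c • α) t = c • D.sec α t :=
  D.sec_ae_eq (ξ := c • D.sec α) (Submodule.smul_mem _ c (D.sec_mem α)) (by
    have := map_smul D.toMap c ⟨D.sec α, D.sec_mem α⟩
    rw [D.toMap_sec] at this
    exact this)

theorem sec_zero : ∀ᵐ t ∂ν, D.sec (0 : L) t = 0 := D.ae_eq_zero (D.toMap_sec 0)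

theorem sec_sum {ι : Type*} (s : Finset ι) (α : ι → L) :
    ∀ᵐ t ∂ν, D.sec (∑ i ∈ s, α i) t = ∑ i ∈ s, D.sec (α i) t := by
  classical
  induction s using Finset.induction_on with
  | empty => simpa using D.sec_zero
  | insert i s hi ih =>
    rw [Finset.sum_insert hi]
    filter_upwards [ih, D.sec_add (α i) (∑ i ∈ s, α i)] with t h1 h2
    rw [h2, h1, Finset.sum_insert hi]

theorem norm_sq_eq (α : L) : ‖α‖ ^ 2 = ∫ t, ‖D.sec α t‖ ^ 2 ∂ν := by
  conv_lhs => rw [← D.toMap_sec α]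
  exact D.norm_toMap_sq _

theorem integrable_sec (α : L) : Integrable (fun t => ‖D.sec α t‖ ^ 2) ν := (D.sec_mem α).2

/-- Fast convergence of vectors implies almost sure convergence of the sections. -/
theorem tendsto_sec {α : ℕ → L} {β : L} (h : ∀ᶠ n in atTop, ‖α n - β‖ ≤ (1 / 2) ^ n) :
    ∀ᵐ t ∂ν, Tendsto (fun n => D.sec (α n) t) atTop (𝓝 (D.sec β t)) := by
  obtain ⟨N, hN⟩ := eventually_atTop.1 h
  have hmeas : ∀ n, AEMeasurable (fun t => ENNReal.ofReal (‖D.sec (α (n + N) - β) t‖ ^ 2)) ν :=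
    fun n => ((S.measurable_norm _ (D.sec_mem _).1).pow_const 2).ennreal_ofReal.aemeasurable
  have hle : ∀ n, ∫⁻ t, ENNReal.ofReal (‖D.sec (α (n + N) - β) t‖ ^ 2) ∂ν ≤
      ENNReal.ofReal ((1 / 4) ^ n) := by
    intro n
    rw [← ofReal_integral_eq_lintegral_ofReal (D.integrable_sec _)
      (Eventually.of_forall fun t => by positivity), ← D.norm_sq_eq]
    refine ENNReal.ofReal_le_ofReal ?_
    calc ‖α (n + N) - β‖ ^ 2 ≤ ((1 / 2 : ℝ) ^ n) ^ 2 := by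
          gcongr
          refine (hN _ (Nat.le_add_left N n)).trans ?_
          exact pow_le_pow_of_le_one (by norm_num) (by norm_num) (Nat.le_add_right n N)
      _ = (1 / 4) ^ n := by rw [← pow_mul, mul_comm, pow_mul]; norm_num
  -- The integrals are bounded by a geometric series, so almost everywhere the sum of squared fibre
  -- norms is finite and its terms tend to `0`.
  have hsum : ∫⁻ t, ∑' n, ENNReal.ofReal (‖D.sec (α (n + N) - β) t‖ ^ 2) ∂ν ≠ ∞ := by
    rw [lintegral_tsum hmeas]
    refine ne_top_of_le_ne_top ?_ (ENNReal.tsum_le_tsum hle)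
    rw [← ENNReal.ofReal_tsum_of_nonneg (fun n => by positivity)
      (summable_geometric_of_lt_one (by norm_num) (by norm_num))]
    exact ENNReal.ofReal_ne_top
  have hdiff : ∀ᵐ t ∂ν, ∀ n, D.sec (α n) t = D.sec (α n - β) t + D.sec β t := by
    rw [ae_all_iff]
    intro n
    have := D.sec_add (α n - β) β
    rwa [sub_add_cancel] at this
  filter_upwards [ae_lt_top' (AEMeasurable.tsum hmeas) hsum, hdiff] with t ht hd
  have h1 : Tendsto (fun n => ENNReal.ofReal (‖D.sec (α (n + N) - β) t‖ ^ 2)) atTop (𝓝 0) :=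
    ENNReal.tendsto_atTop_zero_of_tsum_ne_top ht.ne
  have h2 : Tendsto (fun n => ‖D.sec (α (n + N) - β) t‖ ^ 2) atTop (𝓝 0) := by
    have := (ENNReal.tendsto_toReal ENNReal.zero_ne_top).comp h1
    refine this.congr fun n => ?_
    exact ENNReal.toReal_ofReal (by positivity)
  have h3 : Tendsto (fun n => ‖D.sec (α (n + N) - β) t‖) atTop (𝓝 0) := by
    have := h2.sqrt
    simpa [Real.sqrt_sq] using this
  have h4 : Tendsto (fun n => D.sec (α (n + N) - β) t) atTop (𝓝 0) :=
    tendsto_zero_iff_norm_tendsto_zero.2 h3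
  refine (tendsto_add_atTop_iff_nat N).1 ?_
  have h5 := h4.add_const (D.sec β t)
  rw [zero_add] at h5
  exact h5.congr fun n => (hd _).symm

/-- The vectors represented by the sections of a field of closed subspaces. -/
def fieldSubmodule (Q : ∀ t, Submodule ℂ (F t)) : Submodule ℂ L where
  carrier := {α | ∀ᵐ t ∂ν, D.sec α t ∈ Q t}
  zero_mem' := by
    filter_upwards [D.sec_zero] with t ht
    rw [ht]; exact (Q t).zero_mem
  add_mem' := by
    intro α β hα hβ
    filter_upwards [hα, hβ, D.sec_add α β] with t h1 h2 h3
    rw [h3]; exact (Q t).add_mem h1 h2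
  smul_mem' := by
    intro c α hα
    filter_upwards [hα, D.sec_smul c α] with t h1 h2
    rw [h2]; exact (Q t).smul_mem c h1

theorem isClosed_fieldSubmodule {Q : ∀ t, Submodule ℂ (F t)}
    (hQ : ∀ t, IsClosed (Q t : Set (F t))) : IsClosed (D.fieldSubmodule Q : Set L) := by
  refine isClosed_of_closure_subset fun β hβ => ?_
  have h1 : ∀ n : ℕ, ∃ α ∈ D.fieldSubmodule Q, ‖α - β‖ ≤ (1 / 2) ^ n := fun n => by
    obtain ⟨α, hα, hd⟩ := Metric.mem_closure_iff.1 hβ ((1 / 2) ^ n) (by positivity)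
    exact ⟨α, hα, by rw [← dist_eq_norm, dist_comm]; exact hd.le⟩
  choose α hα hd using h1
  have h2 : ∀ᵐ t ∂ν, ∀ n, D.sec (α n) t ∈ Q t := ae_all_iff.2 hα
  change ∀ᵐ t ∂ν, D.sec β t ∈ Q t
  filter_upwards [h2, D.tendsto_sec (Eventually.of_forall hd)] with t h3 h4
  exact (hQ t).mem_of_tendsto h4 (Eventually.of_forall h3)

/-- If all vectors are represented by sections of a field of closed subspaces, then almost all the
subspaces are everything. -/
theorem eq_top_of_fieldSubmodule [IsFiniteMeasure ν] {Q : ∀ t, Submodule ℂ (F t)}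
    (hQ : ∀ t, IsClosed (Q t : Set (F t))) (h : ∀ α, α ∈ D.fieldSubmodule Q) :
    ∀ᵐ t ∂ν, Q t = ⊤ := by
  obtain ⟨ξ, hξ, htot⟩ := S.exists_fundamental
  have h1 : ∀ᵐ t ∂ν, ∀ n, ξ n t ∈ Q t := by
    rw [ae_all_iff]
    intro n
    -- Fundamental sections need not be square-integrable. Dividing by `1 + ‖ξ n t‖` repairs this
    -- and does not affect membership in a subspace.
    have hm := S.normalize_mem (ν := ν) (hξ n)
    filter_upwards [h (D.toMap ⟨_, hm⟩), D.sec_ae_eq hm rfl] with t h2 h3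
    rw [h3] at h2
    have h4 : (((1 + ‖ξ n t‖)⁻¹ : ℝ) : ℂ) ≠ 0 := by
      have : 0 < 1 + ‖ξ n t‖ := by positivity
      exact_mod_cast (inv_pos.2 this).ne'
    exact ((Q t).smul_mem_iff h4).1 h2
  filter_upwards [h1] with t ht
  rw [eq_top_iff, ← htot t]
  refine Submodule.topologicalClosure_minimal _ (Submodule.span_le.2 ?_) (hQ t)
  rintro _ ⟨n, rfl⟩
  exact ht n

end DirectIntegralIso

end DirectIntegralBasics

/-! ### Comparison of two equivalent fibres. -/

section Fibres

/-- Two fibres that are unitarily equivalent have the same eigenvalues. -/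
theorem eq_of_fibre_equiv {V W ι : Type*} [NormedAddCommGroup V] [InnerProductSpace ℂ V]
    [NormedAddCommGroup W] [InnerProductSpace ℂ W] [CompleteSpace W] (U : V ≃ₗᵢ[ℂ] W)
    {S : ι → ℕ → V →L[ℂ] V} {T : ι → ℕ → W →L[ℂ] W} (hT : ∀ i n, IsSelfAdjoint (T i n))
    (hU : ∀ i n x, U (S i n x) = T i n (U x)) {Ω : V} {v : ℕ → W} {w : ι → ℕ → W} {f g : ι → ℂ}
    (hs : ∀ i, Tendsto (fun n => S i n Ω) atTop (𝓝 (f i • Ω)))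
    (ht : ∀ i j, Tendsto (fun n => T i n (v j)) atTop (𝓝 (w i j))) (hw : ∀ i, w i 0 = g i • v 0)
    (hf : ∀ i, f i = 0 ∨ f i = 1) {r : ι → ℝ} (hpart : ∀ ε > 0, ∃ i, f i = 1 ∧ r i ≤ ε)
    {c : ℕ → ℝ} (hc : ∀ j, 0 ≤ c j)
    (hest : ∀ i j, ‖w i (j + 1)‖ ^ 2 ≤ c j * r i * ‖v (j + 1)‖ ^ 2) (hΩ : Ω ≠ 0)
    (htot : ∀ ζ, (∀ j, ⟪ζ, v j⟫_ℂ = 0) → ζ = 0) (i : ι) : f i = g i := by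
  set ζ := U Ω with hζ
  -- The limit of `⟨T i n ζ, v j⟩` is computed twice: `ζ` is an eigenvector in the limit by
  -- transport along `U`, and self-adjointness moves `T i n` to `v j`. No conjugate appears since `f
  -- i` is `0` or `1`.
  have key : ∀ i j, f i * ⟪ζ, v j⟫_ℂ = ⟪ζ, w i j⟫_ℂ := fun i j => by
    have h1 : Tendsto (fun n => ⟪T i n ζ, v j⟫_ℂ) atTop (𝓝 ⟪f i • ζ, v j⟫_ℂ) := by
      have := ((U.continuous.tendsto _).comp (hs i)).inner (𝕜 := ℂ) (tendsto_const_nhds (x := v j))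
      rw [map_smul] at this
      exact this.congr fun n => by rw [Function.comp_apply, hU]
    have h2 : Tendsto (fun n => ⟪T i n ζ, v j⟫_ℂ) atTop (𝓝 ⟪ζ, w i j⟫_ℂ) :=
      (tendsto_const_nhds.inner (ht i j)).congr fun n => ((hT i n).isSymmetric ζ (v j)).symm
    have h3 := tendsto_nhds_unique h1 h2
    rw [inner_smul_left] at h3
    rcases hf i with h | h <;> rw [h] at h3 ⊢ <;> simpa using h3
  -- An index `i` with `f i = 1` and small `r i` replaces `v (j + 1)` by the small vector `w i (j +
  -- 1)`. Index `0` is excluded: it is kept for the fibre of `1`.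
  have hzero : ∀ j, ⟪ζ, v (j + 1)⟫_ℂ = 0 := by
    intro j
    have h1 : ∀ ε > 0, ‖⟪ζ, v (j + 1)⟫_ℂ‖ ^ 2 ≤ ε * (‖ζ‖ ^ 2 * (c j * ‖v (j + 1)‖ ^ 2)) := by
      intro ε hε
      obtain ⟨i, hi, hr⟩ := hpart ε hε
      have h2 := key i (j + 1)
      rw [hi, one_mul] at h2
      rw [h2]
      calc ‖⟪ζ, w i (j + 1)⟫_ℂ‖ ^ 2 ≤ (‖ζ‖ * ‖w i (j + 1)‖) ^ 2 := by
            gcongr; exact norm_inner_le_norm _ _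
        _ = ‖ζ‖ ^ 2 * ‖w i (j + 1)‖ ^ 2 := mul_pow _ _ _
        _ ≤ ‖ζ‖ ^ 2 * (c j * ε * ‖v (j + 1)‖ ^ 2) := by
            refine mul_le_mul_of_nonneg_left ((hest i j).trans ?_) (by positivity)
            have := hc j
            gcongr
        _ = _ := by ring
    have hlim : Tendsto (fun ε : ℝ => ε * (‖ζ‖ ^ 2 * (c j * ‖v (j + 1)‖ ^ 2))) (𝓝[>] 0) (𝓝 0) := by
      have : Tendsto (fun ε : ℝ => ε * (‖ζ‖ ^ 2 * (c j * ‖v (j + 1)‖ ^ 2))) (𝓝 0) (𝓝 (0 * _)) :=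
        tendsto_id.mul_const _
      rw [zero_mul] at this
      exact this.mono_left nhdsWithin_le_nhds
    have h3 : ‖⟪ζ, v (j + 1)⟫_ℂ‖ ^ 2 ≤ 0 := by
      refine ge_of_tendsto hlim ?_
      filter_upwards [self_mem_nhdsWithin] with ε hε using h1 ε hε
    exact norm_eq_zero.1 (pow_eq_zero_iff two_ne_zero |>.1 (le_antisymm h3 (by positivity)))
  have h0 : ⟪ζ, v 0⟫_ℂ ≠ 0 := by
    intro h
    have h1 : ζ = 0 := htot ζ fun j => by cases j with
      | zero => exact h
      | succ j => exact hzero j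
    exact hΩ (U.map_eq_zero_iff.1 h1)
  have h1 := key i 0
  rw [hw, inner_smul_right] at h1
  exact mul_right_cancel₀ h0 h1

end Fibres

/-! ### The actions of `A` and `B` on sections. -/

section TakesakiSections

variable {H : Type u} [NormedAddCommGroup H] [InnerProductSpace ℂ H] [CompleteSpace H]
  {M : VonNeumannAlgebra H} {τ : Trace M} {A : VonNeumannAlgebra H}
  {hAM : A ≤ M} {B : NonUnitalStarSubalgebra ℂ (H →L[ℂ] H)} {hB : IsDenseSeparable M B}
  {Y : Type} [MeasurableSpace Y] {ν : Measure Y} {F : Y → Type}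
  [∀ t, NormedAddCommGroup (F t)] [∀ t, InnerProductSpace ℂ (F t)]
  [∀ t, CompleteSpace (F t)]

namespace TakesakiData

variable (D : TakesakiData τ A hAM B hB Y ν F)

/-- The function on `Y` that corresponds to an element of `A`. -/
def fn {a : M} (ha : (a : H →L[ℂ] H) ∈ A) : Y → ℂ := D.iso.toEquiv ⟨a, ha⟩

theorem sec_right {a : M} (ha : (a : H →L[ℂ] H) ∈ A) (α : τ.L2) :
    ∀ᵐ t ∂ν, D.unitary.sec (τ.right a α) t = D.fn ha t • D.unitary.sec α t := by
  have hm : Measurable (D.fn ha) := (Lp.stronglyMeasurable (D.iso.toEquiv ⟨a, ha⟩)).measurable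
  have hb : ∀ᵐ t ∂ν, ‖D.fn ha t‖ ≤ ‖D.iso.toEquiv ⟨a, ha⟩‖ := by
    rw [Lp.norm_def, eLpNorm_exponent_top]
    filter_upwards [ae_le_eLpNormEssSup (f := D.fn ha) (μ := ν)] with t ht
    have h1 := ENNReal.toReal_mono (by
      rw [← eLpNorm_exponent_top]; exact Lp.eLpNorm_ne_top (D.iso.toEquiv ⟨a, ha⟩)) ht
    rwa [toReal_enorm] at h1
  have hmem := D.field.bounded_smul_mem hm hb (D.unitary.sec_mem α)
  refine D.unitary.sec_ae_eq hmem ?_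
  rw [D.diagonal ⟨a, ha⟩ ⟨_, D.unitary.sec_mem α⟩ ⟨_, hmem⟩ (Eventually.of_forall fun t => rfl),
    D.unitary.toMap_sec]

theorem norm_rep_le (b : B) (t : Y) : ‖D.rep t b‖ ≤ ‖b‖ := by
  have : IsClosed (B : Set (H →L[ℂ] H)) := hB.isClosed
  exact NonUnitalStarAlgHom.norm_apply_le (D.rep t) b

theorem sec_left {b : M} (hb : (b : H →L[ℂ] H) ∈ B) (α : τ.L2) :
    ∀ᵐ t ∂ν, D.unitary.sec (τ.left b α) t = D.rep t ⟨b, hb⟩ (D.unitary.sec α t) := by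
  have hmem := D.field.bounded_map_mem (fun t => D.norm_rep_le ⟨b, hb⟩ t) (D.unitary.sec_mem α)
    (D.rep_measurable _ _ (D.unitary.sec_mem α).1)
  refine D.unitary.sec_ae_eq hmem ?_
  rw [D.rep_decomposes ⟨b, hb⟩ ⟨_, D.unitary.sec_mem α⟩ ⟨_, hmem⟩
    (Eventually.of_forall fun t => rfl), D.unitary.toMap_sec]

theorem fn_eq_zero_or_one {e : M} (he : (e : H →L[ℂ] H) ∈ A) (hp : IsStarProjection e) :
    ∀ᵐ t ∂ν, D.fn he t = 0 ∨ D.fn he t = 1 := by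
  have h := D.iso.map_mul ⟨e, he⟩ ⟨e, he⟩
  have h0 : (e : H →L[ℂ] H) * e = e := congrArg Subtype.val hp.isIdempotentElem.eq
  have h1 : (⟨e, he⟩ : A) * ⟨e, he⟩ = ⟨e, he⟩ := Subtype.ext h0
  rw [h1] at h
  filter_upwards [h] with t ht
  change D.fn he t = D.fn he t * D.fn he t at ht
  rcases eq_or_ne (D.fn he t) 0 with h0 | h0
  · exact Or.inl h0
  · exact Or.inr (mul_left_cancel₀ h0 (by rw [← ht, mul_one]))

variable [IsFiniteMeasure ν]

/-- The projection of `A` that corresponds to a measurable set. -/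
def proj {E : Set Y} (hE : MeasurableSet E) : M :=
  ⟨D.iso.toEquiv.symm (indicatorConstLp ∞ hE (measure_ne_top ν E) 1),
    hAM (D.iso.toEquiv.symm (indicatorConstLp ∞ hE (measure_ne_top ν E) 1)).2⟩

theorem proj_mem {E : Set Y} (hE : MeasurableSet E) : (D.proj hE : H →L[ℂ] H) ∈ A :=
  (D.iso.toEquiv.symm (indicatorConstLp ∞ hE (measure_ne_top ν E) 1)).2

theorem fn_proj {E : Set Y} (hE : MeasurableSet E) :
    ∀ᵐ t ∂ν, D.fn (D.proj_mem hE) t = E.indicator (fun _ => 1) t := by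
  have h : D.fn (D.proj_mem hE) = (indicatorConstLp ∞ hE (measure_ne_top ν E) (1 : ℂ) : Y → ℂ) := by
    change ((D.iso.toEquiv (D.iso.toEquiv.symm _) : Lp ℂ ∞ ν) : Y → ℂ) = _
    rw [LinearEquiv.apply_symm_apply]
  rw [h]
  exact indicatorConstLp_coeFn

theorem isStarProjection_proj {E : Set Y} (hE : MeasurableSet E) : IsStarProjection (D.proj hE) := by
  have hinj : ∀ {a b : A}, (∀ᵐ t ∂ν, D.iso.toEquiv a t = D.iso.toEquiv b t) → a = b := fun h =>
    D.iso.toEquiv.injective (Lp.ext h)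
  let p : A := ⟨D.proj hE, D.proj_mem hE⟩
  have hp : ∀ᵐ t ∂ν, D.iso.toEquiv p t = E.indicator (fun _ => 1) t := D.fn_proj hE
  have h1 : p * p = p := hinj (by
    filter_upwards [D.iso.map_mul p p, hp] with t h1 h2
    rw [h1, h2]
    by_cases ht : t ∈ E <;> simp [ht])
  have h2 : star p = p := hinj (by
    filter_upwards [D.iso.map_star p, hp] with t h1 h2
    rw [h1, h2]
    by_cases ht : t ∈ E <;> simp [ht])
  have h3 : (D.proj hE : H →L[ℂ] H) * D.proj hE = D.proj hE := congrArg Subtype.val h1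
  have h4 : star (D.proj hE : H →L[ℂ] H) = D.proj hE := congrArg Subtype.val h2
  exact ⟨Subtype.ext h3, Subtype.ext h4⟩

/-- Integrals of fibre norms over arbitrary measurable sets become norms in `L²(M)`, where the
bimodule structure can be used. This is how fibrewise identities are derived. -/
theorem norm_right_proj_sq {E : Set Y} (hE : MeasurableSet E) (α : τ.L2) :
    ‖τ.right (D.proj hE) α‖ ^ 2 = ∫ t in E, ‖D.unitary.sec α t‖ ^ 2 ∂ν := by
  rw [D.unitary.norm_sq_eq, ← integral_indicator hE]
  refine integral_congr_ae ?_
  filter_upwards [D.sec_right (D.proj_mem hE) α, D.fn_proj hE] with t h1 h2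
  rw [h1, h2]
  by_cases ht : t ∈ E <;> simp [ht]

/-- The projection of `A` belonging to the zero set of the section kills the vector of `1`, so it is
`0` and the set is null. -/
theorem sec_one_ne_zero : ∀ᵐ t ∂ν, D.unitary.sec (τ.vec 1) t ≠ 0 := by
  set E : Set Y := {t | D.unitary.sec (τ.vec 1) t = 0} with hEdef
  have hE : MeasurableSet E := by
    have : E = {t | ‖D.unitary.sec (τ.vec 1) t‖ = 0} := by ext t; simp [hEdef]
    rw [this]
    exact measurableSet_eq_fun (D.field.measurable_norm _ (D.unitary.sec_mem _).1) measurable_const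
  have h1 := D.norm_right_proj_sq hE (τ.vec 1)
  rw [setIntegral_congr_fun hE (g := fun _ => (0 : ℝ)) (fun t ht => by
    have : D.unitary.sec (τ.vec 1) t = 0 := ht
    simp [this]), integral_zero, ← τ.vec_eq_right, sq_eq_zero_iff, norm_eq_zero] at h1
  have h2 : D.proj hE = 0 := τ.vec_eq_zero h1
  have h2' : (D.proj hE : H →L[ℂ] H) = 0 := congrArg Subtype.val h2
  have h3 : indicatorConstLp ∞ hE (measure_ne_top ν E) (1 : ℂ) = 0 := by
    have h4 : D.iso.toEquiv.symm (indicatorConstLp ∞ hE (measure_ne_top ν E) (1 : ℂ)) = 0 :=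
      Subtype.ext h2'
    exact (LinearEquiv.map_eq_zero_iff _).1 h4
  have h5 := indicatorConstLp_coeFn (p := ∞) (hs := hE) (hμs := measure_ne_top ν E) (c := (1 : ℂ))
  rw [h3] at h5
  filter_upwards [h5, Lp.coeFn_zero ℂ ∞ ν] with t h6 h7 ht
  rw [h7, Set.indicator_of_mem (show t ∈ E from ht)] at h6
  exact zero_ne_one h6

variable {K : Type v} [NormedAddCommGroup K] [InnerProductSpace ℂ K]
  (C : CoarseDecomposition τ A K)

/-- Projections of small trace are fibrewise small on elementary tensors. -/
theorem exists_norm_sec_le {a b : M} (ha : (a : H →L[ℂ] H) ∈ A) (hb : (b : H →L[ℂ] H) ∈ A) (k : K) :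
    ∃ c : ℝ, 0 ≤ c ∧ ∀ e : M, (e : H →L[ℂ] H) ∈ A → IsStarProjection e → ∀ᵐ t ∂ν,
      ‖D.unitary.sec (τ.left e (C.coarse (tmul (τ.vecA ha) k (τ.vecA hb)))) t‖ ^ 2 ≤
        c * (τ.toFunctional e).re *
          ‖D.unitary.sec (C.coarse (tmul (τ.vecA ha) k (τ.vecA hb))) t‖ ^ 2 := by
  set η := C.coarse (tmul (τ.vecA ha) k (τ.vecA hb)) with hη
  by_cases h0 : ‖τ.vec a‖ = 0
  · have hη0 : η = 0 := by
      rw [← norm_eq_zero, hη, C.coarse.norm_map, norm_tmul, τ.norm_vecA, h0, zero_mul, zero_mul]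
    refine ⟨0, le_rfl, fun e he hp => ?_⟩
    rw [hη0, map_zero]
    filter_upwards [D.unitary.sec_zero] with t ht
    rw [ht]; simp
  · refine ⟨(‖a‖ / ‖τ.vec a‖) ^ 2, by positivity, fun e he hp => ?_⟩
    -- Cutting by a measurable set acts on the right leg and `e` on the left leg, so both sides have
    -- the same integral over every measurable set.
    have heq : (fun t => ‖τ.vec a‖ ^ 2 * ‖D.unitary.sec (τ.left e η) t‖ ^ 2) =ᵐ[ν]
        fun t => ‖τ.vec (e * a)‖ ^ 2 * ‖D.unitary.sec η t‖ ^ 2 := by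
      refine Integrable.ae_eq_of_forall_setIntegral_eq _ _
        ((D.unitary.integrable_sec _).const_mul _) ((D.unitary.integrable_sec _).const_mul _)
        fun E hE _ => ?_
      rw [integral_const_mul, integral_const_mul, ← D.norm_right_proj_sq hE,
        ← D.norm_right_proj_sq hE, ← τ.left_right_apply, hη, C.right_coarse_tmul (D.proj_mem hE),
        C.left_coarse_tmul he, C.coarse.norm_map, C.coarse.norm_map, norm_tmul, norm_tmul,
        τ.leftA_vecA, τ.norm_vecA, τ.norm_vecA]
      ring
    filter_upwards [heq] with t ht
    have h1 : ‖τ.vec (e * a)‖ ^ 2 ≤ ‖a‖ ^ 2 * (τ.toFunctional e).re := by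
      rw [← τ.norm_vec_sq_of_isStarProjection hp, ← mul_pow]
      gcongr
      exact τ.norm_right_vec_le a e
    have h2 : 0 < ‖τ.vec a‖ ^ 2 := by positivity
    rw [div_pow, div_mul_eq_mul_div, div_mul_eq_mul_div, le_div_iff₀ h2, mul_comm, ht]
    gcongr

end TakesakiData

/-- A countable dense family of elementary tensors. -/
theorem CoarseDecomposition.exists_dense_seq {K : Type v} [NormedAddCommGroup K]
    [InnerProductSpace ℂ K] (C : CoarseDecomposition τ A K) [TopologicalSpace.SeparableSpace τ.L2] :
    ∃ η : ℕ → τ.L2, (∀ j, ∃ (a b : M) (ha : (a : H →L[ℂ] H) ∈ A) (hb : (b : H →L[ℂ] H) ∈ A) (k : K),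
      η j = C.coarse (tmul (τ.vecA ha) k (τ.vecA hb))) ∧
      ∀ (a b : M) (ha : (a : H →L[ℂ] H) ∈ A) (hb : (b : H →L[ℂ] H) ∈ A) (k : K),
        C.coarse (tmul (τ.vecA ha) k (τ.vecA hb)) ∈ closure (Set.range η) := by
  set G : Set τ.L2 := {ξ | ∃ (a b : M) (ha : (a : H →L[ℂ] H) ∈ A) (hb : (b : H →L[ℂ] H) ∈ A) (k : K),
    ξ = C.coarse (tmul (τ.vecA ha) k (τ.vecA hb))} with hG
  obtain ⟨s, hsG, hs, hGs⟩ :=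
    (TopologicalSpace.IsSeparable.of_separableSpace G).exists_countable_dense_subset
  have h1A : ((1 : M) : H →L[ℂ] H) ∈ A := one_mem A
  have hne : s.Nonempty := by
    rw [Set.nonempty_iff_ne_empty]
    rintro rfl
    have := hGs ⟨1, 1, h1A, h1A, 0, rfl⟩
    simp at this
  obtain ⟨η, rfl⟩ := hs.exists_eq_range hne
  exact ⟨η, fun j => hsG ⟨j, rfl⟩, fun a b ha hb k => hGs ⟨a, b, ha, hb, k, rfl⟩⟩

end TakesakiSections

/-! ### Takesaki simplicity. -/

section TakesakiSimple

variable {H : Type u} [NormedAddCommGroup H] [InnerProductSpace ℂ H] [CompleteSpace H]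
  {M : VonNeumannAlgebra H} {τ : Trace M} {A : VonNeumannAlgebra H}
  {hAM : A ≤ M} {K : Type v} [NormedAddCommGroup K] [InnerProductSpace ℂ K]

namespace TakesakiData

variable {B : NonUnitalStarSubalgebra ℂ (H →L[ℂ] H)} {hB : IsDenseSeparable M B}
  {Y : Type} [MeasurableSpace Y] {ν : Measure Y} {F : Y → Type}
  [∀ t, NormedAddCommGroup (F t)] [∀ t, InnerProductSpace ℂ (F t)]
  [∀ t, CompleteSpace (F t)] (D : TakesakiData τ A hAM B hB Y ν F)

/-- Self-adjoint elements of `M` are fibrewise limits of elements of `B`, on countably many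
vectors. -/
theorem exists_tendsto_rep {e : M} (he : IsSelfAdjoint e) (v : ℕ → τ.L2) :
    ∃ b : ℕ → B, (∀ n, IsSelfAdjoint (b n)) ∧ ∀ᵐ t ∂ν, ∀ j,
      Tendsto (fun n => D.rep t (b n) (D.unitary.sec (v j) t)) atTop
        (𝓝 (D.unitary.sec (τ.left e (v j)) t)) := by
  -- The `n`-th approximant handles the first `n` vectors with error `2⁻ⁿ`. Each vector is
  -- eventually handled, at a rate that forces convergence of the sections almost everywhere.
  choose b hbB hb hlim using fun n : ℕ =>
    τ.exists_approx hB he (fun j : Fin n => v j) (ε := (1 / 2) ^ n) (by positivity)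
  refine ⟨fun n => ⟨b n, hbB n⟩, fun n => ?_, ?_⟩
  · have h0 : star (b n : H →L[ℂ] H) = b n := congrArg Subtype.val (hb n)
    exact Subtype.ext h0
  · rw [ae_all_iff]
    intro j
    have h1 : ∀ᵐ t ∂ν, ∀ n, D.unitary.sec (τ.left (b n) (v j)) t =
        D.rep t ⟨b n, hbB n⟩ (D.unitary.sec (v j) t) :=
      ae_all_iff.2 fun n => D.sec_left (hbB n) (v j)
    have h2 : ∀ᶠ n in atTop, ‖τ.left (b n) (v j) - τ.left e (v j)‖ ≤ (1 / 2) ^ n := by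
      filter_upwards [eventually_gt_atTop j] with n hn
      exact (hlim n ⟨j, hn⟩).le
    filter_upwards [h1, D.unitary.tendsto_sec h2] with t h3 h4
    exact h4.congr h3

/-- Almost every point lies in a piece of a partition. -/
theorem exists_fn_eq_one [IsFiniteMeasure ν] {ε : ℝ} (P : τ.Partition A ε) :
    ∀ᵐ t ∂ν, ∃ i, D.fn (P.mem i) t = 1 := by
  have h1 : ∑ i ∈ Finset.range P.len, τ.right (P.proj i) (τ.vec 1) = τ.vec 1 := by
    simp_rw [← τ.vec_eq_right]
    rw [← τ.vec_sum, P.sum]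
  have h2 := D.unitary.sec_sum (Finset.range P.len) fun i => τ.right (P.proj i) (τ.vec 1)
  rw [h1] at h2
  have h3 : ∀ᵐ t ∂ν, ∀ i, D.unitary.sec (τ.right (P.proj i) (τ.vec 1)) t =
      D.fn (P.mem i) t • D.unitary.sec (τ.vec 1) t :=
    ae_all_iff.2 fun i => D.sec_right (P.mem i) _
  have h4 : ∀ᵐ t ∂ν, ∀ i, D.fn (P.mem i) t = 0 ∨ D.fn (P.mem i) t = 1 :=
    ae_all_iff.2 fun i => D.fn_eq_zero_or_one (P.mem i) (P.isProj i)
  filter_upwards [h2, h3, h4, D.sec_one_ne_zero] with t h2 h3 h4 h5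
  by_contra! h
  refine h5 ?_
  rw [h2]
  refine Finset.sum_eq_zero fun i _ => ?_
  rw [h3, (h4 i).resolve_right (h i), zero_smul]

/-- The sections of `1` and of a dense sequence of elementary tensors are fibrewise total. -/
theorem ae_eq_zero_of_inner [IsFiniteMeasure ν] (C : CoarseDecomposition τ A K) (hA : IsAbelian A)
    (hd : HasNoMinimalProjection A) {η : ℕ → τ.L2}
    (hη : ∀ (a b : M) (ha : (a : H →L[ℂ] H) ∈ A) (hb : (b : H →L[ℂ] H) ∈ A) (k : K),
      C.coarse (tmul (τ.vecA ha) k (τ.vecA hb)) ∈ closure (Set.range η)) :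
    ∀ᵐ t ∂ν, ∀ ζ : F t, ⟪ζ, D.unitary.sec (τ.vec 1) t⟫_ℂ = 0 →
      (∀ j, ⟪ζ, D.unitary.sec (η j) t⟫_ℂ = 0) → ζ = 0 := by
  -- The vectors with sections in the closed spans `Q t` form a closed subspace. It contains `A`,
  -- since `a = 1 · a` is fibrewise a multiple of the section of `1`, and it contains the elementary
  -- tensors; hence it is everything.
  let Q : ∀ t, Submodule ℂ (F t) := fun t =>
    (Submodule.span ℂ (insert (D.unitary.sec (τ.vec 1) t)
      (Set.range fun j => D.unitary.sec (η j) t))).topologicalClosure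
  have hQc : ∀ t, IsClosed (Q t : Set (F t)) := fun t => Submodule.isClosed_topologicalClosure _
  have hsub : ∀ t, insert (D.unitary.sec (τ.vec 1) t) (Set.range fun j => D.unitary.sec (η j) t) ⊆
      (Q t : Set (F t)) := fun t => Submodule.subset_span.trans subset_closure
  have hW := D.unitary.isClosed_fieldSubmodule hQc
  have hvec : ∀ a : M, (a : H →L[ℂ] H) ∈ A → τ.vec a ∈ D.unitary.fieldSubmodule Q := by
    intro a ha
    rw [τ.vec_eq_right]
    change ∀ᵐ t ∂ν, _ ∈ Q t
    filter_upwards [D.sec_right ha (τ.vec 1)] with t ht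
    rw [ht]
    exact (Q t).smul_mem _ (hsub t (Set.mem_insert _ _))
  have htriv : ∀ x, C.triv x ∈ D.unitary.fieldSubmodule Q := by
    intro x
    refine closure_minimal ?_ hW (τ.mem_L2sub_iff.1 ((C.range_triv hAM hA hd).1 ⟨x, rfl⟩))
    rintro _ ⟨a, ha, rfl⟩
    exact hvec a ha
  have hη' : Set.range η ⊆ (D.unitary.fieldSubmodule Q : Set τ.L2) := by
    rintro _ ⟨j, rfl⟩
    change ∀ᵐ t ∂ν, D.unitary.sec (η j) t ∈ Q t
    exact Eventually.of_forall fun t => hsub t (Set.mem_insert_of_mem _ ⟨j, rfl⟩)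
  have hcoarse := C.coarse_mem_of_vecA hW fun a b ha hb k => closure_minimal hη' hW (hη a b ha hb k)
  have htop := D.unitary.eq_top_of_fieldSubmodule hQc fun α => by
    obtain ⟨x, y, rfl⟩ := C.exists_eq_add α
    exact Submodule.add_mem _ (htriv x) (hcoarse y)
  filter_upwards [htop] with t ht ζ h1 h2
  have h3 : Q t ≤ (ℂ ∙ ζ)ᗮ := by
    refine Submodule.topologicalClosure_minimal _ (Submodule.span_le.2 ?_)
      (Submodule.isClosed_orthogonal _)
    rintro _ (rfl | ⟨j, rfl⟩)
    · exact Submodule.mem_orthogonal_singleton_iff_inner_right.2 h1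
    · exact Submodule.mem_orthogonal_singleton_iff_inner_right.2 (h2 j)
  have h4 : ζ ∈ (ℂ ∙ ζ)ᗮ := h3 (ht ▸ Submodule.mem_top)
  exact inner_self_eq_zero.1 (Submodule.mem_orthogonal_singleton_iff_inner_right.1 h4)

end TakesakiData

theorem mem_iff_of_indicator_eq {Y : Type*} {E : Set Y} {s t : Y}
    (h : E.indicator (fun _ => (1 : ℂ)) s = E.indicator (fun _ => 1) t) : s ∈ E ↔ t ∈ E := by
  by_cases hs : s ∈ E <;> by_cases ht : t ∈ E <;> simp_all

theorem CoarseDecomposition.isTakesakiSimple (C : CoarseDecomposition τ A K) (hAM : A ≤ M)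
    (hA : IsAbelian A) (hd : HasNoMinimalProjection A) [TopologicalSpace.SeparableSpace τ.L2] :
    IsTakesakiSimple τ A hAM := by
  intro B hB Y _ _ ν _ F _ _ _ D
  obtain ⟨η, hη, hdense⟩ := C.exists_dense_seq
  obtain ⟨φ, hφ, hinj⟩ := MeasurableSpace.measurable_injection_nat_bool_of_countablySeparated Y
  have hE : ∀ k, MeasurableSet {t | φ t k = true} := fun k =>
    measurableSet_eq_fun ((measurable_pi_apply k).comp hφ) measurable_const
  have P : ∀ m : ℕ, τ.Partition A (1 / (m + 1)) := fun m =>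
    (τ.exists_partition hAM hd Nat.one_div_pos_of_nat).some
  -- The left summand indexes projections whose functions separate the points of `Y`, the right one
  -- the pieces of partitions of mesh `1 / (m + 1)`. Countability leaves a single null set to
  -- discard.
  let e : ℕ ⊕ ℕ × ℕ → M := Sum.elim (fun k => D.proj (hE k)) fun p => (P p.1).proj p.2
  have heA : ∀ i, (e i : H →L[ℂ] H) ∈ A := by
    rintro (k | p)
    · exact D.proj_mem (hE k)
    · exact (P p.1).mem p.2
  have hep : ∀ i, IsStarProjection (e i) := by
    rintro (k | p)
    · exact D.isStarProjection_proj (hE k)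
    · exact (P p.1).isProj p.2
  let w : ℕ → τ.L2 := fun j => Nat.casesOn j (τ.vec 1) η
  choose b hb hlim using fun i => D.exists_tendsto_rep (hep i).isSelfAdjoint w
  have hη' : ∀ j, ∃ c : ℝ, 0 ≤ c ∧ ∀ e : M, (e : H →L[ℂ] H) ∈ A → IsStarProjection e →
      ∀ᵐ t ∂ν, ‖D.unitary.sec (τ.left e (η j)) t‖ ^ 2 ≤
        c * (τ.toFunctional e).re * ‖D.unitary.sec (η j) t‖ ^ 2 := by
    intro j
    obtain ⟨x, y, hx, hy, k, h⟩ := hη j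
    rw [h]
    exact D.exists_norm_sec_le C hx hy k
  choose c hc hest using hη'
  have h1 : ∀ᵐ t ∂ν, ∀ i j, Tendsto (fun n => D.rep t (b i n) (D.unitary.sec (w j) t)) atTop
      (𝓝 (D.unitary.sec (τ.left (e i) (w j)) t)) := ae_all_iff.2 hlim
  -- Left and right multiplication agree on the vector of `1`, and the right one is diagonal: the
  -- fibre of `1` is an eigenvector.
  have h2 : ∀ᵐ t ∂ν, ∀ i, D.unitary.sec (τ.left (e i) (τ.vec 1)) t =
      D.fn (heA i) t • D.unitary.sec (τ.vec 1) t := by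
    rw [ae_all_iff]
    intro i
    rw [← τ.vec_eq_left, τ.vec_eq_right]
    exact D.sec_right (heA i) _
  have h3 : ∀ᵐ t ∂ν, ∀ i, D.fn (heA i) t = 0 ∨ D.fn (heA i) t = 1 :=
    ae_all_iff.2 fun i => D.fn_eq_zero_or_one (heA i) (hep i)
  have h4 : ∀ᵐ t ∂ν, ∀ m, ∃ i, D.fn (heA (Sum.inr (m, i))) t = 1 :=
    ae_all_iff.2 fun m => D.exists_fn_eq_one (P m)
  have h5 : ∀ᵐ t ∂ν, ∀ i j, ‖D.unitary.sec (τ.left (e i) (η j)) t‖ ^ 2 ≤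
      c j * (τ.toFunctional (e i)).re * ‖D.unitary.sec (η j) t‖ ^ 2 :=
    ae_all_iff.2 fun i => ae_all_iff.2 fun j => hest j (e i) (heA i) (hep i)
  have h6 : ∀ᵐ t ∂ν, ∀ k, D.fn (heA (Sum.inl k)) t = {t | φ t k = true}.indicator (fun _ => 1) t :=
    ae_all_iff.2 fun k => D.fn_proj (hE k)
  have hgood := h1.and (h2.and (h3.and (h4.and (h5.and (h6.and (D.sec_one_ne_zero.and
    (D.ae_eq_zero_of_inner C hA hd hdense)))))))
  refine ⟨_, measurableSet_toMeasurable ν _, (measure_toMeasurable _).trans (ae_iff.1 hgood),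
    fun s hs t ht => ⟨?_, ?_⟩⟩
  · obtain ⟨s1, s2, s3, s4, s5, s6, s7, s8⟩ := not_not.1 fun h => hs (subset_toMeasurable ν _ h)
    obtain ⟨t1, t2, t3, t4, t5, t6, t7, t8⟩ := not_not.1 fun h => ht (subset_toMeasurable ν _ h)
    rintro ⟨U, hU⟩
    have key : ∀ i, D.fn (heA i) s = D.fn (heA i) t := by
      refine eq_of_fibre_equiv U (S := fun i n => D.rep s (b i n)) (T := fun i n => D.rep t (b i n))
        (fun i n => (hb i n).map (D.rep t)) (fun i n => hU (b i n))
        (Ω := D.unitary.sec (τ.vec 1) s) (v := fun j => D.unitary.sec (w j) t)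
        (w := fun i j => D.unitary.sec (τ.left (e i) (w j)) t)
        (fun i => ?_) t1 t2 s3 (r := fun i => (τ.toFunctional (e i)).re) (fun ε hε => ?_) hc t5 s7
        (fun ζ hζ => t8 ζ (hζ 0) fun j => hζ (j + 1))
      · rw [← s2]
        exact s1 i 0
      · obtain ⟨m, hm⟩ := exists_nat_one_div_lt hε
        obtain ⟨i, hi⟩ := s4 m
        exact ⟨Sum.inr (m, i), hi, ((P m).small i).trans hm.le⟩
    refine hinj (funext fun k => ?_)
    have h7 := key (Sum.inl k)
    rw [s6, t6] at h7
    exact Bool.eq_iff_iff.2 (mem_iff_of_indicator_eq h7)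
  · rintro rfl
    exact ⟨LinearIsometryEquiv.refl ℂ _, fun _ _ => rfl⟩

end TakesakiSimple

end CoarseMasa

end

theorem mainTheorem6 {H : Type u} [NormedAddCommGroup H] [InnerProductSpace ℂ H] [CompleteSpace H]
    (M A : VonNeumannAlgebra H) (τ : CoarseMasa.Trace M) (hAM : A ≤ M)
    (hA : CoarseMasa.IsAbelian A) (hdiffuse : CoarseMasa.HasNoMinimalProjection A)
    (K : Type v) [NormedAddCommGroup K] [InnerProductSpace ℂ K] [CompleteSpace K] [Nontrivial K]
    (hiso : Nonempty (CoarseMasa.CoarseDecomposition τ A K)) :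
    CoarseMasa.IsII1Factor M ∧ CoarseMasa.IsMasa A M ∧ CoarseMasa.IsSingular A M ∧
      CoarseMasa.pukanszkyInvariant τ A = {Cardinal.toENat (Module.rank ℂ K)} ∧
      (TopologicalSpace.SeparableSpace τ.L2 → CoarseMasa.IsTakesakiSimple τ A hAM) := by
  obtain ⟨C⟩ := hiso
  refine ⟨⟨C.isFactor hAM hA hdiffuse, τ.isFinite, τ.hasNoMinimalProjection hAM hdiffuse⟩,
    C.isMasa hAM hA hdiffuse, C.isSingular hAM hA hdiffuse,
    C.pukanszkyInvariant_eq hAM hA hdiffuse, fun _ => C.isTakesakiSimple hAM hA hdiffuse⟩
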